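/- **Setting.** Let $\Bbbk$ be a field and $A=A_0\oplus A_1$ an associative unital $\Bbbk$-superalgebra with an anti-involution $\mathrm{inv}$, i.e. an even $\Bbbk$-linear map $a\mapsto a^{\mathrm{inv}}$ with $(a^{\mathrm{inv}})^{\mathrm{inv}}=a$ and $(ab)^{\mathrm{inv}}=(-1)^{\bar a\bar b}b^{\mathrm{inv}}a^{\mathrm{inv}}$ for homogeneous $a,b$ ($\bar a$ is the parity of $a$). If $A$ is finite-dimensional, put $\mathrm{str}_A(a)=\sum_b(-1)^{\bar b}\,b^*(ba)$, the sum being over a homogeneous basis of $A$. In a strict monoidal supercategory, $(f'\otimes g)\circ(f\otimes g')=(-1)^{\bar f\bar g}(f'\circ f)\otimes(g\circ g')$ for homogeneous $f,g$. Below $1$ denotes identity morphisms of the evident objects, and also the unit of $A$; in the relations $a,b$ run over $A$ and $\lambda,\mu$ over $\Bbbk$, and juxtaposition of morphisms is composition $f\circ g$; tokens $t_a$ and $\tau_a$ have parity $\bar a$ for homogeneous $a$. *$\mathcal{OB}(A)$* is the strict monoidal supercategory with generating objects $\uparrow,\downarrow$ and generating morphisms $s:\uparrow\uparrow\to\uparrow\uparrow$,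 $t_a:\uparrow\to\uparrow$ ($a\in A$), $\mathrm{cap}_l:\downarrow\uparrow\to\mathbb 1$, $\mathrm{cup}_l:\mathbb 1\to\uparrow\downarrow$, $\mathrm{cap}_r:\uparrow\downarrow\to\mathbb 1$, $\mathrm{cup}_r:\mathbb 1\to\downarrow\uparrow$, all even except the tokens, subject to: $t_1=1$, $t_{\lambda a+\mu b}=\lambda t_a+\mu t_b$, $t_a t_b=t_{ab}$; $s^2=1$, $(s\otimes1)(1\otimes s)(s\otimes1)=(1\otimes s)(s\otimes1)(1\otimes s)$, $s(t_a\otimes1)=(1\otimes t_a)s$; $(\mathrm{cap}_l\otimes1_\downarrow)(1_\downarrow\otimes\mathrm{cup}_l)=1_\downarrow$, $(1_\uparrow\otimes\mathrm{cap}_l)(\mathrm{cup}_l\otimes1_\uparrow)=1_\uparrow$; $s_ls_r=1_{\uparrow\downarrow}$, $s_rs_l=1_{\downarrow\uparrow}$; $(\mathrm{cap}_l\otimes1_\uparrow)(1_\downarrow\otimes s)(\mathrm{cup}_r\otimes1_\uparrow)=1_\uparrow=(1_\uparrow\otimes\mathrm{cap}_r)(s\otimes1_\downarrow)(1_\uparrow\otimes\mathrm{cup}_l)$.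 Here $$s_r=(1_{\downarrow\uparrow}\otimes\mathrm{cap}_r)(1_\downarrow\otimes s\otimes1_\downarrow)(\mathrm{cup}_r\otimes1_{\uparrow\downarrow}):\uparrow\downarrow\to\downarrow\uparrow,\qquad s_l=(\mathrm{cap}_l\otimes1_{\uparrow\downarrow})(1_\downarrow\otimes s\otimes1_\downarrow)(1_{\downarrow\uparrow}\otimes\mathrm{cup}_l):\downarrow\uparrow\to\uparrow\downarrow .$$ Put also $s_d=(1_{\downarrow\downarrow}\otimes\mathrm{cap}_r)(1_\downarrow\otimes s_r\otimes1_\downarrow)(\mathrm{cup}_r\otimes1_{\downarrow\downarrow}):\downarrow\downarrow\to\downarrow\downarrow$ and $t^{\downarrow}_a=(1_\downarrow\otimes\mathrm{cap}_r)(1_\downarrow\otimes t_a\otimes1_\downarrow)(\mathrm{cup}_r\otimes1_\downarrow):\downarrow\to\downarrow$. For $A$ finite-dimensional and $d\in\Bbbk$, $\mathcal{OB}(A;d)$ is the quotient by the relations $\mathrm{cap}_l(1_\downarrow\otimes t_a)\mathrm{cup}_r=d\,\mathrm{str}_A(a)\,1_{\mathbb 1}$, $a\in A$. *$\mathcal B^\sigma(A,\mathrm{inv})$*,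 for $\sigma\in\mathbb Z/2$, is the strict monoidal supercategory with one generating object $\bullet$ and generating morphisms $x:\bullet\bullet\to\bullet\bullet$ (even), $\mathrm{cap}:\bullet\bullet\to\mathbb 1$ and $\mathrm{cup}:\mathbb 1\to\bullet\bullet$ (parity $\sigma$), $\tau_a:\bullet\to\bullet$ ($a\in A$), subject to: $x^2=1$, $(x\otimes1)(1\otimes x)(x\otimes1)=(1\otimes x)(x\otimes1)(1\otimes x)$, $(1\otimes\mathrm{cap})(\mathrm{cup}\otimes1)=1=(-1)^\sigma(\mathrm{cap}\otimes1)(1\otimes\mathrm{cup})$, $\mathrm{cap}\,x=\mathrm{cap}$, $(1\otimes\mathrm{cap})(x\otimes1)=(\mathrm{cap}\otimes1)(1\otimes x)$; $\tau_1=1$, $\tau_{\lambda a+\mu b}=\lambda\tau_a+\mu\tau_b$, $\tau_a\tau_b=\tau_{ab}$, $x(\tau_a\otimes1)=(1\otimes\tau_a)x$, $\mathrm{cap}(\tau_a\otimes1)=\mathrm{cap}(1\otimes\tau_{a^{\mathrm{inv}}})$. For $A$ finite-dimensional and $d\in\Bbbk$, $\mathcal B^\sigma(A,\mathrm{inv};d)$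 is the quotient by the relations $\mathrm{cap}(1\otimes\tau_a)\mathrm{cup}=d\,\mathrm{str}_A(a)1_{\mathbb 1}$, $a\in A$. For a strict monoidal supercategory $\mathcal C$, its $\Pi$-envelope $\mathcal C_\pi$ has objects $\Pi^rX$ ($r\in\mathbb Z/2$, $X\in\mathcal C$) and morphisms $f_r^s:\Pi^rX\to\Pi^sY$ for $f:X\to Y$ in $\mathcal C$, of parity $\bar f+r-s$; $g_s^t\circ f_r^s=(g\circ f)_r^t$, $(\Pi^rX)\otimes(\Pi^sY)=\Pi^{r+s}(X\otimes Y)$ and $f_r^s\otimes g_u^v=(-1)^{r(\bar g+u+v)+\bar fv}(f\otimes g)_{r+u}^{s+v}$. $\mathrm{Add}(\mathcal C_\pi)$ is its additive envelope: finite sequences of objects (formal direct sums) and matrices of morphisms, which is again strict monoidal, with the tensor product of two formal sums being ordered lexicographically. **Theorem.** Let $\sigma\in\mathbb Z/2$. (1) There is a unique strict monoidal superfunctor $D:\mathcal B^\sigma(A,\mathrm{inv})\to\mathrm{Add}(\mathcal{OB}(A)_\pi)$ such that $D(\bullet)=\uparrow\oplus\,\Pi^\sigma\!\downarrow$ and,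 writing a morphism as the sum of its components (the components not listed being zero), $$D(x)=s_0^0+(s_r)_\sigma^\sigma+(s_l)_\sigma^\sigma+(-1)^\sigma(s_d)_0^0,\qquad D(\mathrm{cap})=(\mathrm{cap}_l)_\sigma^0+(\mathrm{cap}_r)_\sigma^0,$$ $$D(\mathrm{cup})=(\mathrm{cup}_l)_0^\sigma+(-1)^\sigma(\mathrm{cup}_r)_0^\sigma,\qquad D(\tau_a)=(t_a)_0^0+(-1)^{\sigma\bar a}(t^{\downarrow}_{a^{\mathrm{inv}}})_\sigma^\sigma\quad(a\in A\text{ homogeneous}).$$ (2) Suppose that $A$ is finite-dimensional and that $(A,\mathrm{inv})$ admits an involutive Frobenius structure: a linear form $\varphi:A\to\Bbbk$ vanishing on $A_1$, such that $(a,b)\mapsto\varphi(ab)$ is nondegenerate, $\varphi(a^{\mathrm{inv}})=\varphi(a)$ for all $a$, and the Nakayama automorphism $N$ of the superalgebra $A$, given by $\varphi(ab)=(-1)^{\bar a\bar b}\varphi(b\,N(a))$ for homogeneous $a,b$, satisfies $N^2=\mathrm{id}$. Let $d\in\Bbbk$, with $d=0$ if $\sigma=1$. Then $D$ induces a strict monoidal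 superfunctor $\mathcal B^\sigma(A,\mathrm{inv};2d)\to\mathrm{Add}(\mathcal{OB}(A;d)_\pi)$, that is, there is a unique such superfunctor whose composite with the quotient functor $\mathcal B^\sigma(A,\mathrm{inv})\to\mathcal B^\sigma(A,\mathrm{inv};2d)$ is the composite of $D$ with the functor $\mathrm{Add}(\mathcal{OB}(A)_\pi)\to\mathrm{Add}(\mathcal{OB}(A;d)_\pi)$ induced by the quotient functor. -/

import Mathlib

open CategoryTheory

noncomputable section

set_option linter.unusedSectionVars false
set_option linter.checkUnivs false

universe u v w u' v'

namespace SuperBrauer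

/-! ### Supercategories and strict monoidal supercategories -/

/-- The sign `(-1) ^ p` of a parity `p`. -/
def sgn (k : Type*) [Ring k] (p : ZMod 2) : k := if p = 0 then 1 else -1

theorem zmod_two_cases (p : ZMod 2) : p = 0 ∨ p = 1 := by
  revert p; decide

section sign
variable {k : Type*} [Ring k]

@[simp] theorem sgn_zero : sgn k 0 = 1 := rfl

theorem sgn_add (p q : ZMod 2) : sgn k (p + q) = sgn k p * sgn k q := by
  rcases zmod_two_cases p with rfl | rfl <;> rcases zmod_two_cases q with rfl | rfl <;>
    simp [sgn, CharTwo.add_self_eq_zero]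

theorem sgn_self (p : ZMod 2) : sgn k p * sgn k p = 1 := by
  rcases zmod_two_cases p with rfl | rfl <;> simp [sgn]

end sign

/-- A supercategory over `k`: every morphism space is a vector superspace (the direct sum of its
even and odd part), identities are even and composition is bilinear and adds parities. -/
class Supercategory (k : Type*) [Field k] (C : Type*) [Category C] [Preadditive C]
    [Linear k C] where
  /-- The morphisms that are homogeneous of a given parity. -/
  homParity (X Y : C) : ZMod 2 → Submodule k (X ⟶ Y)
  isCompl (X Y : C) : IsCompl (homParity X Y 0) (homParity X Y 1)
  id_mem (X : C) : 𝟙 X ∈ homParity X X 0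
  comp_mem {X Y Z : C} {p q : ZMod 2} {f : X ⟶ Y} {g : Y ⟶ Z} (hf : f ∈ homParity X Y p)
    (hg : g ∈ homParity Y Z q) : f ≫ g ∈ homParity X Z (p + q)

open Supercategory (homParity)

section twist

variable (k : Type*) [Field k] {C : Type*} [Category C] [Preadditive C] [Linear k C]
  [Supercategory k C]

/-- The linear map `f ↦ (-1) ^ (n * parity f) f`. -/
def twist (n : ZMod 2) {X Y : C} : (X ⟶ Y) →ₗ[k] (X ⟶ Y) :=
  Submodule.projection _ _ (Supercategory.isCompl (k := k) X Y) +
    sgn k n • Submodule.projection _ _ (Supercategory.isCompl (k := k) X Y).symm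

theorem twist_of_mem (n p : ZMod 2) {X Y : C} {f : X ⟶ Y} (hf : f ∈ homParity (k := k) X Y p) :
    twist k n f = sgn k (n * p) • f := by
  rcases zmod_two_cases p with rfl | rfl
  · simp only [twist, LinearMap.add_apply, LinearMap.smul_apply, mul_zero, sgn_zero, one_smul]
    rw [Submodule.projection_apply_of_mem_left _ hf]
    rw [(Submodule.projection_apply_eq_zero_iff _).2 hf]
    simp
  · simp only [twist, LinearMap.add_apply, LinearMap.smul_apply, mul_one]
    rw [Submodule.projection_apply_of_mem_left _ hf]
    rw [(Submodule.projection_apply_eq_zero_iff _).2 hf]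
    simp

theorem exists_homogeneous {X Y : C} (f : X ⟶ Y) :
    ∃ f₀ f₁, f₀ ∈ homParity (k := k) X Y 0 ∧ f₁ ∈ homParity (k := k) X Y 1 ∧ f₀ + f₁ = f :=
  Submodule.codisjoint_iff_exists_add_eq.1 (Supercategory.isCompl (k := k) X Y).codisjoint f

@[elab_as_elim]
theorem homogeneous_induction {X Y : C} {P : (X ⟶ Y) → Prop} (f : X ⟶ Y)
    (hom : ∀ p, ∀ f ∈ homParity (k := k) X Y p, P f) (add : ∀ f g, P f → P g → P (f + g)) : P f := by
  obtain ⟨f₀, f₁, h₀, h₁, rfl⟩ := exists_homogeneous k f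
  exact add _ _ (hom 0 _ h₀) (hom 1 _ h₁)

theorem twist_twist (m n : ZMod 2) {X Y : C} (f : X ⟶ Y) :
    twist k m (twist k n f) = twist k (m + n) f := by
  refine homogeneous_induction k (P := fun f => twist k m (twist k n f) = twist k (m + n) f) f ?_ ?_
  · intro p f hf
    rw [twist_of_mem k n p hf, map_smul, twist_of_mem k m p hf, twist_of_mem k _ p hf, smul_smul,
      ← sgn_add]
    congr 2; ring
  · intro f g hf hg
    simp only [map_add, hf, hg]

theorem twist_zero {X Y : C} (f : X ⟶ Y) : twist k 0 f = f := by
  refine homogeneous_induction k (P := fun f => twist k 0 f = f) f ?_ ?_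
  · intro p f hf
    rw [twist_of_mem k 0 p hf]; simp
  · intro f g hf hg
    simp only [map_add, hf, hg]

theorem twist_comp (n : ZMod 2) {X Y Z : C} (f : X ⟶ Y) (g : Y ⟶ Z) :
    twist k n (f ≫ g) = twist k n f ≫ twist k n g := by
  refine homogeneous_induction k (P := fun f => twist k n (f ≫ g) = twist k n f ≫ twist k n g)
    f ?_ ?_
  · intro p f hf
    refine homogeneous_induction k (P := fun g => twist k n (f ≫ g) = twist k n f ≫ twist k n g)
      g ?_ ?_
    · intro q g hg
      rw [twist_of_mem k n p hf, twist_of_mem k n q hg,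
        twist_of_mem k n _ (Supercategory.comp_mem hf hg), Linear.smul_comp, Linear.comp_smul,
        smul_smul, ← sgn_add]
      congr 2; ring
    · intro g g' hg hg'
      simp only [map_add, hg, hg', Preadditive.comp_add]
  · intro f f' hf hf'
    simp only [map_add, hf, hf', Preadditive.add_comp]

theorem twist_id (n : ZMod 2) (X : C) : twist k n (𝟙 X) = 𝟙 X := by
  rw [twist_of_mem k n 0 (Supercategory.id_mem X)]; simp

theorem twist_eqToHom (n : ZMod 2) {X Y : C} (h : X = Y) :
    twist k n (eqToHom h) = eqToHom h := by
  subst h; simpa using twist_id k n X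

theorem twist_mem (n p : ZMod 2) {X Y : C} {f : X ⟶ Y} (hf : f ∈ homParity (k := k) X Y p) :
    twist k n f ∈ homParity (k := k) X Y p := by
  rw [twist_of_mem k n p hf]; exact Submodule.smul_mem _ _ hf

theorem eqToHom_mem {X Y : C} (h : X = Y) : eqToHom h ∈ homParity (k := k) X Y 0 := by
  subst h; exact Supercategory.id_mem X

theorem conj_mem {X Y X' Y' : C} (hX : X' = X) (hY : Y = Y') {f : X ⟶ Y} {p : ZMod 2}
    (hf : f ∈ homParity (k := k) X Y p) :
    eqToHom hX ≫ f ≫ eqToHom hY ∈ homParity (k := k) X' Y' p := by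
  subst hX hY; simpa using hf

end twist

/-- A strict monoidal supercategory over `k`: the objects form a monoid, the tensor product of
morphisms is bilinear, adds parities, satisfies the super interchange law, and is strictly
associative and unital. Composition is written in diagrammatic order: `f ≫ g` is `g ∘ f`. -/
class StrictMonoidalSupercategory (k : Type*) [Field k] (C : Type*) [Category C] [Preadditive C]
    [Linear k C] [Monoid C] extends Supercategory k C where
  tensorHom {X X' Y Y' : C} (f : X ⟶ X') (g : Y ⟶ Y') : X * Y ⟶ X' * Y'
  add_tensor {X X' Y Y' : C} (f f' : X ⟶ X') (g : Y ⟶ Y') :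
    tensorHom (f + f') g = tensorHom f g + tensorHom f' g
  tensor_add {X X' Y Y' : C} (f : X ⟶ X') (g g' : Y ⟶ Y') :
    tensorHom f (g + g') = tensorHom f g + tensorHom f g'
  smul_tensor {X X' Y Y' : C} (c : k) (f : X ⟶ X') (g : Y ⟶ Y') :
    tensorHom (c • f) g = c • tensorHom f g
  tensor_smul {X X' Y Y' : C} (c : k) (f : X ⟶ X') (g : Y ⟶ Y') :
    tensorHom f (c • g) = c • tensorHom f g
  tensor_mem {X X' Y Y' : C} {p q : ZMod 2} {f : X ⟶ X'} {g : Y ⟶ Y'}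
    (hf : f ∈ homParity X X' p) (hg : g ∈ homParity Y Y' q) :
    tensorHom f g ∈ homParity (X * Y) (X' * Y') (p + q)
  tensor_id (X Y : C) : tensorHom (𝟙 X) (𝟙 Y) = 𝟙 (X * Y)
  /-- `(f' ⊗ g) ∘ (f ⊗ g') = (-1) ^ (p * q) (f' ∘ f) ⊗ (g ∘ g')` for `f`, `g` homogeneous of
  parities `p`, `q`. -/
  interchange {X X' X'' Y Y' Y'' : C} {p q : ZMod 2} (f : X ⟶ X') (f' : X' ⟶ X'')
    (g' : Y ⟶ Y') (g : Y' ⟶ Y'') (hf : f ∈ homParity X X' p) (hg : g ∈ homParity Y' Y'' q) :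
    tensorHom f g' ≫ tensorHom f' g = sgn k (p * q) • tensorHom (f ≫ f') (g' ≫ g)
  tensor_assoc {X X' Y Y' Z Z' : C} (f : X ⟶ X') (g : Y ⟶ Y') (h : Z ⟶ Z') :
    tensorHom (tensorHom f g) h =
      eqToHom (mul_assoc X Y Z) ≫ tensorHom f (tensorHom g h) ≫ eqToHom (mul_assoc X' Y' Z').symm
  one_tensor {X X' : C} (f : X ⟶ X') :
    tensorHom (𝟙 (1 : C)) f = eqToHom (one_mul X) ≫ f ≫ eqToHom (one_mul X').symm
  tensor_one {X X' : C} (f : X ⟶ X') :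
    tensorHom f (𝟙 (1 : C)) = eqToHom (mul_one X) ≫ f ≫ eqToHom (mul_one X').symm

open StrictMonoidalSupercategory (tensorHom)

/-- A strict monoidal superfunctor: a functor which is linear and parity preserving on morphism
spaces, and strictly compatible with unit objects and tensor products. -/
@[ext]
structure StrictMonoidalSuperfunctor (k : Type*) [Field k] (C D : Type*)
    [Category C] [Preadditive C] [Linear k C] [Monoid C] [StrictMonoidalSupercategory k C]
    [Category D] [Preadditive D] [Linear k D] [Monoid D] [StrictMonoidalSupercategory k D]
    extends C ⥤ D where
  map_add {X Y : C} (f g : X ⟶ Y) : map (f + g) = map f + map g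
  map_smul {X Y : C} (c : k) (f : X ⟶ Y) : map (c • f) = c • map f
  map_mem {X Y : C} {p : ZMod 2} {f : X ⟶ Y} (hf : f ∈ homParity (k := k) X Y p) :
    map f ∈ homParity (k := k) (obj X) (obj Y) p
  obj_one : obj 1 = 1
  obj_mul (X Y : C) : obj (X * Y) = obj X * obj Y
  map_tensor {X X' Y Y' : C} (f : X ⟶ X') (g : Y ⟶ Y') :
    map (tensorHom (k := k) f g) =
      eqToHom (obj_mul X Y) ≫ tensorHom (k := k) (map f) (map g) ≫ eqToHom (obj_mul X' Y').symm

theorem StrictMonoidalSuperfunctor.obj_mul_of_eq {k : Type*} [Field k] {C D : Type*}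
    [Category C] [Preadditive C] [Linear k C] [Monoid C] [StrictMonoidalSupercategory k C]
    [Category D] [Preadditive D] [Linear k D] [Monoid D] [StrictMonoidalSupercategory k D]
    (F : StrictMonoidalSuperfunctor k C D) {X Y : C} {X' Y' : D} (hX : F.obj X = X')
    (hY : F.obj Y = Y') : F.obj (X * Y) = X' * Y' :=
  (F.obj_mul X Y).trans (congrArg₂ (· * ·) hX hY)

/-! ### The `Π`-envelope -/

section tensorLemmas

variable (k : Type*) [Field k] {C : Type*} [Category C] [Preadditive C] [Linear k C]
  [Monoid C] [StrictMonoidalSupercategory k C]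

theorem twist_tensor (n : ZMod 2) {X X' Y Y' : C} (f : X ⟶ X') (g : Y ⟶ Y') :
    twist k n (tensorHom (k := k) f g) = tensorHom (k := k) (twist k n f) (twist k n g) := by
  refine homogeneous_induction k (P := fun f => twist k n (tensorHom (k := k) f g) =
    tensorHom (k := k) (twist k n f) (twist k n g)) f ?_ ?_
  · intro p f hf
    refine homogeneous_induction k (P := fun g => twist k n (tensorHom (k := k) f g) =
      tensorHom (k := k) (twist k n f) (twist k n g)) g ?_ ?_
    · intro q g hg
      rw [twist_of_mem k n p hf, twist_of_mem k n q hg,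
        twist_of_mem k n _ (StrictMonoidalSupercategory.tensor_mem hf hg),
        StrictMonoidalSupercategory.smul_tensor, StrictMonoidalSupercategory.tensor_smul,
        smul_smul, ← sgn_add]
      congr 2; ring
    · intro g g' hg hg'
      simp only [map_add, hg, hg', StrictMonoidalSupercategory.tensor_add]
  · intro f f' hf hf'
    simp only [map_add, hf, hf', StrictMonoidalSupercategory.add_tensor]

theorem zero_tensor {X X' Y Y' : C} (g : Y ⟶ Y') :
    tensorHom (k := k) (0 : X ⟶ X') g = 0 := by
  have := StrictMonoidalSupercategory.smul_tensor (0 : k) (0 : X ⟶ X') g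
  simpa using this

theorem tensor_zero {X X' Y Y' : C} (f : X ⟶ X') :
    tensorHom (k := k) f (0 : Y ⟶ Y') = 0 := by
  have := StrictMonoidalSupercategory.tensor_smul (0 : k) f (0 : Y ⟶ Y')
  simpa using this

theorem tensor_eqToHom {X X' Y Y' : C} (h : X = X') (h' : Y = Y') :
    tensorHom (k := k) (eqToHom h) (eqToHom h') = eqToHom (by rw [h, h']) := by
  subst h h'
  simpa using StrictMonoidalSupercategory.tensor_id X Y

end tensorLemmas

/-- The objects `Π^r X` of the `Π`-envelope. -/
@[ext]
structure PiEnv (C : Type*) where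
  parity : ZMod 2
  obj : C

namespace PiEnv

section basic

variable {C : Type*} [Category C]

/-- The morphism `f_r^s : Π^r X ⟶ Π^s Y` determined by `f : X ⟶ Y`. -/
@[ext]
structure Hom (X Y : PiEnv C) where
  base : X.obj ⟶ Y.obj

/-- Morphisms in the `Π`-envelope correspond to morphisms in the original category. -/
def homEquiv (X Y : PiEnv C) : Hom X Y ≃ (X.obj ⟶ Y.obj) where
  toFun f := f.base
  invFun f := ⟨f⟩
  left_inv _ := rfl
  right_inv _ := rfl

instance : Category (PiEnv C) where
  Hom := Hom
  id X := ⟨𝟙 X.obj⟩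
  comp f g := ⟨f.base ≫ g.base⟩
  id_comp f := Hom.ext (Category.id_comp f.base)
  comp_id f := Hom.ext (Category.comp_id f.base)
  assoc f g h := Hom.ext (Category.assoc f.base g.base h.base)

@[ext]
theorem hom_ext {X Y : PiEnv C} {f g : X ⟶ Y} (h : f.base = g.base) : f = g := Hom.ext h

@[simp] theorem id_base (X : PiEnv C) : (𝟙 X : X ⟶ X).base = 𝟙 X.obj := rfl

@[simp] theorem comp_base {X Y Z : PiEnv C} (f : X ⟶ Y) (g : Y ⟶ Z) :
    (f ≫ g).base = f.base ≫ g.base := rfl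

@[simp] theorem eqToHom_base {X Y : PiEnv C} (h : X = Y) :
    (eqToHom h).base = eqToHom (congrArg PiEnv.obj h) := by
  subst h; rfl

variable [Preadditive C]

instance (X Y : PiEnv C) : AddCommGroup (X ⟶ Y) := (homEquiv X Y).addCommGroup

@[simp] theorem add_base {X Y : PiEnv C} (f g : X ⟶ Y) : (f + g).base = f.base + g.base := rfl

instance : Preadditive (PiEnv C) where
  homGroup := inferInstance
  add_comp _ _ _ f f' g := hom_ext (Preadditive.add_comp _ _ _ f.base f'.base g.base)
  comp_add _ _ _ f g g' := hom_ext (Preadditive.comp_add _ _ _ f.base g.base g'.base)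

variable (k : Type*) [Field k] [Linear k C]

instance (X Y : PiEnv C) : Module k (X ⟶ Y) := (homEquiv X Y).module k

@[simp] theorem smul_base {X Y : PiEnv C} (c : k) (f : X ⟶ Y) : (c • f).base = c • f.base := rfl

instance : Linear k (PiEnv C) where
  homModule := inferInstance
  smul_comp _ _ _ c f g := hom_ext (Linear.smul_comp _ _ _ c f.base g.base)
  comp_smul _ _ _ f c g := hom_ext (Linear.comp_smul _ _ _ f.base c g.base)

/-- Passage from `f_r^s` to `f`, as a linear map. -/
def baseLinear (X Y : PiEnv C) : (X ⟶ Y) →ₗ[k] (X.obj ⟶ Y.obj) where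
  toFun f := f.base
  map_add' _ _ := rfl
  map_smul' _ _ := rfl

variable [Supercategory k C]

theorem isCompl_shift (X Y : C) (a : ZMod 2) :
    IsCompl (homParity (k := k) X Y (0 + a)) (homParity (k := k) X Y (1 + a)) := by
  rcases zmod_two_cases a with rfl | rfl
  · exact Supercategory.isCompl X Y
  · rw [CharTwo.add_self_eq_zero]
    exact (Supercategory.isCompl X Y).symm

theorem isCompl_comap {M N : Type*} [AddCommGroup M] [Module k M] [AddCommGroup N] [Module k N]
    (e : M →ₗ[k] N) (he : Function.Bijective e) {p q : Submodule k N} (h : IsCompl p q) :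
    IsCompl (p.comap e) (q.comap e) := by
  constructor
  · rw [Submodule.disjoint_def]
    intro x hx hx'
    exact he.1 (by rw [map_zero]; exact (Submodule.disjoint_def.1 h.disjoint) _ hx hx')
  · rw [Submodule.codisjoint_iff_exists_add_eq]
    intro z
    obtain ⟨x, y, hx, hy, hxy⟩ := Submodule.codisjoint_iff_exists_add_eq.1 h.codisjoint (e z)
    obtain ⟨x, rfl⟩ := he.2 x
    obtain ⟨y, rfl⟩ := he.2 y
    exact ⟨x, y, hx, hy, he.1 (by rw [map_add, hxy])⟩

/-- The morphism `f_r^s` has parity `p` if and only if `f` has parity `p - r + s`. -/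
instance : Supercategory k (PiEnv C) where
  homParity X Y p := (homParity X.obj Y.obj (p + (-X.parity + Y.parity))).comap (baseLinear k X Y)
  isCompl X Y := isCompl_comap k _ (homEquiv X Y).bijective (isCompl_shift k _ _ _)
  id_mem X := by
    rw [Submodule.mem_comap, neg_add_cancel, add_zero]
    exact Supercategory.id_mem X.obj
  comp_mem {X Y Z p q f g} hf hg := by
    rw [Submodule.mem_comap] at hf hg ⊢
    have := Supercategory.comp_mem hf hg
    have e : p + q + (-X.parity + Z.parity) =
      p + (-X.parity + Y.parity) + (q + (-Y.parity + Z.parity)) := by ring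
    rw [e]
    exact this

theorem mem_homParity_iff {X Y : PiEnv C} {p : ZMod 2} {f : X ⟶ Y} :
    f ∈ homParity (k := k) X Y p ↔
      f.base ∈ homParity (k := k) X.obj Y.obj (p + (-X.parity + Y.parity)) := Iff.rfl

end basic

section monoidal

variable {C : Type*}

/-- `(Π^r X) ⊗ (Π^s Y) = Π^(r+s) (X ⊗ Y)`. -/
instance [Monoid C] : Monoid (PiEnv C) where
  one := ⟨0, 1⟩
  mul X Y := ⟨X.parity + Y.parity, X.obj * Y.obj⟩
  mul_assoc X Y Z := PiEnv.ext (add_assoc _ _ _) (mul_assoc _ _ _)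
  one_mul X := PiEnv.ext (zero_add _) (one_mul _)
  mul_one X := PiEnv.ext (add_zero _) (mul_one _)

@[simp] theorem mul_parity [Monoid C] (X Y : PiEnv C) : (X * Y).parity = X.parity + Y.parity := rfl
@[simp] theorem mul_obj [Monoid C] (X Y : PiEnv C) : (X * Y).obj = X.obj * Y.obj := rfl
@[simp] theorem one_parity [Monoid C] : (1 : PiEnv C).parity = 0 := rfl
@[simp] theorem one_obj [Monoid C] : (1 : PiEnv C).obj = 1 := rfl

variable (k : Type*) [Field k] [Category C] [Preadditive C] [Linear k C]
  [Monoid C] [StrictMonoidalSupercategory k C]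

/-- The morphism underlying `f_r^s ⊗ g_u^v`. -/
def tensorBase (r u v : ZMod 2) {X X' Y Y' : C} (f : X ⟶ X') (g : Y ⟶ Y') : X * Y ⟶ X' * Y' :=
  sgn k (r * (u + v)) • tensorHom (k := k) (twist k v f) (twist k r g)

theorem tensorBase_assoc (r u v w x : ZMod 2) {X X' Y Y' Z Z' : C} (f : X ⟶ X') (g : Y ⟶ Y')
    (h : Z ⟶ Z') :
    tensorBase k (r + u) w x (tensorBase k r u v f g) h =
      eqToHom (mul_assoc X Y Z) ≫ tensorBase k r (u + w) (v + x) f (tensorBase k u w x g h) ≫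
        eqToHom (mul_assoc X' Y' Z').symm := by
  simp only [tensorBase, map_smul, twist_tensor, twist_twist,
    StrictMonoidalSupercategory.tensor_smul,
    StrictMonoidalSupercategory.smul_tensor, smul_smul, ← sgn_add,
    StrictMonoidalSupercategory.tensor_assoc, Linear.smul_comp, Linear.comp_smul]
  congr 2
  · ring
  · rw [add_comm v x, add_comm x r]

/-- `f_r^s ⊗ g_u^v = (-1) ^ (r * (parity g + u + v) + parity f * v) (f ⊗ g)_(r+u)^(s+v)`. -/
def tensor {X X' Y Y' : PiEnv C} (f : X ⟶ X') (g : Y ⟶ Y') : X * Y ⟶ X' * Y' :=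
  ⟨tensorBase k X.parity Y.parity Y'.parity f.base g.base⟩

theorem tensor_of_mem {X X' Y Y' : PiEnv C} {f : X ⟶ X'} {g : Y ⟶ Y'} {p q : ZMod 2}
    (hf : f.base ∈ homParity (k := k) X.obj X'.obj p)
    (hg : g.base ∈ homParity (k := k) Y.obj Y'.obj q) :
    (tensor k f g).base =
      sgn k (X.parity * (q + Y.parity + Y'.parity) + p * Y'.parity) •
        tensorHom (k := k) f.base g.base := by
  simp only [tensor, tensorBase]
  rw [twist_of_mem k _ p hf, twist_of_mem k _ q hg, StrictMonoidalSupercategory.smul_tensor,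
    StrictMonoidalSupercategory.tensor_smul, smul_smul, smul_smul, ← sgn_add, ← sgn_add]
  congr 2; ring

instance : StrictMonoidalSupercategory k (PiEnv C) where
  tensorHom f g := tensor k f g
  add_tensor f f' g := hom_ext (by
    simp [tensor, tensorBase, StrictMonoidalSupercategory.add_tensor])
  tensor_add f g g' := hom_ext (by
    simp [tensor, tensorBase, StrictMonoidalSupercategory.tensor_add])
  smul_tensor c f g := hom_ext (by
    simp [tensor, tensorBase, StrictMonoidalSupercategory.smul_tensor, smul_comm c])
  tensor_smul c f g := hom_ext (by
    simp [tensor, tensorBase, StrictMonoidalSupercategory.tensor_smul, smul_comm c])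
  tensor_mem {X X' Y Y' p q f g} hf hg := by
    rw [mem_homParity_iff] at hf hg ⊢
    rw [tensor_of_mem k hf hg]
    have := StrictMonoidalSupercategory.tensor_mem hf hg
    refine Submodule.smul_mem _ _ ?_
    have e : p + q + (-(X.parity + Y.parity) + (X'.parity + Y'.parity)) =
      p + (-X.parity + X'.parity) + (q + (-Y.parity + Y'.parity)) := by ring
    exact e ▸ this
  tensor_id X Y := hom_ext (by
    simp [tensor, tensorBase, twist_id, StrictMonoidalSupercategory.tensor_id, CharTwo.add_self_eq_zero])
  interchange {X X' X'' Y Y' Y'' p q} f f' g' g hf hg := by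
    rw [mem_homParity_iff] at hf hg
    apply hom_ext
    simp only [tensor, tensorBase, comp_base, smul_base, Linear.smul_comp, Linear.comp_smul, twist_comp]
    rw [StrictMonoidalSupercategory.interchange _ _ _ _ (twist_mem k _ _ hf) (twist_mem k _ _ hg)]
    rw [twist_of_mem k _ _ hf, twist_of_mem k _ _ hf, twist_of_mem k _ _ hg, twist_of_mem k _ _ hg]
    simp only [Linear.smul_comp, Linear.comp_smul, StrictMonoidalSupercategory.tensor_smul,
      StrictMonoidalSupercategory.smul_tensor, smul_smul, ← sgn_add]
    congr 2
    clear hf hg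
    clear f f' g g'
    generalize X.parity = a
    generalize X'.parity = b
    generalize Y.parity = c
    generalize Y'.parity = d
    generalize Y''.parity = e
    have h2 : (2 : ZMod 2) = 0 := rfl
    linear_combination (a * d + e * b + b * q - e * a - a * q) * h2
  tensor_assoc f g h := by
    apply hom_ext
    rw [comp_base, comp_base, eqToHom_base, eqToHom_base]
    exact tensorBase_assoc k _ _ _ _ _ f.base g.base h.base
  one_tensor {X X'} f := by
    apply hom_ext
    simp [tensor, tensorBase, twist_zero, twist_id, StrictMonoidalSupercategory.one_tensor]
  tensor_one {X X'} f := by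
    apply hom_ext
    simp [tensor, tensorBase, twist_zero, twist_id, StrictMonoidalSupercategory.tensor_one]

end monoidal

/-- The functor induced by a functor on `Π`-envelopes, `f_r^s ↦ (F f)_r^s`. -/
def mapFunctor {C D : Type*} [Category C] [Category D] (F : C ⥤ D) : PiEnv C ⥤ PiEnv D where
  obj X := ⟨X.parity, F.obj X.obj⟩
  map f := ⟨F.map f.base⟩
  map_id X := hom_ext (F.map_id X.obj)
  map_comp f g := hom_ext (F.map_comp f.base g.base)

instance {C D : Type*} [Category C] [Category D] [Preadditive C] [Preadditive D] (F : C ⥤ D)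
    [F.Additive] : (mapFunctor F).Additive where
  map_add := hom_ext F.map_add

end PiEnv

/-! ### The additive envelope -/

/-- A formal finite direct sum `X₀ ⊕ ⋯ ⊕ Xₙ₋₁` of objects. -/
structure AddEnv (C : Type*) where
  size : ℕ
  obj : Fin size → C

namespace AddEnv

theorem ext_cast {C : Type*} {X Y : AddEnv C} (h : X.size = Y.size)
    (h' : ∀ i, X.obj i = Y.obj (Fin.cast h i)) : X = Y := by
  obtain ⟨n, X⟩ := X
  obtain ⟨m, Y⟩ := Y
  dsimp at h
  subst h
  congr
  funext i
  exact h' i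

section basic

variable {C : Type*} [Category C]

/-- A matrix of morphisms; `entry i j` is the component from the `i`-th summand of the source to
the `j`-th summand of the target. -/
@[ext]
structure Hom (X Y : AddEnv C) where
  entry (i : Fin X.size) (j : Fin Y.size) : X.obj i ⟶ Y.obj j

/-- Morphisms of formal direct sums as a function type. -/
def homEquiv (X Y : AddEnv C) :
    Hom X Y ≃ (∀ (i : Fin X.size) (j : Fin Y.size), X.obj i ⟶ Y.obj j) where
  toFun f := f.entry
  invFun f := ⟨f⟩
  left_inv _ := rfl
  right_inv _ := rfl

theorem entry_congr {m n : ℕ} {X : Fin m → C} {Y : Fin n → C} (f : ∀ i j, X i ⟶ Y j)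
    {i i' : Fin m} {j j' : Fin n} (hi : i = i') (hj : j = j') :
    f i j = eqToHom (by rw [hi]) ≫ f i' j' ≫ eqToHom (by rw [hj]) := by
  subst hi hj
  simp

variable [Preadditive C]

/-- The entries of an identity matrix. -/
def idEntry {n : ℕ} (X : Fin n → C) (i j : Fin n) : X i ⟶ X j :=
  if h : i = j then eqToHom (congrArg X h) else 0

instance : Category (AddEnv C) where
  Hom := Hom
  id X := ⟨idEntry X.obj⟩
  comp f g := ⟨fun i j => ∑ l, f.entry i l ≫ g.entry l j⟩
  id_comp f := Hom.ext (by funext i j; simp [idEntry, dite_comp])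
  comp_id f := Hom.ext (by funext i j; simp [idEntry, comp_dite])
  assoc f g h := Hom.ext (by
    funext i j
    simp only [Preadditive.sum_comp, Preadditive.comp_sum, Category.assoc]
    exact Finset.sum_comm)

theorem hom_ext {X Y : AddEnv C} {f g : X ⟶ Y} (h : ∀ i j, f.entry i j = g.entry i j) : f = g :=
  Hom.ext (by funext i j; exact h i j)

theorem id_entry (X : AddEnv C) (i j : Fin X.size) :
    (𝟙 X : X ⟶ X).entry i j = idEntry X.obj i j := rfl

theorem comp_entry {X Y Z : AddEnv C} (f : X ⟶ Y) (g : Y ⟶ Z) (i : Fin X.size) (j : Fin Z.size) :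
    (f ≫ g).entry i j = ∑ l, f.entry i l ≫ g.entry l j := rfl

instance (X Y : AddEnv C) : AddCommGroup (X ⟶ Y) := (homEquiv X Y).addCommGroup

@[simp] theorem add_entry {X Y : AddEnv C} (f g : X ⟶ Y) (i j) :
    (f + g).entry i j = f.entry i j + g.entry i j := rfl

instance : Preadditive (AddEnv C) where
  homGroup := inferInstance
  add_comp _ _ _ f f' g := hom_ext fun i j => by
    simp [comp_entry, Finset.sum_add_distrib]
  comp_add _ _ _ f g g' := hom_ext fun i j => by
    simp [comp_entry, Finset.sum_add_distrib]

theorem conj_entry {X Y X' Y' : AddEnv C} (hX : X' = X) (hY : Y = Y') (f : X ⟶ Y)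
    (i : Fin X'.size) (j : Fin Y'.size) :
    (eqToHom hX ≫ f ≫ eqToHom hY).entry i j =
      eqToHom (by subst hX; rfl) ≫ f.entry (Fin.cast (congrArg size hX) i)
        (Fin.cast (congrArg size hY).symm j) ≫ eqToHom (by subst hY; rfl) := by
  subst hX hY
  simp

variable (k : Type*) [Field k] [Linear k C]

instance (X Y : AddEnv C) : Module k (X ⟶ Y) := (homEquiv X Y).module k

@[simp] theorem smul_entry {X Y : AddEnv C} (c : k) (f : X ⟶ Y) (i j) :
    (c • f).entry i j = c • f.entry i j := rfl

@[simp] theorem zero_entry {X Y : AddEnv C} (i j) : (0 : X ⟶ Y).entry i j = 0 := rfl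

instance : Linear k (AddEnv C) where
  homModule := inferInstance
  smul_comp _ _ _ c f g := hom_ext fun i j => by
    simp [comp_entry, Finset.smul_sum]
  comp_smul _ _ _ f c g := hom_ext fun i j => by
    simp [comp_entry, Finset.smul_sum]

variable [Supercategory k C]

theorem idEntry_mem {n : ℕ} (X : Fin n → C) (i j : Fin n) :
    idEntry X i j ∈ homParity (k := k) (X i) (X j) 0 := by
  unfold idEntry
  split_ifs
  · exact eqToHom_mem k _
  · exact Submodule.zero_mem _

/-- A matrix is homogeneous of parity `p` if all its entries are. -/
instance : Supercategory k (AddEnv C) where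
  homParity X Y p :=
    { carrier := {f | ∀ i j, f.entry i j ∈ homParity (X.obj i) (Y.obj j) p}
      add_mem' := fun hf hg i j => Submodule.add_mem _ (hf i j) (hg i j)
      zero_mem' := fun i j => Submodule.zero_mem _
      smul_mem' := fun c _ hf i j => Submodule.smul_mem _ c (hf i j) }
  isCompl X Y := by
    constructor
    · rw [Submodule.disjoint_def]
      intro f h0 h1
      exact hom_ext fun i j =>
        (Submodule.disjoint_def.1 (Supercategory.isCompl (k := k) _ _).disjoint) _ (h0 i j) (h1 i j)
    · rw [Submodule.codisjoint_iff_exists_add_eq]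
      intro f
      choose f₀ f₁ h₀ h₁ h using fun i j => exists_homogeneous k (f.entry i j)
      exact ⟨⟨f₀⟩, ⟨f₁⟩, h₀, h₁, hom_ext h⟩
  id_mem X := fun i j => idEntry_mem k X.obj i j
  comp_mem hf hg := fun i j => by
    rw [comp_entry]
    exact Submodule.sum_mem _ fun l _ => Supercategory.comp_mem (hf i l) (hg l j)

theorem mem_homParity_iff {X Y : AddEnv C} {p : ZMod 2} {f : X ⟶ Y} :
    f ∈ homParity (k := k) X Y p ↔
      ∀ i j, f.entry i j ∈ homParity (k := k) (X.obj i) (Y.obj j) p := Iff.rfl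

end basic

section monoidal

variable {C : Type*}

theorem divNat_cast_assoc {l m n : ℕ} (i : Fin (l * m * n)) :
    i.divNat.divNat = (Fin.cast (mul_assoc l m n) i).divNat := by
  apply Fin.ext
  simp [Fin.coe_divNat, Nat.div_div_eq_div_mul, mul_comm]

theorem modNat_divNat_assoc {l m n : ℕ} (i : Fin (l * m * n)) :
    i.divNat.modNat = (Fin.cast (mul_assoc l m n) i).modNat.divNat := by
  apply Fin.ext
  simp [Nat.mod_mul_left_div_self]

theorem modNat_cast_assoc {l m n : ℕ} (i : Fin (l * m * n)) :
    i.modNat = (Fin.cast (mul_assoc l m n) i).modNat.modNat := by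
  apply Fin.ext
  simp

/-- `(⨁ᵢ Xᵢ) ⊗ (⨁ⱼ Yⱼ) = ⨁₍ᵢ,ⱼ₎ Xᵢ ⊗ Yⱼ`, the pairs `(i, j)` being ordered lexicographically. -/
instance [Monoid C] : Monoid (AddEnv C) where
  one := ⟨1, fun _ => 1⟩
  mul X Y := ⟨X.size * Y.size, fun i => X.obj i.divNat * Y.obj i.modNat⟩
  mul_assoc X Y Z := ext_cast (mul_assoc _ _ _) fun i => by
    change X.obj i.divNat.divNat * Y.obj i.divNat.modNat * Z.obj i.modNat = _
    rw [divNat_cast_assoc, modNat_divNat_assoc, modNat_cast_assoc, mul_assoc]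
    rfl
  one_mul X := ext_cast (one_mul _) fun i => by
    change 1 * X.obj i.modNat = _
    rw [one_mul]
    congr 1
    apply Fin.ext
    have h : i.1 < X.size := lt_of_lt_of_eq i.2 (one_mul X.size)
    simpa using Nat.mod_eq_of_lt h
  mul_one X := ext_cast (mul_one _) fun i => by
    change X.obj i.divNat * 1 = _
    rw [mul_one]
    congr 1
    apply Fin.ext
    exact Nat.div_one i.1

variable (k : Type*) [Field k] [Category C] [Preadditive C] [Linear k C]
  [Monoid C] [StrictMonoidalSupercategory k C]

/-- The tensor product (Kronecker product) of matrices of morphisms. -/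
def tensor {X X' Y Y' : AddEnv C} (f : X ⟶ X') (g : Y ⟶ Y') : X * Y ⟶ X' * Y' :=
  ⟨fun i j => tensorHom (k := k) (f.entry i.divNat j.divNat) (g.entry i.modNat j.modNat)⟩

theorem sum_divNat_modNat {M : Type*} [AddCommMonoid M] {m n : ℕ} (F : Fin m → Fin n → M) :
    ∑ l : Fin (m * n), F l.divNat l.modNat = ∑ a, ∑ b, F a b := by
  rw [← Fintype.sum_prod_type']
  exact Equiv.sum_comp finProdFinEquiv.symm (fun p : Fin m × Fin n => F p.1 p.2)

theorem sum_tensor {ι : Type*} (s : Finset ι) {X X' Y Y' : C} (f : ι → (X ⟶ X')) (g : Y ⟶ Y') :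
    tensorHom (k := k) (∑ i ∈ s, f i) g = ∑ i ∈ s, tensorHom (k := k) (f i) g :=
  map_sum (AddMonoidHom.mk' (fun f : X ⟶ X' => tensorHom (k := k) f g)
    fun f f' => StrictMonoidalSupercategory.add_tensor f f' g) f s

theorem tensor_sum {ι : Type*} (s : Finset ι) {X X' Y Y' : C} (f : X ⟶ X') (g : ι → (Y ⟶ Y')) :
    tensorHom (k := k) f (∑ i ∈ s, g i) = ∑ i ∈ s, tensorHom (k := k) f (g i) :=
  map_sum (AddMonoidHom.mk' (fun g : Y ⟶ Y' => tensorHom (k := k) f g)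
    fun g g' => StrictMonoidalSupercategory.tensor_add f g g') g s

theorem tensor_idEntry {m n : ℕ} (X : Fin m → C) (Y : Fin n → C) (i j : Fin (m * n)) :
    tensorHom (k := k) (idEntry X i.divNat j.divNat) (idEntry Y i.modNat j.modNat) =
      idEntry (fun i : Fin (m * n) => X i.divNat * Y i.modNat) i j := by
  by_cases h : i = j
  · subst h
    simp [idEntry, StrictMonoidalSupercategory.tensor_id]
  · rw [show idEntry (fun i : Fin (m * n) => X i.divNat * Y i.modNat) i j = 0 from dif_neg h]
    by_cases h1 : i.divNat = j.divNat
    · have h2 : ¬ i.modNat = j.modNat := fun h2 =>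
        h (finProdFinEquiv.symm.injective (Prod.ext h1 h2))
      rw [show idEntry Y i.modNat j.modNat = 0 from dif_neg h2, tensor_zero]
    · rw [show idEntry X i.divNat j.divNat = 0 from dif_neg h1, zero_tensor]

theorem tensor_entry_congr {l l' m m' n n' : ℕ} {X : Fin l → C} {X' : Fin l' → C}
    {Y : Fin m → C} {Y' : Fin m' → C} {Z : Fin n → C} {Z' : Fin n' → C}
    (f : ∀ i j, X i ⟶ X' j) (g : ∀ i j, Y i ⟶ Y' j) (h : ∀ i j, Z i ⟶ Z' j)
    {a a₁ : Fin l} {b b₁ : Fin m} {c c₁ : Fin n} {a' a₁' : Fin l'} {b' b₁' : Fin m'}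
    {c' c₁' : Fin n'} (ha : a = a₁) (hb : b = b₁) (hc : c = c₁) (ha' : a' = a₁') (hb' : b' = b₁')
    (hc' : c' = c₁') :
    tensorHom (k := k) (tensorHom (k := k) (f a a') (g b b')) (h c c') =
      eqToHom (by rw [ha, hb, hc, mul_assoc]) ≫
        tensorHom (k := k) (f a₁ a₁') (tensorHom (k := k) (g b₁ b₁') (h c₁ c₁')) ≫
          eqToHom (by rw [ha', hb', hc', mul_assoc]) := by
  subst ha hb hc ha' hb' hc'
  exact StrictMonoidalSupercategory.tensor_assoc _ _ _

theorem modNat_one_mul {n : ℕ} (i : Fin (1 * n)) : i.modNat = Fin.cast (one_mul n) i := by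
  have h : i.1 < n := lt_of_lt_of_eq i.2 (one_mul n)
  apply Fin.ext
  simpa using Nat.mod_eq_of_lt h

theorem divNat_mul_one {n : ℕ} (i : Fin (n * 1)) : i.divNat = Fin.cast (mul_one n) i :=
  Fin.ext (Nat.div_one i.1)

theorem idEntry_one (i j : Fin 1) :
    idEntry (fun _ : Fin 1 => (1 : C)) i j = 𝟙 (1 : C) := by
  have h : i = j := Subsingleton.elim _ _
  simp [idEntry, h]

instance : StrictMonoidalSupercategory k (AddEnv C) where
  tensorHom f g := tensor k f g
  add_tensor f f' g := hom_ext fun i j => StrictMonoidalSupercategory.add_tensor _ _ _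
  tensor_add f g g' := hom_ext fun i j => StrictMonoidalSupercategory.tensor_add _ _ _
  smul_tensor c f g := hom_ext fun i j => StrictMonoidalSupercategory.smul_tensor _ _ _
  tensor_smul c f g := hom_ext fun i j => StrictMonoidalSupercategory.tensor_smul _ _ _
  tensor_mem hf hg := fun i j => StrictMonoidalSupercategory.tensor_mem (hf _ _) (hg _ _)
  tensor_id X Y := hom_ext fun i j => tensor_idEntry k X.obj Y.obj i j
  interchange {X X' X'' Y Y' Y'' p q} f f' g' g hf hg := hom_ext fun i j => by
    rw [smul_entry, comp_entry]
    refine (sum_divNat_modNat (fun a b =>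
      tensorHom (k := k) (f.entry i.divNat a) (g'.entry i.modNat b) ≫
        tensorHom (k := k) (f'.entry a j.divNat) (g.entry b j.modNat))).trans ?_
    change _ = sgn k (p * q) • tensorHom (k := k) ((f ≫ f').entry i.divNat j.divNat)
      ((g' ≫ g).entry i.modNat j.modNat)
    rw [comp_entry, sum_tensor, Finset.smul_sum]
    refine Finset.sum_congr rfl fun a _ => ?_
    rw [comp_entry, tensor_sum, Finset.smul_sum]
    refine Finset.sum_congr rfl fun b _ => ?_
    exact StrictMonoidalSupercategory.interchange _ _ _ _ (hf _ _) (hg _ _)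
  tensor_assoc {X X' Y Y' Z Z'} f g h := hom_ext fun i j => by
    rw [conj_entry]
    exact tensor_entry_congr k f.entry g.entry h.entry (divNat_cast_assoc i) (modNat_divNat_assoc i)
      (modNat_cast_assoc i) (divNat_cast_assoc j) (modNat_divNat_assoc j) (modNat_cast_assoc j)
  one_tensor {X X'} f := hom_ext fun i j => by
    rw [conj_entry]
    refine Eq.trans (congrArg (fun x => tensorHom (k := k) x (f.entry i.modNat j.modNat))
      (idEntry_one i.divNat j.divNat)) ?_
    rw [StrictMonoidalSupercategory.one_tensor,
      entry_congr f.entry (modNat_one_mul i) (modNat_one_mul j)]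
    simp only [eqToHom_trans, eqToHom_trans_assoc, Category.assoc]
  tensor_one {X X'} f := hom_ext fun i j => by
    rw [conj_entry]
    refine Eq.trans (congrArg (fun x => tensorHom (k := k) (f.entry i.divNat j.divNat) x)
      (idEntry_one i.modNat j.modNat)) ?_
    rw [StrictMonoidalSupercategory.tensor_one,
      entry_congr f.entry (divNat_mul_one i) (divNat_mul_one j)]
    simp only [eqToHom_trans, eqToHom_trans_assoc, Category.assoc]

end monoidal

/-- The functor induced by an additive functor on additive envelopes, applied to every entry. -/
def mapFunctor {C D : Type*} [Category C] [Category D] [Preadditive C] [Preadditive D] (F : C ⥤ D)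
    [F.Additive] : AddEnv C ⥤ AddEnv D where
  obj X := ⟨X.size, fun i => F.obj (X.obj i)⟩
  map f := ⟨fun i j => F.map (f.entry i j)⟩
  map_id X := hom_ext fun i j => by
    change F.map (idEntry X.obj i j) = idEntry (fun i => F.obj (X.obj i)) i j
    unfold idEntry
    split_ifs
    · rw [eqToHom_map]
    · rw [F.map_zero]
  map_comp f g := hom_ext fun i j => by
    change F.map ((f ≫ g).entry i j) = ∑ l, F.map (f.entry i l) ≫ F.map (g.entry l j)
    simp only [comp_entry, F.map_sum, F.map_comp]

end AddEnv

/-! ### Strict monoidal supercategories given by generators and relations -/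

/-- Generating objects, and generating morphisms with given source, target (words in the
generating objects) and parity. -/
structure Signature where
  Ob : Type u
  Gen : List Ob → List Ob → ZMod 2 → Type v

/-- A string diagram `1_left ⊗ gen ⊗ 1_right` containing exactly one generating morphism. -/
structure Layer (S : Signature.{u, v}) (X Y : List S.Ob) where
  left : List S.Ob
  right : List S.Ob
  src : List S.Ob
  tgt : List S.Ob
  par : ZMod 2
  gen : S.Gen src tgt par
  hX : X = left ++ (src ++ right)
  hY : Y = left ++ (tgt ++ right)

/-- A string diagram: finitely many layers stacked from bottom to top. -/
inductive Diagram (S : Signature.{u, v}) : List S.Ob → List S.Ob → Type (max u v)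
  | nil (X : List S.Ob) : Diagram S X X
  | cons {X Y Z : List S.Ob} (l : Layer S X Y) (d : Diagram S Y Z) : Diagram S X Z

namespace Layer

variable {S : Signature.{u, v}}

/-- `1_U ⊗ l`. -/
def whiskerL (U : List S.Ob) {X Y : List S.Ob} (l : Layer S X Y) : Layer S (U ++ X) (U ++ Y) :=
  ⟨U ++ l.left, l.right, l.src, l.tgt, l.par, l.gen, (congrArg (U ++ ·) l.hX).trans (by simp),
    (congrArg (U ++ ·) l.hY).trans (by simp)⟩

/-- `l ⊗ 1_V`. -/
def whiskerR (V : List S.Ob) {X Y : List S.Ob} (l : Layer S X Y) : Layer S (X ++ V) (Y ++ V) :=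
  ⟨l.left, l.right ++ V, l.src, l.tgt, l.par, l.gen, (congrArg (· ++ V) l.hX).trans (by simp),
    (congrArg (· ++ V) l.hY).trans (by simp)⟩

/-- Transport along equalities of source and target. -/
def cast {X Y X' Y' : List S.Ob} (hX : X = X') (hY : Y = Y') (l : Layer S X Y) : Layer S X' Y' :=
  ⟨l.left, l.right, l.src, l.tgt, l.par, l.gen, hX ▸ l.hX, hY ▸ l.hY⟩

end Layer

namespace Diagram

variable {S : Signature.{u, v}}

/-- Vertical composition: the first diagram is at the bottom. -/
def comp {X Y Z : List S.Ob} : Diagram S X Y → Diagram S Y Z → Diagram S X Z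
  | nil _, e => e
  | cons l d, e => cons l (d.comp e)

theorem comp_nil {X Y : List S.Ob} (d : Diagram S X Y) : d.comp (nil Y) = d := by
  induction d with
  | nil => rfl
  | cons l d ih => exact congrArg (cons l) ih

theorem comp_assoc {W X Y Z : List S.Ob} (c : Diagram S W X) (d : Diagram S X Y)
    (e : Diagram S Y Z) : (c.comp d).comp e = c.comp (d.comp e) := by
  induction c with
  | nil => rfl
  | cons l c ih => exact congrArg (cons l) (ih d)

/-- The parity of a diagram, the sum of the parities of its generators. -/
def parity {X Y : List S.Ob} : Diagram S X Y → ZMod 2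
  | nil _ => 0
  | cons l d => l.par + d.parity

theorem parity_comp {X Y Z : List S.Ob} (d : Diagram S X Y) (e : Diagram S Y Z) :
    (d.comp e).parity = d.parity + e.parity := by
  induction d with
  | nil => exact (zero_add _).symm
  | cons l d ih => exact (congrArg (l.par + ·) (ih e)).trans (add_assoc _ _ _).symm

/-- `1_U ⊗ d`. -/
def whiskerL (U : List S.Ob) {X Y : List S.Ob} : Diagram S X Y → Diagram S (U ++ X) (U ++ Y)
  | nil X => nil (U ++ X)
  | cons l d => cons (l.whiskerL U) (d.whiskerL U)

/-- `d ⊗ 1_V`. -/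
def whiskerR (V : List S.Ob) {X Y : List S.Ob} : Diagram S X Y → Diagram S (X ++ V) (Y ++ V)
  | nil X => nil (X ++ V)
  | cons l d => cons (l.whiskerR V) (d.whiskerR V)

theorem whiskerL_comp (U : List S.Ob) {X Y Z : List S.Ob} (d : Diagram S X Y)
    (e : Diagram S Y Z) : (d.comp e).whiskerL U = (d.whiskerL U).comp (e.whiskerL U) := by
  induction d with
  | nil => rfl
  | cons l d ih => exact congrArg (cons _) (ih e)

theorem whiskerR_comp (V : List S.Ob) {X Y Z : List S.Ob} (d : Diagram S X Y)
    (e : Diagram S Y Z) : (d.comp e).whiskerR V = (d.whiskerR V).comp (e.whiskerR V) := by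
  induction d with
  | nil => rfl
  | cons l d ih => exact congrArg (cons _) (ih e)

theorem parity_whiskerL (U : List S.Ob) {X Y : List S.Ob} (d : Diagram S X Y) :
    (d.whiskerL U).parity = d.parity := by
  induction d with
  | nil => rfl
  | cons l d ih => exact congrArg (l.par + ·) ih

theorem parity_whiskerR (V : List S.Ob) {X Y : List S.Ob} (d : Diagram S X Y) :
    (d.whiskerR V).parity = d.parity := by
  induction d with
  | nil => rfl
  | cons l d ih => exact congrArg (l.par + ·) ih

/-- Transport along equalities of source and target. -/
def cast {X Y X' Y' : List S.Ob} (hX : X = X') (hY : Y = Y') (d : Diagram S X Y) :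
    Diagram S X' Y' := hX ▸ hY ▸ d

theorem cast_nil {X X' : List S.Ob} (h : X = X') : cast h h (nil X) = nil X' := by
  subst h; rfl

theorem cast_cons {X Y Z X' Y' Z' : List S.Ob} (hX : X = X') (hY : Y = Y') (hZ : Z = Z')
    (l : Layer S X Y) (d : Diagram S Y Z) :
    cast hX hZ (cons l d) = cons (l.cast hX hY) (d.cast hY hZ) := by
  subst hX hY hZ; rfl

theorem whiskerL_nil {X Y : List S.Ob} (d : Diagram S X Y) : d.whiskerL [] = d := by
  induction d with
  | nil => rfl
  | cons l d ih => exact congrArg (cons l) ih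

theorem whiskerR_nil {X Y : List S.Ob} (d : Diagram S X Y) :
    d.whiskerR [] = cast (List.append_nil X).symm (List.append_nil Y).symm d := by
  induction d with
  | nil X => exact (cast_nil _).symm
  | @cons X Y Z l d ih =>
    rw [cast_cons _ (List.append_nil Y).symm, ← ih]
    exact congrArg (fun l => cons l (d.whiskerR [])) (by
      simp [Layer.whiskerR, Layer.cast])

theorem whiskerL_append (U V : List S.Ob) {X Y : List S.Ob} (d : Diagram S X Y) :
    d.whiskerL (U ++ V) = cast (List.append_assoc U V X).symm (List.append_assoc U V Y).symm
      ((d.whiskerL V).whiskerL U) := by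
  induction d with
  | nil X => exact (cast_nil _).symm
  | @cons X Y Z l d ih =>
    refine Eq.trans ?_ (cast_cons _ (List.append_assoc U V Y).symm _ _ _).symm
    rw [← ih]
    exact congrArg (fun l => cons l (d.whiskerL (U ++ V))) (by
      simp [Layer.whiskerL, Layer.cast])

theorem whiskerR_append (U V : List S.Ob) {X Y : List S.Ob} (d : Diagram S X Y) :
    (d.whiskerR U).whiskerR V = cast (List.append_assoc X U V).symm (List.append_assoc Y U V).symm
      (d.whiskerR (U ++ V)) := by
  induction d with
  | nil X => exact (cast_nil _).symm
  | @cons X Y Z l d ih =>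
    refine Eq.trans ?_ (cast_cons _ (List.append_assoc Y U V).symm _ _ _).symm
    rw [← ih]
    exact congrArg (fun l => cons l ((d.whiskerR U).whiskerR V)) (by
      simp [Layer.whiskerR, Layer.cast])

theorem whiskerR_whiskerL (U V : List S.Ob) {X Y : List S.Ob} (d : Diagram S X Y) :
    (d.whiskerL U).whiskerR V = cast (List.append_assoc U X V).symm (List.append_assoc U Y V).symm
      ((d.whiskerR V).whiskerL U) := by
  induction d with
  | nil X => exact (cast_nil _).symm
  | @cons X Y Z l d ih =>
    refine Eq.trans ?_ (cast_cons _ (List.append_assoc U Y V).symm _ _ _).symm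
    rw [← ih]
    exact congrArg (fun l => cons l ((d.whiskerL U).whiskerR V)) (by
      simp [Layer.whiskerR, Layer.whiskerL, Layer.cast])

end Diagram

/-- Formal linear combinations of string diagrams. -/
abbrev FreeHom (k : Type w) [Field k] (S : Signature.{u, v}) (X Y : List S.Ob) :
    Type (max u v w) :=
  Diagram S X Y →₀ k

namespace FreeHom

variable {k : Type w} [Field k] {S : Signature.{u, v}}

/-- The identity diagram. -/
def id (k : Type w) [Field k] {S : Signature.{u, v}} (X : List S.Ob) : FreeHom k S X X :=
  Finsupp.single (Diagram.nil X) 1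

/-- The diagram `1_U ⊗ g ⊗ 1_V` with a single generator `g`. -/
def layer (k : Type w) [Field k] {S : Signature.{u, v}} (U : List S.Ob) {s t : List S.Ob}
    {p : ZMod 2} (g : S.Gen s t p) (V : List S.Ob) {X Y : List S.Ob}
    (hX : X = U ++ (s ++ V) := by rfl) (hY : Y = U ++ (t ++ V) := by rfl) : FreeHom k S X Y :=
  Finsupp.single (Diagram.cons ⟨U, V, s, t, p, g, hX, hY⟩ (Diagram.nil Y)) 1

/-- Bilinear extension of vertical composition. -/
def compLinear {X Y Z : List S.Ob} :
    FreeHom k S X Y →ₗ[k] FreeHom k S Y Z →ₗ[k] FreeHom k S X Z :=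
  Finsupp.linearCombination k fun d => Finsupp.lmapDomain k k fun e => d.comp e

/-- Vertical composition, the first morphism being at the bottom. -/
def comp {X Y Z : List S.Ob} (f : FreeHom k S X Y) (g : FreeHom k S Y Z) : FreeHom k S X Z :=
  compLinear f g

infixr:80 " ⋙ₛ " => FreeHom.comp

theorem single_comp_single {X Y Z : List S.Ob} (d : Diagram S X Y) (e : Diagram S Y Z) (a b : k) :
    (Finsupp.single d a : FreeHom k S X Y) ⋙ₛ (Finsupp.single e b : FreeHom k S Y Z) =
      Finsupp.single (d.comp e) (a * b) := by
  simp [comp, compLinear, Finsupp.linearCombination_single]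

theorem add_comp {X Y Z : List S.Ob} (f f' : FreeHom k S X Y) (g : FreeHom k S Y Z) :
    (f + f') ⋙ₛ g = f ⋙ₛ g + f' ⋙ₛ g := by simp [comp]

theorem comp_add {X Y Z : List S.Ob} (f : FreeHom k S X Y) (g g' : FreeHom k S Y Z) :
    f ⋙ₛ (g + g') = f ⋙ₛ g + f ⋙ₛ g' := by simp [comp]

theorem id_comp {X Y : List S.Ob} (f : FreeHom k S X Y) : id k X ⋙ₛ f = f := by
  induction f using Finsupp.induction_linear with
  | zero => simp [comp]
  | add f g hf hg => rw [comp_add, hf, hg]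
  | single d a => rw [id, single_comp_single, one_mul]; rfl

theorem comp_id {X Y : List S.Ob} (f : FreeHom k S X Y) : f ⋙ₛ id k Y = f := by
  induction f using Finsupp.induction_linear with
  | zero => simp [comp]
  | add f g hf hg => rw [add_comp, hf, hg]
  | single d a => rw [id, single_comp_single, mul_one, Diagram.comp_nil]

theorem comp_assoc {W X Y Z : List S.Ob} (f : FreeHom k S W X) (g : FreeHom k S X Y)
    (h : FreeHom k S Y Z) : (f ⋙ₛ g) ⋙ₛ h = f ⋙ₛ g ⋙ₛ h := by
  induction f using Finsupp.induction_linear with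
  | zero => simp [comp]
  | add f f' hf hf' => simp only [add_comp, hf, hf']
  | single d a =>
    induction g using Finsupp.induction_linear with
    | zero => simp [comp]
    | add g g' hg hg' => simp only [add_comp, comp_add, hg, hg']
    | single e b =>
      induction h using Finsupp.induction_linear with
      | zero => simp [comp]
      | add h h' hh hh' => simp only [comp_add, hh, hh']
      | single c x => simp only [single_comp_single, Diagram.comp_assoc, mul_assoc]

/-- Linear extension of `d ↦ 1_U ⊗ d`. -/
def whiskerL (U : List S.Ob) {X Y : List S.Ob} :
    FreeHom k S X Y →ₗ[k] FreeHom k S (U ++ X) (U ++ Y) :=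
  Finsupp.lmapDomain k k (Diagram.whiskerL U)

/-- Linear extension of `d ↦ d ⊗ 1_V`. -/
def whiskerR (V : List S.Ob) {X Y : List S.Ob} :
    FreeHom k S X Y →ₗ[k] FreeHom k S (X ++ V) (Y ++ V) :=
  Finsupp.lmapDomain k k (Diagram.whiskerR V)

/-- Transport along equalities of source and target. -/
def castHom {X Y X' Y' : List S.Ob} (hX : X = X') (hY : Y = Y') :
    FreeHom k S X Y →ₗ[k] FreeHom k S X' Y' :=
  Finsupp.lmapDomain k k (Diagram.cast hX hY)

@[simp] theorem whiskerL_single (U : List S.Ob) {X Y : List S.Ob} (d : Diagram S X Y) (a : k) :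
    whiskerL U (Finsupp.single d a : FreeHom k S X Y) = Finsupp.single (d.whiskerL U) a := by
  simp [whiskerL]

@[simp] theorem whiskerR_single (V : List S.Ob) {X Y : List S.Ob} (d : Diagram S X Y) (a : k) :
    whiskerR V (Finsupp.single d a : FreeHom k S X Y) = Finsupp.single (d.whiskerR V) a := by
  simp [whiskerR]

@[simp] theorem castHom_single {X Y X' Y' : List S.Ob} (hX : X = X') (hY : Y = Y')
    (d : Diagram S X Y) (a : k) :
    castHom hX hY (Finsupp.single d a : FreeHom k S X Y) = Finsupp.single (d.cast hX hY) a := by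
  simp [castHom]

theorem whiskerL_comp (U : List S.Ob) {X Y Z : List S.Ob} (f : FreeHom k S X Y)
    (g : FreeHom k S Y Z) : whiskerL U (f ⋙ₛ g) = whiskerL U f ⋙ₛ whiskerL U g := by
  induction f using Finsupp.induction_linear with
  | zero => simp [comp]
  | add f f' hf hf' => simp only [add_comp, map_add, hf, hf']
  | single d a =>
    induction g using Finsupp.induction_linear with
    | zero => simp [comp]
    | add g g' hg hg' => simp only [comp_add, map_add, hg, hg']
    | single e b => simp only [single_comp_single, whiskerL_single, Diagram.whiskerL_comp]

theorem whiskerR_comp (V : List S.Ob) {X Y Z : List S.Ob} (f : FreeHom k S X Y)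
    (g : FreeHom k S Y Z) : whiskerR V (f ⋙ₛ g) = whiskerR V f ⋙ₛ whiskerR V g := by
  induction f using Finsupp.induction_linear with
  | zero => simp [comp]
  | add f f' hf hf' => simp only [add_comp, map_add, hf, hf']
  | single d a =>
    induction g using Finsupp.induction_linear with
    | zero => simp [comp]
    | add g g' hg hg' => simp only [comp_add, map_add, hg, hg']
    | single e b => simp only [single_comp_single, whiskerR_single, Diagram.whiskerR_comp]

theorem whiskerL_nil {X Y : List S.Ob} (f : FreeHom k S X Y) : whiskerL [] f = f := by
  induction f using Finsupp.induction_linear with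
  | zero => simp
  | add f f' hf hf' => rw [map_add, hf, hf']
  | single d a => rw [whiskerL_single, Diagram.whiskerL_nil]

theorem whiskerR_nil {X Y : List S.Ob} (f : FreeHom k S X Y) :
    whiskerR [] f = castHom (List.append_nil X).symm (List.append_nil Y).symm f := by
  induction f using Finsupp.induction_linear with
  | zero => simp
  | add f f' hf hf' => rw [map_add, hf, hf', map_add]
  | single d a => rw [whiskerR_single, Diagram.whiskerR_nil, castHom_single]

theorem whiskerL_append (U V : List S.Ob) {X Y : List S.Ob} (f : FreeHom k S X Y) :
    whiskerL (U ++ V) f = castHom (List.append_assoc U V X).symm (List.append_assoc U V Y).symm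
      (whiskerL U (whiskerL V f)) := by
  induction f using Finsupp.induction_linear with
  | zero => simp
  | add f f' hf hf' => simp only [map_add, hf, hf']
  | single d a => simp only [whiskerL_single, castHom_single, Diagram.whiskerL_append]

theorem whiskerR_append (U V : List S.Ob) {X Y : List S.Ob} (f : FreeHom k S X Y) :
    whiskerR V (whiskerR U f) = castHom (List.append_assoc X U V).symm
      (List.append_assoc Y U V).symm (whiskerR (U ++ V) f) := by
  induction f using Finsupp.induction_linear with
  | zero => simp
  | add f f' hf hf' => simp only [map_add, hf, hf']
  | single d a => simp only [whiskerR_single, castHom_single, Diagram.whiskerR_append]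

theorem whiskerR_whiskerL (U V : List S.Ob) {X Y : List S.Ob} (f : FreeHom k S X Y) :
    whiskerR V (whiskerL U f) = castHom (List.append_assoc U X V).symm
      (List.append_assoc U Y V).symm (whiskerL U (whiskerR V f)) := by
  induction f using Finsupp.induction_linear with
  | zero => simp
  | add f f' hf hf' => simp only [map_add, hf, hf']
  | single d a =>
    simp only [whiskerR_single, whiskerL_single, castHom_single, Diagram.whiskerR_whiskerL]

theorem whiskerL_id (U X : List S.Ob) : whiskerL U (id k X) = id k (U ++ X) :=
  whiskerL_single _ _ _

theorem whiskerR_id (V X : List S.Ob) : whiskerR V (id k X) = id k (X ++ V) :=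
  whiskerR_single _ _ _

/-- The formal linear combinations of diagrams of parity `p`. -/
def homog (k : Type w) [Field k] (S : Signature.{u, v}) (X Y : List S.Ob) (p : ZMod 2) :
    Submodule k (FreeHom k S X Y) :=
  Finsupp.supported k k {d | d.parity = p}

theorem single_mem_homog {X Y : List S.Ob} (d : Diagram S X Y) (a : k) {p : ZMod 2}
    (h : d.parity = p) : (Finsupp.single d a : FreeHom k S X Y) ∈ homog k S X Y p :=
  Finsupp.single_mem_supported k a h

theorem id_mem_homog (X : List S.Ob) : id k X ∈ homog k S X X 0 := single_mem_homog _ _ rfl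

theorem layer_mem_homog (U : List S.Ob) {s t : List S.Ob} {p : ZMod 2} (g : S.Gen s t p)
    (V : List S.Ob) {X Y : List S.Ob} (hX : X = U ++ (s ++ V)) (hY : Y = U ++ (t ++ V)) :
    layer k U g V hX hY ∈ homog k S X Y p := single_mem_homog _ _ (add_zero p)

theorem isCompl_homog (X Y : List S.Ob) :
    IsCompl (homog k S X Y 0) (homog k S X Y 1) := by
  constructor
  · refine Finsupp.disjoint_supported_supported (Set.disjoint_left.2 fun d h0 h1 => ?_)
    exact zero_ne_one (h0.symm.trans h1)
  · rw [codisjoint_iff, homog, homog, ← Finsupp.supported_union, ← Finsupp.supported_univ]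
    congr 1
    exact Set.eq_univ_of_forall fun d => zmod_two_cases d.parity

theorem homog_le {X Y : List S.Ob} {p : ZMod 2} {N : Submodule k (FreeHom k S X Y)}
    (h : ∀ d : Diagram S X Y, d.parity = p → (Finsupp.single d 1 : FreeHom k S X Y) ∈ N) :
    homog k S X Y p ≤ N := by
  rw [homog, Finsupp.supported_eq_span_single, Submodule.span_le]
  rintro _ ⟨d, hd, rfl⟩
  exact h d hd

theorem comp_mem_homog {X Y Z : List S.Ob} {p q : ZMod 2} {f : FreeHom k S X Y}
    {g : FreeHom k S Y Z} (hf : f ∈ homog k S X Y p) (hg : g ∈ homog k S Y Z q) :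
    f ⋙ₛ g ∈ homog k S X Z (p + q) := by
  have : homog k S X Y p ≤ (homog k S X Z (p + q)).comap (compLinear.flip g) := by
    refine homog_le fun d hd => ?_
    have : homog k S Y Z q ≤ (homog k S X Z (p + q)).comap (compLinear (Finsupp.single d 1)) := by
      refine homog_le fun e he => ?_
      change FreeHom.comp (Finsupp.single d 1) (Finsupp.single e 1) ∈ homog k S X Z (p + q)
      rw [single_comp_single]
      exact single_mem_homog _ _ (by rw [Diagram.parity_comp, hd, he])
    exact this hg
  exact this hf

theorem whiskerL_mem_homog (U : List S.Ob) {X Y : List S.Ob} {p : ZMod 2} {f : FreeHom k S X Y}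
    (hf : f ∈ homog k S X Y p) : whiskerL U f ∈ homog k S (U ++ X) (U ++ Y) p := by
  have : homog k S X Y p ≤ (homog k S (U ++ X) (U ++ Y) p).comap (whiskerL U) := by
    refine homog_le fun d hd => ?_
    rw [Submodule.mem_comap, whiskerL_single]
    exact single_mem_homog _ _ (by rw [Diagram.parity_whiskerL, hd])
  exact this hf

theorem whiskerR_mem_homog (V : List S.Ob) {X Y : List S.Ob} {p : ZMod 2} {f : FreeHom k S X Y}
    (hf : f ∈ homog k S X Y p) : whiskerR V f ∈ homog k S (X ++ V) (Y ++ V) p := by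
  have : homog k S X Y p ≤ (homog k S (X ++ V) (Y ++ V) p).comap (whiskerR V) := by
    refine homog_le fun d hd => ?_
    rw [Submodule.mem_comap, whiskerR_single]
    exact single_mem_homog _ _ (by rw [Diagram.parity_whiskerR, hd])
  exact this hf

end FreeHom

/-- Relations between formal linear combinations of diagrams. Both sides of each relation have to
be homogeneous of the same parity. -/
structure Presentation (k : Type w) [Field k] (S : Signature.{u, v}) where
  Rel : ∀ {X Y : List S.Ob}, FreeHom k S X Y → FreeHom k S X Y → Prop
  homogeneous : ∀ {X Y : List S.Ob} {f g : FreeHom k S X Y}, Rel f g →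
    ∃ p, f ∈ FreeHom.homog k S X Y p ∧ g ∈ FreeHom.homog k S X Y p

namespace Presentation

open FreeHom

variable {k : Type w} [Field k] {S : Signature.{u, v}} (P : Presentation k S)

/-- The tensor ideal generated by the relations and by the super interchange law
`(1 ⊗ e) ∘ (d ⊗ 1) = (-1) ^ (parity d * parity e) (d ⊗ 1) ∘ (1 ⊗ e)`. -/
inductive InIdeal : ∀ {X Y : List S.Ob}, FreeHom k S X Y → Prop
  | rel {X Y : List S.Ob} {f g : FreeHom k S X Y} (h : P.Rel f g) : InIdeal (f - g)
  | interchange {X X' Y Y' : List S.Ob} {p q : ZMod 2} {f : FreeHom k S X X'}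
      {g : FreeHom k S Y Y'} (hf : f ∈ homog k S X X' p) (hg : g ∈ homog k S Y Y' q) :
      InIdeal (whiskerR Y f ⋙ₛ whiskerL X' g - sgn k (p * q) • (whiskerL X g ⋙ₛ whiskerR Y' f))
  | zero {X Y : List S.Ob} : InIdeal (0 : FreeHom k S X Y)
  | add {X Y : List S.Ob} {f g : FreeHom k S X Y} (hf : InIdeal f) (hg : InIdeal g) :
      InIdeal (f + g)
  | smul {X Y : List S.Ob} (c : k) {f : FreeHom k S X Y} (hf : InIdeal f) : InIdeal (c • f)
  | comp_left {X Y Z : List S.Ob} (f : FreeHom k S X Y) {g : FreeHom k S Y Z} (hg : InIdeal g) :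
      InIdeal (f ⋙ₛ g)
  | comp_right {X Y Z : List S.Ob} {f : FreeHom k S X Y} (hf : InIdeal f) (g : FreeHom k S Y Z) :
      InIdeal (f ⋙ₛ g)
  | whiskerL (U : List S.Ob) {X Y : List S.Ob} {f : FreeHom k S X Y} (hf : InIdeal f) :
      InIdeal (FreeHom.whiskerL U f)
  | whiskerR (V : List S.Ob) {X Y : List S.Ob} {f : FreeHom k S X Y} (hf : InIdeal f) :
      InIdeal (FreeHom.whiskerR V f)

/-- The tensor ideal, as a subspace of each morphism space. -/
def ideal (X Y : List S.Ob) : Submodule k (FreeHom k S X Y) where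
  carrier := {f | P.InIdeal f}
  add_mem' := InIdeal.add
  zero_mem' := InIdeal.zero
  smul_mem' := fun c _ h => InIdeal.smul c h

/-- The homogeneous components of an element of the ideal are in the ideal. -/
theorem InIdeal.exists_homog {X Y : List S.Ob} {f : FreeHom k S X Y} (hf : P.InIdeal f) :
    ∃ f₀ f₁, f₀ ∈ homog k S X Y 0 ∧ f₁ ∈ homog k S X Y 1 ∧ P.InIdeal f₀ ∧ P.InIdeal f₁ ∧
      f = f₀ + f₁ := by
  have key : ∀ {X Y : List S.Ob} {f : FreeHom k S X Y} {p : ZMod 2}, P.InIdeal f →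
      f ∈ homog k S X Y p → ∃ f₀ f₁, f₀ ∈ homog k S X Y 0 ∧ f₁ ∈ homog k S X Y 1 ∧
        P.InIdeal f₀ ∧ P.InIdeal f₁ ∧ f = f₀ + f₁ := by
    intro X Y f p h h'
    rcases zmod_two_cases p with rfl | rfl
    · exact ⟨f, 0, h', Submodule.zero_mem _, h, .zero, (add_zero f).symm⟩
    · exact ⟨0, f, Submodule.zero_mem _, h', .zero, h, (zero_add f).symm⟩
  induction hf with
  | rel h =>
    obtain ⟨p, hf, hg⟩ := P.homogeneous h
    exact key (.rel h) (Submodule.sub_mem _ hf hg)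
  | @interchange X X' Y Y' p q f g hf hg =>
    refine key (p := p + q) (.interchange hf hg) (Submodule.sub_mem _ ?_ (Submodule.smul_mem _ _ ?_))
    · exact comp_mem_homog (whiskerR_mem_homog _ hf) (whiskerL_mem_homog _ hg)
    · rw [add_comm]
      exact comp_mem_homog (whiskerL_mem_homog _ hg) (whiskerR_mem_homog _ hf)
  | zero => exact key (p := 0) .zero (Submodule.zero_mem _)
  | add _ _ hf hg =>
    obtain ⟨f₀, f₁, h₀, h₁, i₀, i₁, rfl⟩ := hf
    obtain ⟨g₀, g₁, h₀', h₁', i₀', i₁', rfl⟩ := hg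
    exact ⟨f₀ + g₀, f₁ + g₁, Submodule.add_mem _ h₀ h₀', Submodule.add_mem _ h₁ h₁', .add i₀ i₀',
      .add i₁ i₁', add_add_add_comm _ _ _ _⟩
  | smul c _ hf =>
    obtain ⟨f₀, f₁, h₀, h₁, i₀, i₁, rfl⟩ := hf
    exact ⟨c • f₀, c • f₁, Submodule.smul_mem _ _ h₀, Submodule.smul_mem _ _ h₁, .smul c i₀,
      .smul c i₁, smul_add _ _ _⟩
  | @comp_left X Y Z f g _ hg =>
    obtain ⟨g₀, g₁, h₀, h₁, i₀, i₁, rfl⟩ := hg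
    obtain ⟨f₀, f₁, j₀, j₁, rfl⟩ :=
      Submodule.codisjoint_iff_exists_add_eq.1 (isCompl_homog (k := k) (S := S) X Y).codisjoint f
    refine ⟨f₀ ⋙ₛ g₀ + f₁ ⋙ₛ g₁, f₀ ⋙ₛ g₁ + f₁ ⋙ₛ g₀,
      Submodule.add_mem _ (comp_mem_homog j₀ h₀) (comp_mem_homog j₁ h₁),
      Submodule.add_mem _ (comp_mem_homog j₀ h₁) (comp_mem_homog j₁ h₀),
      .add (.comp_left _ i₀) (.comp_left _ i₁), .add (.comp_left _ i₁) (.comp_left _ i₀), ?_⟩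
    simp only [FreeHom.comp_add, FreeHom.add_comp]
    abel
  | @comp_right X Y Z f _ g hf =>
    obtain ⟨f₀, f₁, h₀, h₁, i₀, i₁, rfl⟩ := hf
    obtain ⟨g₀, g₁, j₀, j₁, rfl⟩ :=
      Submodule.codisjoint_iff_exists_add_eq.1 (isCompl_homog (k := k) (S := S) Y Z).codisjoint g
    refine ⟨f₀ ⋙ₛ g₀ + f₁ ⋙ₛ g₁, f₀ ⋙ₛ g₁ + f₁ ⋙ₛ g₀,
      Submodule.add_mem _ (comp_mem_homog h₀ j₀) (comp_mem_homog h₁ j₁),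
      Submodule.add_mem _ (comp_mem_homog h₀ j₁) (comp_mem_homog h₁ j₀),
      .add (.comp_right i₀ _) (.comp_right i₁ _), .add (.comp_right i₀ _) (.comp_right i₁ _), ?_⟩
    simp only [FreeHom.comp_add, FreeHom.add_comp]
    abel
  | whiskerL U _ hf =>
    obtain ⟨f₀, f₁, h₀, h₁, i₀, i₁, rfl⟩ := hf
    exact ⟨_, _, whiskerL_mem_homog U h₀, whiskerL_mem_homog U h₁, .whiskerL U i₀, .whiskerL U i₁,
      map_add _ _ _⟩
  | whiskerR V _ hf =>
    obtain ⟨f₀, f₁, h₀, h₁, i₀, i₁, rfl⟩ := hf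
    exact ⟨_, _, whiskerR_mem_homog V h₀, whiskerR_mem_homog V h₁, .whiskerR V i₀, .whiskerR V i₁,
      map_add _ _ _⟩

/-- The objects of the strict monoidal supercategory presented by `P`: words in the generating
objects. -/
@[ext]
structure Cat (_P : Presentation k S) where
  word : List S.Ob

/-- Morphism spaces: formal linear combinations of diagrams modulo the tensor ideal. -/
abbrev HomSpace (X Y : List S.Ob) := FreeHom k S X Y ⧸ P.ideal X Y

/-- The class of a formal linear combination of diagrams. -/
abbrev mkHom {X Y : List S.Ob} : FreeHom k S X Y →ₗ[k] P.HomSpace X Y := (P.ideal X Y).mkQ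

/-- Composition on the quotients. -/
def homComp {X Y Z : List S.Ob} : P.HomSpace X Y →ₗ[k] P.HomSpace Y Z →ₗ[k] P.HomSpace X Z :=
  (P.ideal X Y).liftQ
    (LinearMap.mk₂ k (fun f (g : P.HomSpace Y Z) =>
      (P.ideal Y Z).liftQ (P.mkHom ∘ₗ compLinear f) (fun g hg =>
        (Submodule.Quotient.mk_eq_zero _).2 (InIdeal.comp_left f hg)) g)
      (fun f f' g => by
        obtain ⟨g, rfl⟩ := Submodule.mkQ_surjective _ g
        exact congrArg P.mkHom (LinearMap.map_add₂ compLinear f f' g))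
      (fun c f g => by
        obtain ⟨g, rfl⟩ := Submodule.mkQ_surjective _ g
        exact congrArg P.mkHom (LinearMap.map_smul₂ compLinear c f g))
      (fun f g g' => map_add _ _ _)
      (fun c f g => map_smul _ _ _))
    (fun f hf => by
      rw [LinearMap.mem_ker]
      refine LinearMap.ext fun g => ?_
      obtain ⟨g, rfl⟩ := Submodule.mkQ_surjective _ g
      exact (Submodule.Quotient.mk_eq_zero _).2 (InIdeal.comp_right hf g))

theorem homComp_mk {X Y Z : List S.Ob} (f : FreeHom k S X Y) (g : FreeHom k S Y Z) :
    P.homComp (P.mkHom f) (P.mkHom g) = P.mkHom (f ⋙ₛ g) := rfl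

/-- `1_U ⊗ f` on the quotients. -/
def homWhiskerL (U : List S.Ob) {X Y : List S.Ob} :
    P.HomSpace X Y →ₗ[k] P.HomSpace (U ++ X) (U ++ Y) :=
  Submodule.mapQ _ _ (FreeHom.whiskerL U) fun _ hf => InIdeal.whiskerL U hf

/-- `f ⊗ 1_V` on the quotients. -/
def homWhiskerR (V : List S.Ob) {X Y : List S.Ob} :
    P.HomSpace X Y →ₗ[k] P.HomSpace (X ++ V) (Y ++ V) :=
  Submodule.mapQ _ _ (FreeHom.whiskerR V) fun _ hf => InIdeal.whiskerR V hf

theorem homWhiskerL_mk (U : List S.Ob) {X Y : List S.Ob} (f : FreeHom k S X Y) :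
    P.homWhiskerL U (P.mkHom f) = P.mkHom (FreeHom.whiskerL U f) := rfl

theorem homWhiskerR_mk (V : List S.Ob) {X Y : List S.Ob} (f : FreeHom k S X Y) :
    P.homWhiskerR V (P.mkHom f) = P.mkHom (FreeHom.whiskerR V f) := rfl

/-- The parity subspaces of the quotients. -/
def homHomog (X Y : List S.Ob) (p : ZMod 2) : Submodule k (P.HomSpace X Y) :=
  (homog k S X Y p).map P.mkHom

theorem isCompl_homHomog (X Y : List S.Ob) : IsCompl (P.homHomog X Y 0) (P.homHomog X Y 1) := by
  constructor
  · rw [Submodule.disjoint_def]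
    rintro _ ⟨f, hf, rfl⟩ ⟨g, hg, hgf⟩
    have h : P.InIdeal (g - f) := (Submodule.Quotient.eq _).1 hgf
    obtain ⟨y₀, y₁, h₀, h₁, i₀, i₁, h⟩ := h.exists_homog
    have e : f + y₀ = g - y₁ := by
      rw [sub_eq_iff_eq_add] at h
      rw [h]; abel
    have hz : f + y₀ = 0 := (Submodule.disjoint_def.1 (isCompl_homog X Y).disjoint) _
      (Submodule.add_mem _ hf h₀) (e ▸ Submodule.sub_mem _ hg h₁)
    rw [eq_neg_of_add_eq_zero_left hz]
    exact (Submodule.Quotient.mk_eq_zero _).2 (Submodule.neg_mem (P.ideal X Y) i₀)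
  · rw [Submodule.codisjoint_iff_exists_add_eq]
    intro z
    obtain ⟨f, rfl⟩ := Submodule.mkQ_surjective _ z
    obtain ⟨f₀, f₁, j₀, j₁, rfl⟩ :=
      Submodule.codisjoint_iff_exists_add_eq.1 (isCompl_homog (k := k) (S := S) X Y).codisjoint f
    exact ⟨_, _, ⟨f₀, j₀, rfl⟩, ⟨f₁, j₁, rfl⟩, (map_add _ _ _).symm⟩

instance : Category P.Cat where
  Hom X Y := P.HomSpace X.word Y.word
  id X := P.mkHom (FreeHom.id k X.word)
  comp f g := P.homComp f g
  id_comp f := by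
    obtain ⟨f, rfl⟩ := Submodule.mkQ_surjective _ f
    exact (P.homComp_mk _ _).trans (congrArg P.mkHom (FreeHom.id_comp f))
  comp_id f := by
    obtain ⟨f, rfl⟩ := Submodule.mkQ_surjective _ f
    exact (P.homComp_mk _ _).trans (congrArg P.mkHom (FreeHom.comp_id f))
  assoc f g h := by
    obtain ⟨f, rfl⟩ := Submodule.mkQ_surjective _ f
    obtain ⟨g, rfl⟩ := Submodule.mkQ_surjective _ g
    obtain ⟨h, rfl⟩ := Submodule.mkQ_surjective _ h
    exact congrArg P.mkHom (FreeHom.comp_assoc f g h)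

instance (X Y : P.Cat) : AddCommGroup (X ⟶ Y) :=
  inferInstanceAs (AddCommGroup (P.HomSpace X.word Y.word))

instance (X Y : P.Cat) : Module k (X ⟶ Y) :=
  inferInstanceAs (Module k (P.HomSpace X.word Y.word))

instance : Preadditive P.Cat where
  homGroup := inferInstance
  add_comp _ _ _ f f' g := LinearMap.map_add₂ P.homComp f f' g
  comp_add _ _ _ f g g' := map_add (P.homComp f) g g'

instance : Linear k P.Cat where
  homModule := inferInstance
  smul_comp _ _ _ c f g := LinearMap.map_smul₂ P.homComp c f g
  comp_smul _ _ _ f c g := map_smul (P.homComp f) c g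

/-- The morphism of the presented supercategory given by a linear combination of diagrams. -/
def ofDiag {X Y : List S.Ob} (f : FreeHom k S X Y) : (⟨X⟩ : P.Cat) ⟶ ⟨Y⟩ := P.mkHom f

theorem ofDiag_surjective {X Y : P.Cat} (f : X ⟶ Y) :
    ∃ g : FreeHom k S X.word Y.word, P.ofDiag g = f :=
  Submodule.mkQ_surjective _ f

theorem ofDiag_eq_iff {X Y : List S.Ob} (f g : FreeHom k S X Y) :
    P.ofDiag f = P.ofDiag g ↔ P.InIdeal (f - g) :=
  Submodule.Quotient.eq _

theorem ofDiag_comp {X Y Z : List S.Ob} (f : FreeHom k S X Y) (g : FreeHom k S Y Z) :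
    P.ofDiag (f ⋙ₛ g) = P.ofDiag f ≫ P.ofDiag g := rfl

theorem ofDiag_id (X : List S.Ob) : P.ofDiag (FreeHom.id k X) = 𝟙 _ := rfl

theorem ofDiag_add {X Y : List S.Ob} (f g : FreeHom k S X Y) : P.ofDiag (f + g) = P.ofDiag f + P.ofDiag g := rfl

theorem ofDiag_smul {X Y : List S.Ob} (c : k) (f : FreeHom k S X Y) : P.ofDiag (c • f) = c • P.ofDiag f := rfl

instance : Supercategory k P.Cat where
  homParity X Y p := P.homHomog X.word Y.word p
  isCompl X Y := P.isCompl_homHomog X.word Y.word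
  id_mem X := ⟨_, id_mem_homog X.word, rfl⟩
  comp_mem := by
    rintro X Y Z p q _ _ ⟨f, hf, rfl⟩ ⟨g, hg, rfl⟩
    exact ⟨_, comp_mem_homog hf hg, rfl⟩

theorem ofDiag_mem {X Y : List S.Ob} {p : ZMod 2} {f : FreeHom k S X Y}
    (hf : f ∈ homog k S X Y p) : P.ofDiag f ∈ homParity (k := k) (⟨X⟩ : P.Cat) ⟨Y⟩ p := ⟨f, hf, rfl⟩

theorem exists_ofDiag_of_mem {X Y : P.Cat} {p : ZMod 2} {f : X ⟶ Y}
    (hf : f ∈ homParity (k := k) X Y p) :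
    ∃ g ∈ homog k S X.word Y.word p, P.ofDiag g = f := hf

/-- The tensor product of objects is concatenation of words. -/
instance : Monoid P.Cat where
  one := ⟨[]⟩
  mul X Y := ⟨X.word ++ Y.word⟩
  mul_assoc X Y Z := Cat.ext (List.append_assoc _ _ _)
  one_mul X := rfl
  mul_one X := Cat.ext (List.append_nil _)

/-- `f ⊗ g = (f ⊗ 1) ∘ (1 ⊗ g)`: horizontal juxtaposition, with `f` placed above `g`. -/
def tensor {X X' Y Y' : P.Cat} (f : X ⟶ X') (g : Y ⟶ Y') : X * Y ⟶ X' * Y' :=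
  P.homComp (P.homWhiskerL X.word g) (P.homWhiskerR Y'.word f)

theorem tensor_ofDiag {X X' Y Y' : List S.Ob} (f : FreeHom k S X X') (g : FreeHom k S Y Y') :
    P.tensor (P.ofDiag f) (P.ofDiag g) = P.ofDiag (FreeHom.whiskerL X g ⋙ₛ FreeHom.whiskerR Y' f) := rfl

theorem ofDiag_castHom {X Y X' Y' : List S.Ob} (hX : X = X') (hY : Y = Y') (f : FreeHom k S X Y) :
    P.ofDiag (FreeHom.castHom hX hY f) =
      eqToHom (by rw [hX]) ≫ P.ofDiag f ≫ eqToHom (by rw [hY]) := by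
  subst hX hY
  simp only [eqToHom_refl, Category.id_comp, Category.comp_id]
  congr 1
  exact Finsupp.mapDomain_id

theorem castHom_comp {X Y Z X' Y' Z' : List S.Ob} (hX : X = X') (hY : Y = Y') (hZ : Z = Z')
    (f : FreeHom k S X Y) (g : FreeHom k S Y Z) :
    castHom hX hZ (f ⋙ₛ g) = castHom hX hY f ⋙ₛ castHom hY hZ g := by
  subst hX hY hZ
  have h : ∀ {X Y : List S.Ob} (f : FreeHom k S X Y), castHom rfl rfl f = f :=
    fun f => Finsupp.mapDomain_id
  simp only [h]

instance : StrictMonoidalSupercategory k P.Cat where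
  tensorHom f g := P.tensor f g
  add_tensor {X X' Y Y'} f f' g := by
    obtain ⟨f, rfl⟩ := P.ofDiag_surjective f
    obtain ⟨f', rfl⟩ := P.ofDiag_surjective f'
    obtain ⟨g, rfl⟩ := P.ofDiag_surjective g
    rw [← ofDiag_add, tensor_ofDiag, tensor_ofDiag, tensor_ofDiag, map_add, FreeHom.comp_add, ofDiag_add]
  tensor_add {X X' Y Y'} f g g' := by
    obtain ⟨f, rfl⟩ := P.ofDiag_surjective f
    obtain ⟨g, rfl⟩ := P.ofDiag_surjective g
    obtain ⟨g', rfl⟩ := P.ofDiag_surjective g'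
    rw [← ofDiag_add, tensor_ofDiag, tensor_ofDiag, tensor_ofDiag, map_add, FreeHom.add_comp, ofDiag_add]
  smul_tensor {X X' Y Y'} c f g := by
    obtain ⟨f, rfl⟩ := P.ofDiag_surjective f
    obtain ⟨g, rfl⟩ := P.ofDiag_surjective g
    rw [← ofDiag_smul, tensor_ofDiag, tensor_ofDiag, map_smul, ofDiag_comp, ofDiag_smul, Linear.comp_smul, ofDiag_comp]
  tensor_smul {X X' Y Y'} c f g := by
    obtain ⟨f, rfl⟩ := P.ofDiag_surjective f
    obtain ⟨g, rfl⟩ := P.ofDiag_surjective g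
    rw [← ofDiag_smul, tensor_ofDiag, tensor_ofDiag, map_smul, ofDiag_comp, ofDiag_smul, Linear.smul_comp, ofDiag_comp]
  tensor_mem {X X' Y Y' p q f g} hf hg := by
    obtain ⟨f, hf', rfl⟩ := P.exists_ofDiag_of_mem hf
    obtain ⟨g, hg', rfl⟩ := P.exists_ofDiag_of_mem hg
    rw [tensor_ofDiag, add_comm]
    exact P.ofDiag_mem (comp_mem_homog (whiskerL_mem_homog _ hg') (whiskerR_mem_homog _ hf'))
  tensor_id X Y := by
    rw [← ofDiag_id, ← ofDiag_id, tensor_ofDiag, FreeHom.whiskerL_id, FreeHom.whiskerR_id, FreeHom.comp_id]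
    rfl
  interchange {X X' X'' Y Y' Y'' p q} f f' g' g hf hg := by
    obtain ⟨f, hf', rfl⟩ := P.exists_ofDiag_of_mem hf
    obtain ⟨g, hg', rfl⟩ := P.exists_ofDiag_of_mem hg
    obtain ⟨f', rfl⟩ := P.ofDiag_surjective f'
    obtain ⟨g', rfl⟩ := P.ofDiag_surjective g'
    have h : P.ofDiag (FreeHom.whiskerR Y'.word f ⋙ₛ FreeHom.whiskerL X'.word g) =
        sgn k (p * q) • P.ofDiag (FreeHom.whiskerL X.word g ⋙ₛ FreeHom.whiskerR Y''.word f) :=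
      (P.ofDiag_eq_iff _ _).2 (.interchange hf' hg')
    rw [← ofDiag_comp, ← ofDiag_comp, tensor_ofDiag, tensor_ofDiag, tensor_ofDiag, FreeHom.whiskerL_comp,
      FreeHom.whiskerR_comp]
    simp only [ofDiag_comp, Category.assoc] at h ⊢
    rw [reassoc_of% h, Linear.smul_comp, Linear.comp_smul, Category.assoc]
  tensor_assoc {X X' Y Y' Z Z'} f g h := by
    obtain ⟨f, rfl⟩ := P.ofDiag_surjective f
    obtain ⟨g, rfl⟩ := P.ofDiag_surjective g
    obtain ⟨h, rfl⟩ := P.ofDiag_surjective h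
    rw [tensor_ofDiag, tensor_ofDiag, tensor_ofDiag]
    refine Eq.trans (congrArg P.ofDiag ?_) (P.ofDiag_castHom (List.append_assoc _ _ _).symm
      (List.append_assoc _ _ _).symm (FreeHom.whiskerL X.word
        (FreeHom.whiskerL Y.word h ⋙ₛ FreeHom.whiskerR Z'.word g) ⋙ₛ
          FreeHom.whiskerR (Y'.word ++ Z'.word) f))
    rw [FreeHom.whiskerR_comp, FreeHom.whiskerL_comp,
      castHom_comp _ (List.append_assoc X.word Y'.word Z'.word).symm,
      castHom_comp _ (List.append_assoc X.word Y.word Z'.word).symm,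
      ← FreeHom.whiskerL_append, ← FreeHom.whiskerR_append, ← FreeHom.whiskerR_whiskerL,
      FreeHom.comp_assoc]
  one_tensor {X X'} f := by
    obtain ⟨f, rfl⟩ := P.ofDiag_surjective f
    change P.ofDiag (FreeHom.whiskerL [] f ⋙ₛ FreeHom.whiskerR X'.word (FreeHom.id k [])) =
      𝟙 _ ≫ P.ofDiag f ≫ 𝟙 _
    rw [FreeHom.whiskerL_nil, FreeHom.whiskerR_id, Category.id_comp, Category.comp_id]
    exact congrArg P.ofDiag (FreeHom.comp_id f)
  tensor_one {X X'} f := by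
    obtain ⟨f, rfl⟩ := P.ofDiag_surjective f
    refine Eq.trans (congrArg P.ofDiag ?_) (P.ofDiag_castHom (List.append_nil _).symm
      (List.append_nil _).symm f)
    exact (congrArg (· ⋙ₛ FreeHom.whiskerR [] f) (FreeHom.whiskerL_id X.word [])).trans
      ((FreeHom.id_comp _).trans (FreeHom.whiskerR_nil f))

/-- Adding relations. -/
theorem InIdeal.mono {P Q : Presentation k S}
    (h : ∀ {X Y : List S.Ob} {f g : FreeHom k S X Y}, P.Rel f g → Q.Rel f g)
    {X Y : List S.Ob} {f : FreeHom k S X Y} (hf : P.InIdeal f) : Q.InIdeal f := by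
  induction hf with
  | rel h' => exact .rel (h h')
  | interchange hf hg => exact .interchange hf hg
  | zero => exact .zero
  | add _ _ hf hg => exact .add hf hg
  | smul c _ hf => exact .smul c hf
  | comp_left f _ hg => exact .comp_left f hg
  | comp_right _ g hf => exact .comp_right hf g
  | whiskerL U _ hf => exact .whiskerL U hf
  | whiskerR V _ hf => exact .whiskerR V hf

/-- The quotient functor between the supercategories presented by two sets of relations, the first
contained in the second. -/
def quotientFunctor (P Q : Presentation k S)
    (h : ∀ {X Y : List S.Ob} {f g : FreeHom k S X Y}, P.Rel f g → Q.Rel f g) : P.Cat ⥤ Q.Cat where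
  obj X := ⟨X.word⟩
  map {X Y} f := Submodule.mapQ (P.ideal X.word Y.word) (Q.ideal X.word Y.word) LinearMap.id
    (fun _ hf => InIdeal.mono h hf) f
  map_id _ := rfl
  map_comp f g := by
    obtain ⟨f, rfl⟩ := P.ofDiag_surjective f
    obtain ⟨g, rfl⟩ := P.ofDiag_surjective g
    rfl

instance (P Q : Presentation k S)
    (h : ∀ {X Y : List S.Ob} {f g : FreeHom k S X Y}, P.Rel f g → Q.Rel f g) :
    (quotientFunctor P Q h).Additive where
  map_add := map_add _ _ _

end Presentation

/-! ### Superalgebras -/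

section superalgebra

variable {k : Type w} {A : Type v} [Field k] [Ring A] [Algebra k A]
  (𝒜 : ZMod 2 → Submodule k A) [GradedAlgebra 𝒜]

/-- An anti-involution of the superalgebra `A = 𝒜 0 ⊕ 𝒜 1`. -/
structure AntiInvolution where
  toFun : A →ₗ[k] A
  map_mem {p : ZMod 2} {a : A} (ha : a ∈ 𝒜 p) : toFun a ∈ 𝒜 p
  map_mul {p q : ZMod 2} {a b : A} (ha : a ∈ 𝒜 p) (hb : b ∈ 𝒜 q) :
    toFun (a * b) = sgn k (p * q) • (toFun b * toFun a)
  involutive (a : A) : toFun (toFun a) = a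

/-- The action of an anti-involution on the homogeneous elements of parity `p`. -/
def AntiInvolution.app {𝒜 : ZMod 2 → Submodule k A} [GradedAlgebra 𝒜] (inv : AntiInvolution 𝒜)
    {p : ZMod 2} (a : 𝒜 p) : 𝒜 p := ⟨inv.toFun a, inv.map_mem a.2⟩

/-- The product of homogeneous elements. -/
def homMul {p q : ZMod 2} (a : 𝒜 p) (b : 𝒜 q) : 𝒜 (p + q) :=
  ⟨a * b, SetLike.mul_mem_graded a.2 b.2⟩

/-- The unit element, as an even element. -/
def homOne : 𝒜 0 := ⟨1, SetLike.one_mem_graded 𝒜⟩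

/-- The supertrace `str_A(a) = ∑ (-1) ^ (parity b) b^*(b a)` (sum over the elements `b` of a
homogeneous basis of `A`) of right multiplication by `a`. -/
def superTrace (a : A) : k :=
  LinearMap.trace k A
    ((GradedAlgebra.proj 𝒜 0 - GradedAlgebra.proj 𝒜 1) ∘ₗ LinearMap.mulRight k a)

theorem superTrace_odd {a : A} (ha : a ∈ 𝒜 1) : superTrace 𝒜 a = 0 := by
  by_cases hfin : Module.Finite k A
  swap
  · rw [superTrace, LinearMap.trace, dif_neg, LinearMap.zero_apply]
    rintro ⟨s, ⟨b⟩⟩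
    exact hfin (Module.Finite.of_basis b)
  have hint : DirectSum.IsInternal 𝒜 := DirectSum.Decomposition.isInternal 𝒜
  refine LinearMap.trace_eq_zero_of_mapsTo_ne hint (fun i => i + 1) (by decide) ?_
  intro i x hx
  have hxa : x * a ∈ 𝒜 (i + 1) := SetLike.mul_mem_graded hx ha
  change GradedAlgebra.proj 𝒜 0 (x * a) - GradedAlgebra.proj 𝒜 1 (x * a) ∈ 𝒜 (i + 1)
  have h : ∀ j : ZMod 2, GradedAlgebra.proj 𝒜 j (x * a) ∈ 𝒜 (i + 1) := by
    intro j
    rw [GradedAlgebra.proj_apply]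
    by_cases hj : i + 1 = j
    · subst hj; exact (DirectSum.decompose 𝒜 (x * a) (i + 1)).2
    · rw [DirectSum.decompose_of_mem_ne 𝒜 hxa hj]; exact Submodule.zero_mem _
  exact Submodule.sub_mem _ (h 0) (h 1)

/-- `form` is the (even) Frobenius form of an involutive Frobenius superalgebra structure on
`(A, inv)`: it is nondegenerate, its Nakayama automorphism `N`, defined by
`form (a b) = (-1) ^ (parity a * parity b) form (b N(a))`, satisfies `N ∘ N = 1`, and `form` is
invariant under `inv`. -/
structure IsInvolutiveFrobenius (inv : AntiInvolution 𝒜) (form : A →ₗ[k] k) : Prop where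
  even {a : A} (ha : a ∈ 𝒜 1) : form a = 0
  nondegenerate : ((LinearMap.mul k A).compr₂ form).Nondegenerate
  nakayama : ∃ N : A ≃ₐ[k] A, (∀ p, ∀ a ∈ 𝒜 p, N a ∈ 𝒜 p) ∧
    (∀ p q, ∀ a ∈ 𝒜 p, ∀ b ∈ 𝒜 q, form (a * b) = sgn k (p * q) * form (b * N a)) ∧
    ∀ a, N (N a) = a
  map_inv (a : A) : form (inv.toFun a) = form a

end superalgebra

/-! ### The oriented Brauer supercategory -/

section orientedBrauer

/-- The generating objects `↑` and `↓`. -/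
inductive OBOb : Type
  | up
  | down

open OBOb FreeHom

variable {k : Type w} {A : Type v} [Field k] [Ring A] [Algebra k A]
  (𝒜 : ZMod 2 → Submodule k A) [GradedAlgebra 𝒜]

/-- The generating morphisms of the oriented Brauer supercategory: the upward crossing, the upward
tokens (for homogeneous elements of `A`; the token of an arbitrary element is the sum of the tokens
of its homogeneous components), and the left and right caps and cups. -/
inductive OBGen : List OBOb → List OBOb → ZMod 2 → Type v
  | cross : OBGen [up, up] [up, up] 0
  | tok {p : ZMod 2} (a : 𝒜 p) : OBGen [up] [up] p
  | leftCap : OBGen [down, up] [] 0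
  | leftCup : OBGen [] [up, down] 0
  | rightCap : OBGen [up, down] [] 0
  | rightCup : OBGen [] [down, up] 0

/-- The generators of the oriented Brauer supercategory. -/
def OBSig : Signature.{0, v} where
  Ob := OBOb
  Gen := OBGen 𝒜

/-- Formal linear combinations of oriented string diagrams. -/
abbrev OBFree (X Y : List OBOb) := FreeHom k (OBSig 𝒜) X Y

/-- The diagram `1_U ⊗ g ⊗ 1_V` for a generator `g`. -/
def obLayer (U : List OBOb) {s t : List OBOb} {p : ZMod 2} (g : OBGen 𝒜 s t p) (V : List OBOb) :
    OBFree 𝒜 (U ++ (s ++ V)) (U ++ (t ++ V)) :=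
  layer k (S := OBSig 𝒜) U g V rfl rfl

/-- The identity diagram. -/
abbrev obId (X : List OBOb) : OBFree 𝒜 X X := FreeHom.id k (S := OBSig 𝒜) X

/-- Vertical composition of oriented diagrams, the first one being at the bottom. -/
abbrev obComp {X Y Z : List OBOb} (f : OBFree 𝒜 X Y) (g : OBFree 𝒜 Y Z) : OBFree 𝒜 X Z :=
  FreeHom.comp f g

/-- The crossing `↑ ↓ ⟶ ↓ ↑`. -/
def rightCross : OBFree 𝒜 [up, down] [down, up] :=
  obComp 𝒜 (Y := [down, up, up, down]) (obLayer 𝒜 [] .rightCup [up, down]) <|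
  obComp 𝒜 (Y := [down, up, up, down]) (obLayer 𝒜 [down] .cross [down]) <|
  obLayer 𝒜 [down, up] .rightCap []

/-- The crossing `↓ ↑ ⟶ ↑ ↓`. -/
def leftCross : OBFree 𝒜 [down, up] [up, down] :=
  obComp 𝒜 (Y := [down, up, up, down]) (obLayer 𝒜 [down, up] .leftCup []) <|
  obComp 𝒜 (Y := [down, up, up, down]) (obLayer 𝒜 [down] .cross [down]) <|
  obLayer 𝒜 [] .leftCap [up, down]

/-- The crossing `↓ ↓ ⟶ ↓ ↓`. -/
def downCross : OBFree 𝒜 [down, down] [down, down] :=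
  obComp 𝒜 (Y := [down, up, down, down]) (obLayer 𝒜 [] .rightCup [down, down]) <|
  obComp 𝒜 (Y := [down, down, up, down])
    (whiskerL (S := OBSig 𝒜) [down] (whiskerR (S := OBSig 𝒜) [down] (rightCross 𝒜))) <|
  obLayer 𝒜 [down, down] .rightCap []

/-- The downward token `↓ ⟶ ↓`. -/
def downTok {p : ZMod 2} (a : 𝒜 p) : OBFree 𝒜 [down] [down] :=
  obComp 𝒜 (Y := [down, up, down]) (obLayer 𝒜 [] .rightCup [down]) <|
  obComp 𝒜 (Y := [down, up, down]) (obLayer 𝒜 [down] (.tok a) [down]) <|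
  obLayer 𝒜 [down] .rightCap []

/-- The relations of the oriented Brauer supercategory. -/
inductive OBRel : ∀ {X Y : List OBOb}, OBFree 𝒜 X Y → OBFree 𝒜 X Y → Prop
  | tok_one : OBRel (X := [up]) (Y := [up]) (obLayer 𝒜 [] (.tok (homOne 𝒜)) []) (obId 𝒜 [up])
  | tok_add {p : ZMod 2} (a b : 𝒜 p) : OBRel (X := [up]) (Y := [up])
      (obLayer 𝒜 [] (.tok (a + b)) []) (obLayer 𝒜 [] (.tok a) [] + obLayer 𝒜 [] (.tok b) [])
  | tok_smul {p : ZMod 2} (c : k) (a : 𝒜 p) : OBRel (X := [up]) (Y := [up])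
      (obLayer 𝒜 [] (.tok (c • a)) []) (c • obLayer 𝒜 [] (.tok a) [])
  | tok_mul {p q : ZMod 2} (a : 𝒜 p) (b : 𝒜 q) : OBRel (X := [up]) (Y := [up])
      (obComp 𝒜 (Y := [up]) (obLayer 𝒜 [] (.tok b) []) (obLayer 𝒜 [] (.tok a) []))
      (obLayer 𝒜 [] (.tok (homMul 𝒜 a b)) [])
  | cross_cross : OBRel (X := [up, up]) (Y := [up, up])
      (obComp 𝒜 (Y := [up, up]) (obLayer 𝒜 [] .cross []) (obLayer 𝒜 [] .cross []))
      (obId 𝒜 [up, up])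
  | braid : OBRel (X := [up, up, up]) (Y := [up, up, up])
      (obComp 𝒜 (Y := [up, up, up]) (obLayer 𝒜 [] .cross [up]) <|
        obComp 𝒜 (Y := [up, up, up]) (obLayer 𝒜 [up] .cross []) <|
        obLayer 𝒜 [] .cross [up])
      (obComp 𝒜 (Y := [up, up, up]) (obLayer 𝒜 [up] .cross []) <|
        obComp 𝒜 (Y := [up, up, up]) (obLayer 𝒜 [] .cross [up]) <|
        obLayer 𝒜 [up] .cross [])
  | tok_cross {p : ZMod 2} (a : 𝒜 p) : OBRel (X := [up, up]) (Y := [up, up])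
      (obComp 𝒜 (Y := [up, up]) (obLayer 𝒜 [] (.tok a) [up]) (obLayer 𝒜 [] .cross []))
      (obComp 𝒜 (Y := [up, up]) (obLayer 𝒜 [] .cross []) (obLayer 𝒜 [up] (.tok a) []))
  | left_zigzag_down : OBRel (X := [down]) (Y := [down])
      (obComp 𝒜 (Y := [down, up, down]) (obLayer 𝒜 [down] .leftCup [])
        (obLayer 𝒜 [] .leftCap [down]))
      (obId 𝒜 [down])
  | left_zigzag_up : OBRel (X := [up]) (Y := [up])
      (obComp 𝒜 (Y := [up, down, up]) (obLayer 𝒜 [] .leftCup [up])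
        (obLayer 𝒜 [up] .leftCap []))
      (obId 𝒜 [up])
  | rightCross_leftCross : OBRel (X := [up, down]) (Y := [up, down])
      (obComp 𝒜 (Y := [down, up]) (rightCross 𝒜) (leftCross 𝒜)) (obId 𝒜 [up, down])
  | leftCross_rightCross : OBRel (X := [down, up]) (Y := [down, up])
      (obComp 𝒜 (Y := [up, down]) (leftCross 𝒜) (rightCross 𝒜)) (obId 𝒜 [down, up])
  | left_curl : OBRel (X := [up]) (Y := [up])
      (obComp 𝒜 (Y := [down, up, up]) (obLayer 𝒜 [] .rightCup [up]) <|
        obComp 𝒜 (Y := [down, up, up]) (obLayer 𝒜 [down] .cross []) <|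
        obLayer 𝒜 [] .leftCap [up])
      (obId 𝒜 [up])
  | right_curl : OBRel (X := [up]) (Y := [up])
      (obComp 𝒜 (Y := [up, up, down]) (obLayer 𝒜 [up] .leftCup []) <|
        obComp 𝒜 (Y := [up, up, down]) (obLayer 𝒜 [] .cross [down]) <|
        obLayer 𝒜 [up] .rightCap [])
      (obId 𝒜 [up])

/-- The additional relation, evaluating the counterclockwise bubbles with a token `a` to
`d str_A(a)`. -/
inductive OBBubbleRel (d : k) : ∀ {X Y : List OBOb}, OBFree 𝒜 X Y → OBFree 𝒜 X Y → Prop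
  | bubble {p : ZMod 2} (a : 𝒜 p) : OBBubbleRel d (X := []) (Y := [])
      (obComp 𝒜 (Y := [down, up]) (obLayer 𝒜 [] .rightCup []) <|
        obComp 𝒜 (Y := [down, up]) (obLayer 𝒜 [down] (.tok a) []) <|
        obLayer 𝒜 [] .leftCap [])
      ((d * superTrace 𝒜 (a : A)) • obId 𝒜 [])

theorem obLayer_mem (U : List OBOb) {s t : List OBOb} {p : ZMod 2} (g : OBGen 𝒜 s t p)
    (V : List OBOb) : obLayer 𝒜 U g V ∈ homog k (OBSig 𝒜) (U ++ (s ++ V)) (U ++ (t ++ V)) p :=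
  layer_mem_homog (S := OBSig 𝒜) U g V rfl rfl

theorem comp_even {S : Signature.{u', v'}} {X Y Z : List S.Ob} {p q r : ZMod 2}
    {f : FreeHom k S X Y} {g : FreeHom k S Y Z} (hf : f ∈ homog k S X Y p)
    (hg : g ∈ homog k S Y Z q) (h : p + q = r) : FreeHom.comp f g ∈ homog k S X Z r :=
  h ▸ comp_mem_homog hf hg

theorem rightCross_mem :
    rightCross 𝒜 ∈ homog k (OBSig 𝒜) [up, down] [down, up] 0 :=
  comp_even (obLayer_mem 𝒜 _ _ _) (comp_even (obLayer_mem 𝒜 _ _ _) (obLayer_mem 𝒜 _ _ _) rfl) rfl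

theorem leftCross_mem :
    leftCross 𝒜 ∈ homog k (OBSig 𝒜) [down, up] [up, down] 0 :=
  comp_even (obLayer_mem 𝒜 _ _ _) (comp_even (obLayer_mem 𝒜 _ _ _) (obLayer_mem 𝒜 _ _ _) rfl) rfl

theorem OBRel.homogeneous {X Y : List OBOb} {f g : OBFree 𝒜 X Y} (h : OBRel 𝒜 f g) :
    ∃ p, f ∈ homog k (OBSig 𝒜) X Y p ∧ g ∈ homog k (OBSig 𝒜) X Y p := by
  have L := @obLayer_mem k A _ _ _ 𝒜 _
  cases h with
  | tok_one => exact ⟨0, L _ _ _, id_mem_homog _⟩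
  | tok_add a b => exact ⟨_, L _ _ _, Submodule.add_mem _ (L _ _ _) (L _ _ _)⟩
  | tok_smul c a => exact ⟨_, L _ _ _, Submodule.smul_mem _ _ (L _ _ _)⟩
  | tok_mul a b => exact ⟨_, comp_even (L _ _ _) (L _ _ _) (add_comm _ _), L _ _ _⟩
  | cross_cross => exact ⟨0, comp_even (L _ _ _) (L _ _ _) rfl, id_mem_homog _⟩
  | braid => exact ⟨0, comp_even (L _ _ _) (comp_even (L _ _ _) (L _ _ _) rfl) rfl,
      comp_even (L _ _ _) (comp_even (L _ _ _) (L _ _ _) rfl) rfl⟩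
  | tok_cross a => exact ⟨_, comp_even (L _ _ _) (L _ _ _) (add_zero _),
      comp_even (L _ _ _) (L _ _ _) (zero_add _)⟩
  | left_zigzag_down => exact ⟨0, comp_even (L _ _ _) (L _ _ _) rfl, id_mem_homog _⟩
  | left_zigzag_up => exact ⟨0, comp_even (L _ _ _) (L _ _ _) rfl, id_mem_homog _⟩
  | rightCross_leftCross =>
    exact ⟨0, comp_even (rightCross_mem 𝒜) (leftCross_mem 𝒜) rfl, id_mem_homog _⟩
  | leftCross_rightCross =>
    exact ⟨0, comp_even (leftCross_mem 𝒜) (rightCross_mem 𝒜) rfl, id_mem_homog _⟩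
  | left_curl =>
    exact ⟨0, comp_even (L _ _ _) (comp_even (L _ _ _) (L _ _ _) rfl) rfl, id_mem_homog _⟩
  | right_curl =>
    exact ⟨0, comp_even (L _ _ _) (comp_even (L _ _ _) (L _ _ _) rfl) rfl, id_mem_homog _⟩

theorem OBBubbleRel.homogeneous {d : k} {X Y : List OBOb} {f g : OBFree 𝒜 X Y}
    (h : OBBubbleRel 𝒜 d f g) :
    ∃ p, f ∈ homog k (OBSig 𝒜) X Y p ∧ g ∈ homog k (OBSig 𝒜) X Y p := by
  have L := @obLayer_mem k A _ _ _ 𝒜 _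
  cases h with
  | @bubble p a =>
    refine ⟨p, comp_even (L _ _ _) (comp_even (L _ _ _) (L _ _ _) (add_zero p)) (zero_add p), ?_⟩
    rcases zmod_two_cases p with rfl | rfl
    · exact Submodule.smul_mem _ _ (id_mem_homog _)
    · rw [superTrace_odd 𝒜 a.2, mul_zero, zero_smul]
      exact Submodule.zero_mem _

/-- The oriented Brauer supercategory `OB(A)`. -/
def OB : Presentation k (OBSig 𝒜) where
  Rel := OBRel 𝒜
  homogeneous := OBRel.homogeneous 𝒜

/-- The specialized oriented Brauer supercategory `OB(A; d)`. -/
def OBd (d : k) : Presentation k (OBSig 𝒜) where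
  Rel f g := OBRel 𝒜 f g ∨ OBBubbleRel 𝒜 d f g
  homogeneous h := h.elim (OBRel.homogeneous 𝒜) (OBBubbleRel.homogeneous 𝒜)

/-- The quotient functor `OB(A) ⥤ OB(A; d)`. -/
def OB.quotient (d : k) : (OB 𝒜).Cat ⥤ (OBd 𝒜 d).Cat :=
  Presentation.quotientFunctor (OB 𝒜) (OBd 𝒜 d) fun h => Or.inl h

instance (d : k) : (OB.quotient 𝒜 d).Additive where
  map_add := map_add _ _ _

end orientedBrauer

/-! ### The (unoriented) Brauer supercategory -/

section brauer

open FreeHom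

variable {k : Type w} {A : Type v} [Field k] [Ring A] [Algebra k A]
  {𝒜 : ZMod 2 → Submodule k A} [GradedAlgebra 𝒜] (inv : AntiInvolution 𝒜) (σ : ZMod 2)

/-- The generating object `•`. -/
inductive BrOb : Type
  | dot

open BrOb

/-- The generating morphisms of the Brauer supercategory: the crossing, the cap and the cup (of
parity `σ`), and the tokens. -/
inductive BrGen (𝒜 : ZMod 2 → Submodule k A) (σ : ZMod 2) :
    List BrOb → List BrOb → ZMod 2 → Type v
  | cross : BrGen 𝒜 σ [dot, dot] [dot, dot] 0
  | cap : BrGen 𝒜 σ [dot, dot] [] σ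
  | cup : BrGen 𝒜 σ [] [dot, dot] σ
  | tok {p : ZMod 2} (a : 𝒜 p) : BrGen 𝒜 σ [dot] [dot] p

/-- The generators of the Brauer supercategory. -/
def BrSig (𝒜 : ZMod 2 → Submodule k A) (σ : ZMod 2) : Signature.{0, v} where
  Ob := BrOb
  Gen := BrGen 𝒜 σ

/-- Formal linear combinations of unoriented string diagrams. -/
abbrev BrFree (𝒜 : ZMod 2 → Submodule k A) (σ : ZMod 2) (X Y : List BrOb) :=
  FreeHom k (BrSig 𝒜 σ) X Y

/-- The diagram `1_U ⊗ g ⊗ 1_V` for a generator `g`. -/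
def brLayer {𝒜 : ZMod 2 → Submodule k A} {σ : ZMod 2} (U : List BrOb) {s t : List BrOb}
    {p : ZMod 2} (g : BrGen 𝒜 σ s t p) (V : List BrOb) :
    BrFree 𝒜 σ (U ++ (s ++ V)) (U ++ (t ++ V)) :=
  layer k (S := BrSig 𝒜 σ) U g V rfl rfl

/-- The identity diagram. -/
abbrev brId {𝒜 : ZMod 2 → Submodule k A} {σ : ZMod 2} (X : List BrOb) : BrFree 𝒜 σ X X :=
  FreeHom.id k (S := BrSig 𝒜 σ) X

/-- Vertical composition of unoriented diagrams, the first one being at the bottom. -/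
abbrev brComp {𝒜 : ZMod 2 → Submodule k A} {σ : ZMod 2} {X Y Z : List BrOb}
    (f : BrFree 𝒜 σ X Y) (g : BrFree 𝒜 σ Y Z) : BrFree 𝒜 σ X Z :=
  FreeHom.comp f g

/-- The relations of the Brauer supercategory. -/
inductive BrRel : ∀ {X Y : List BrOb}, BrFree 𝒜 σ X Y → BrFree 𝒜 σ X Y → Prop
  | cross_cross : BrRel (X := [dot, dot]) (Y := [dot, dot])
      (brComp (Y := [dot, dot]) (brLayer [] .cross []) (brLayer [] .cross []))
      (brId [dot, dot])
  | braid : BrRel (X := [dot, dot, dot]) (Y := [dot, dot, dot])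
      (brComp (Y := [dot, dot, dot]) (brLayer [] .cross [dot]) <|
        brComp (Y := [dot, dot, dot]) (brLayer [dot] .cross []) <|
        brLayer [] .cross [dot])
      (brComp (Y := [dot, dot, dot]) (brLayer [dot] .cross []) <|
        brComp (Y := [dot, dot, dot]) (brLayer [] .cross [dot]) <|
        brLayer [dot] .cross [])
  | zigzag : BrRel (X := [dot]) (Y := [dot])
      (brComp (Y := [dot, dot, dot]) (brLayer [] .cup [dot]) (brLayer [dot] .cap []))
      (brId [dot])
  | zigzag_sign : BrRel (X := [dot]) (Y := [dot])
      (sgn k σ • brComp (Y := [dot, dot, dot]) (brLayer [dot] .cup []) (brLayer [] .cap [dot]))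
      (brId [dot])
  | cross_cap : BrRel (X := [dot, dot]) (Y := [])
      (brComp (Y := [dot, dot]) (brLayer [] .cross []) (brLayer [] .cap []))
      (brLayer [] .cap [])
  | cross_slide_cap : BrRel (X := [dot, dot, dot]) (Y := [dot])
      (brComp (Y := [dot, dot, dot]) (brLayer [] .cross [dot]) (brLayer [dot] .cap []))
      (brComp (Y := [dot, dot, dot]) (brLayer [dot] .cross []) (brLayer [] .cap [dot]))
  | tok_one : BrRel (X := [dot]) (Y := [dot]) (brLayer [] (.tok (homOne 𝒜)) []) (brId [dot])
  | tok_add {p : ZMod 2} (a b : 𝒜 p) : BrRel (X := [dot]) (Y := [dot])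
      (brLayer [] (.tok (a + b)) []) (brLayer [] (.tok a) [] + brLayer [] (.tok b) [])
  | tok_smul {p : ZMod 2} (c : k) (a : 𝒜 p) : BrRel (X := [dot]) (Y := [dot])
      (brLayer [] (.tok (c • a)) []) (c • brLayer [] (.tok a) [])
  | tok_mul {p q : ZMod 2} (a : 𝒜 p) (b : 𝒜 q) : BrRel (X := [dot]) (Y := [dot])
      (brComp (Y := [dot]) (brLayer [] (.tok b) []) (brLayer [] (.tok a) []))
      (brLayer [] (.tok (homMul 𝒜 a b)) [])
  | tok_cross {p : ZMod 2} (a : 𝒜 p) : BrRel (X := [dot, dot]) (Y := [dot, dot])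
      (brComp (Y := [dot, dot]) (brLayer [] (.tok a) [dot]) (brLayer [] .cross []))
      (brComp (Y := [dot, dot]) (brLayer [] .cross []) (brLayer [dot] (.tok a) []))
  | tok_cap {p : ZMod 2} (a : 𝒜 p) : BrRel (X := [dot, dot]) (Y := [])
      (brComp (Y := [dot, dot]) (brLayer [] (.tok a) [dot]) (brLayer [] .cap []))
      (brComp (Y := [dot, dot]) (brLayer [dot] (.tok (inv.app a)) []) (brLayer [] .cap []))

/-- The additional relation, evaluating the bubbles with a token `a` to `d str_A(a)`. -/
inductive BrBubbleRel (d : k) : ∀ {X Y : List BrOb}, BrFree 𝒜 σ X Y → BrFree 𝒜 σ X Y → Prop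
  | bubble {p : ZMod 2} (a : 𝒜 p) : BrBubbleRel d (X := []) (Y := [])
      (brComp (Y := [dot, dot]) (brLayer [] .cup []) <|
        brComp (Y := [dot, dot]) (brLayer [dot] (.tok a) []) <|
        brLayer [] .cap [])
      ((d * superTrace 𝒜 (a : A)) • brId [])

theorem brLayer_mem {σ : ZMod 2} (U : List BrOb) {s t : List BrOb} {p : ZMod 2}
    (g : BrGen 𝒜 σ s t p) (V : List BrOb) :
    brLayer U g V ∈ homog k (BrSig 𝒜 σ) (U ++ (s ++ V)) (U ++ (t ++ V)) p :=
  layer_mem_homog (S := BrSig 𝒜 σ) U g V rfl rfl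

theorem BrRel.homogeneous {X Y : List BrOb} {f g : BrFree 𝒜 σ X Y} (h : BrRel inv σ f g) :
    ∃ p, f ∈ homog k (BrSig 𝒜 σ) X Y p ∧ g ∈ homog k (BrSig 𝒜 σ) X Y p := by
  have L := @brLayer_mem k A _ _ _ 𝒜 _ σ
  cases h with
  | cross_cross => exact ⟨0, comp_even (L _ _ _) (L _ _ _) rfl, id_mem_homog _⟩
  | braid => exact ⟨0, comp_even (L _ _ _) (comp_even (L _ _ _) (L _ _ _) rfl) rfl,
      comp_even (L _ _ _) (comp_even (L _ _ _) (L _ _ _) rfl) rfl⟩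
  | zigzag => exact ⟨0, comp_even (L _ _ _) (L _ _ _) (CharTwo.add_self_eq_zero σ),
      id_mem_homog _⟩
  | zigzag_sign => exact ⟨0, Submodule.smul_mem _ _
      (comp_even (L _ _ _) (L _ _ _) (CharTwo.add_self_eq_zero σ)), id_mem_homog _⟩
  | cross_cap => exact ⟨σ, comp_even (L _ _ _) (L _ _ _) (zero_add σ), L _ _ _⟩
  | cross_slide_cap => exact ⟨σ, comp_even (L _ _ _) (L _ _ _) (zero_add σ),
      comp_even (L _ _ _) (L _ _ _) (zero_add σ)⟩
  | tok_one => exact ⟨0, L _ _ _, id_mem_homog _⟩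
  | tok_add a b => exact ⟨_, L _ _ _, Submodule.add_mem _ (L _ _ _) (L _ _ _)⟩
  | tok_smul c a => exact ⟨_, L _ _ _, Submodule.smul_mem _ _ (L _ _ _)⟩
  | tok_mul a b => exact ⟨_, comp_even (L _ _ _) (L _ _ _) (add_comm _ _), L _ _ _⟩
  | tok_cross a => exact ⟨_, comp_even (L _ _ _) (L _ _ _) (add_zero _),
      comp_even (L _ _ _) (L _ _ _) (zero_add _)⟩
  | tok_cap a => exact ⟨_, comp_even (L _ _ _) (L _ _ _) rfl, comp_even (L _ _ _) (L _ _ _) rfl⟩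

theorem BrBubbleRel.homogeneous {d : k} {X Y : List BrOb} {f g : BrFree 𝒜 σ X Y}
    (h : BrBubbleRel σ d f g) :
    ∃ p, f ∈ homog k (BrSig 𝒜 σ) X Y p ∧ g ∈ homog k (BrSig 𝒜 σ) X Y p := by
  have L := @brLayer_mem k A _ _ _ 𝒜 _ σ
  cases h with
  | @bubble p a =>
    refine ⟨p, comp_even (L _ _ _) (comp_even (L _ _ _) (L _ _ _) rfl)
      (by rw [add_left_comm, CharTwo.add_self_eq_zero, add_zero]), ?_⟩
    rcases zmod_two_cases p with rfl | rfl
    · exact Submodule.smul_mem _ _ (id_mem_homog _)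
    · rw [superTrace_odd 𝒜 a.2, mul_zero, zero_smul]
      exact Submodule.zero_mem _

/-- The Brauer supercategory `B^σ(A, inv)`. -/
def Br : Presentation k (BrSig 𝒜 σ) where
  Rel := BrRel inv σ
  homogeneous := BrRel.homogeneous inv σ

/-- The specialized Brauer supercategory `B^σ(A, inv; d)`. -/
def Brd (d : k) : Presentation k (BrSig 𝒜 σ) where
  Rel f g := BrRel inv σ f g ∨ BrBubbleRel σ d f g
  homogeneous h := h.elim (BrRel.homogeneous inv σ) (BrBubbleRel.homogeneous σ)

/-- The quotient functor `B^σ(A, inv) ⥤ B^σ(A, inv; d)`. -/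
def Br.quotient (d : k) : (Br inv σ).Cat ⥤ (Brd inv σ d).Cat :=
  Presentation.quotientFunctor (Br inv σ) (Brd inv σ d) fun h => Or.inl h

/-- The generating object `•` of `B^σ(A, inv)`. -/
def Br.dot : (Br inv σ).Cat := ⟨[BrOb.dot]⟩

/-- The crossing of `B^σ(A, inv)`. -/
def Br.cross : Br.dot inv σ * Br.dot inv σ ⟶ Br.dot inv σ * Br.dot inv σ :=
  (Br inv σ).ofDiag (X := [.dot, .dot]) (Y := [.dot, .dot]) (brLayer [] .cross [])

/-- The cap of `B^σ(A, inv)`. -/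
def Br.cap : Br.dot inv σ * Br.dot inv σ ⟶ 1 :=
  (Br inv σ).ofDiag (X := [.dot, .dot]) (Y := []) (brLayer [] .cap [])

/-- The cup of `B^σ(A, inv)`. -/
def Br.cup : 1 ⟶ Br.dot inv σ * Br.dot inv σ :=
  (Br inv σ).ofDiag (X := []) (Y := [.dot, .dot]) (brLayer [] .cup [])

/-- The tokens of `B^σ(A, inv)`. -/
def Br.tok {p : ZMod 2} (a : 𝒜 p) : Br.dot inv σ ⟶ Br.dot inv σ :=
  (Br inv σ).ofDiag (X := [.dot]) (Y := [.dot]) (brLayer [] (.tok a) [])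

end brauer

/-! ### The images of the generators -/

section images

open OBOb

variable {k : Type w} {A : Type v} [Field k] [Ring A] [Algebra k A]
  {𝒜 : ZMod 2 → Submodule k A} [GradedAlgebra 𝒜] (inv : AntiInvolution 𝒜) (σ : ZMod 2)

/-- The summands `↑` and `Π^σ ↓`. -/
def summand (𝒜 : ZMod 2 → Submodule k A) [GradedAlgebra 𝒜] (σ : ZMod 2) :
    Fin 2 → PiEnv (OB 𝒜).Cat
  | 0 => ⟨0, ⟨[up]⟩⟩
  | 1 => ⟨σ, ⟨[down]⟩⟩

/-- The object `↑ ⊕ Π^σ ↓`. -/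
def dotImage (𝒜 : ZMod 2 → Submodule k A) [GradedAlgebra 𝒜] (σ : ZMod 2) :
    AddEnv (PiEnv (OB 𝒜).Cat) :=
  ⟨2, summand 𝒜 σ⟩

/-- The components of the image of the crossing. -/
def crossEntry (𝒜 : ZMod 2 → Submodule k A) [GradedAlgebra 𝒜] (σ : ZMod 2) :
    ∀ a b c d : Fin 2, summand 𝒜 σ a * summand 𝒜 σ b ⟶ summand 𝒜 σ c * summand 𝒜 σ d
  | 0, 0, 0, 0 => ⟨(OB 𝒜).ofDiag (X := [up, up]) (Y := [up, up]) (obLayer 𝒜 [] .cross [])⟩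
  | 0, 1, 1, 0 => ⟨(OB 𝒜).ofDiag (X := [up, down]) (Y := [down, up]) (rightCross 𝒜)⟩
  | 1, 0, 0, 1 => ⟨(OB 𝒜).ofDiag (X := [down, up]) (Y := [up, down]) (leftCross 𝒜)⟩
  | 1, 1, 1, 1 =>
    ⟨sgn k σ • (OB 𝒜).ofDiag (X := [down, down]) (Y := [down, down]) (downCross 𝒜)⟩
  | _, _, _, _ => 0

/-- The image of the crossing. -/
def crossImage (𝒜 : ZMod 2 → Submodule k A) [GradedAlgebra 𝒜] (σ : ZMod 2) :
    dotImage 𝒜 σ * dotImage 𝒜 σ ⟶ dotImage 𝒜 σ * dotImage 𝒜 σ :=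
  ⟨fun i j => crossEntry 𝒜 σ (Fin.divNat (m := 2) (n := 2) i) (Fin.modNat (m := 2) (n := 2) i)
    (Fin.divNat (m := 2) (n := 2) j) (Fin.modNat (m := 2) (n := 2) j)⟩

/-- The components of the image of the cap. -/
def capEntry (𝒜 : ZMod 2 → Submodule k A) [GradedAlgebra 𝒜] (σ : ZMod 2) :
    ∀ a b : Fin 2, summand 𝒜 σ a * summand 𝒜 σ b ⟶ 1
  | 1, 0 => ⟨(OB 𝒜).ofDiag (X := [down, up]) (Y := []) (obLayer 𝒜 [] .leftCap [])⟩
  | 0, 1 => ⟨(OB 𝒜).ofDiag (X := [up, down]) (Y := []) (obLayer 𝒜 [] .rightCap [])⟩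
  | _, _ => 0

/-- The image of the cap. -/
def capImage (𝒜 : ZMod 2 → Submodule k A) [GradedAlgebra 𝒜] (σ : ZMod 2) :
    dotImage 𝒜 σ * dotImage 𝒜 σ ⟶ 1 :=
  ⟨fun i _ => capEntry 𝒜 σ (Fin.divNat (m := 2) (n := 2) i) (Fin.modNat (m := 2) (n := 2) i)⟩

/-- The components of the image of the cup. -/
def cupEntry (𝒜 : ZMod 2 → Submodule k A) [GradedAlgebra 𝒜] (σ : ZMod 2) :
    ∀ a b : Fin 2, 1 ⟶ summand 𝒜 σ a * summand 𝒜 σ b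
  | 0, 1 => ⟨(OB 𝒜).ofDiag (X := []) (Y := [up, down]) (obLayer 𝒜 [] .leftCup [])⟩
  | 1, 0 => ⟨sgn k σ • (OB 𝒜).ofDiag (X := []) (Y := [down, up]) (obLayer 𝒜 [] .rightCup [])⟩
  | _, _ => 0

/-- The image of the cup. -/
def cupImage (𝒜 : ZMod 2 → Submodule k A) [GradedAlgebra 𝒜] (σ : ZMod 2) :
    1 ⟶ dotImage 𝒜 σ * dotImage 𝒜 σ :=
  ⟨fun _ j => cupEntry 𝒜 σ (Fin.divNat (m := 2) (n := 2) j) (Fin.modNat (m := 2) (n := 2) j)⟩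

/-- The components of the image of the token of a homogeneous element `a`. -/
def tokEntry {p : ZMod 2} (a : 𝒜 p) : ∀ i j : Fin 2, summand 𝒜 σ i ⟶ summand 𝒜 σ j
  | 0, 0 => ⟨(OB 𝒜).ofDiag (X := [up]) (Y := [up]) (obLayer 𝒜 [] (.tok a) [])⟩
  | 1, 1 => ⟨sgn k (σ * p) • (OB 𝒜).ofDiag (X := [down]) (Y := [down]) (downTok 𝒜 (inv.app a))⟩
  | _, _ => 0

/-- The image of the token of a homogeneous element `a`. -/
def tokImage {p : ZMod 2} (a : 𝒜 p) : dotImage 𝒜 σ ⟶ dotImage 𝒜 σ := ⟨tokEntry inv σ a⟩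

/-- `D` sends `•` to `↑ ⊕ Π^σ ↓` and takes the prescribed values on the generating morphisms. (The
morphisms `eqToHom` are the identities expressing `D(• ⊗ •) = D(•) ⊗ D(•)`, `D(1) = 1` and
`D(•) = ↑ ⊕ Π^σ ↓`.) -/
structure IsBulb (D : StrictMonoidalSuperfunctor k (Br inv σ).Cat (AddEnv (PiEnv (OB 𝒜).Cat))) :
    Prop where
  obj_dot : D.obj (Br.dot inv σ) = dotImage 𝒜 σ
  map_cross : D.map (Br.cross inv σ) = eqToHom (D.obj_mul_of_eq obj_dot obj_dot) ≫
    crossImage 𝒜 σ ≫ eqToHom (D.obj_mul_of_eq obj_dot obj_dot).symm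
  map_cap : D.map (Br.cap inv σ) = eqToHom (D.obj_mul_of_eq obj_dot obj_dot) ≫
    capImage 𝒜 σ ≫ eqToHom D.obj_one.symm
  map_cup : D.map (Br.cup inv σ) = eqToHom D.obj_one ≫
    cupImage 𝒜 σ ≫ eqToHom (D.obj_mul_of_eq obj_dot obj_dot).symm
  map_tok {p : ZMod 2} (a : 𝒜 p) : D.map (Br.tok inv σ a) = eqToHom obj_dot ≫
    tokImage inv σ a ≫ eqToHom obj_dot.symm

end images

end SuperBrauer

end

open SuperBrauer

open CategoryTheory

noncomputable section

set_option linter.unusedSectionVars false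
set_option linter.checkUnivs false

universe u v w u' v'

namespace SuperBrauer

open SuperBrauer.Supercategory (homParity)
open SuperBrauer.StrictMonoidalSupercategory (tensorHom)

/-! ### Strict tensor products up to heterogeneous equality -/

section heq

variable (k : Type*) [Field k] {E : Type*} [Category E] [Preadditive E] [Linear k E]
  [Monoid E] [StrictMonoidalSupercategory k E]

/-! The source of `D` is given by generators and relations, and the super interchange law holds
automatically in any strict monoidal supercategory. A superfunctor out of the source is therefore a
choice of images of the generators that satisfies the listed relations. Existence is
`GenData.Respects.lift`, uniqueness is `Presentation.superfunctor_ext`, and the content of (1) is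
`Bulb.genData_respects`.

The relations are checked on components. A morphism out of a tensor power of `↑ ⊕ Π^σ ↓` is
determined by its composites with the inclusions of words in `↑`, `↓` (`Bulb.hom_ext_one`,
`Bulb.hom_ext_two`, `Bulb.hom_ext_three`). On such words the images of the generators act by
crossings, caps, cups and tokens of the oriented category, up to explicit signs
(`Bulb.cons_cons_crossE`, `Bulb.cons_cons_capE`, `Bulb.comp_cupE`, `Bulb.cons_tokE`); moving a
morphism past a letter on its left costs a further Koszul sign (`Bulb.cons_shiftMap_comp`). Each
relation thus splits into an identity of oriented diagrams, valid for every orientation of the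
strands, and an identity between exponents in `ZMod 2`.

The identities of oriented diagrams are proved for an abstract `DualCrossing`. Since `↓` is a left
dual of `↑` and the crossings starting with `↓` are rotations, passing to mates carries the
involution, the braid relation and the sliding of tokens from `↑` to all orientations. The curl
relations identify the right cap and cup with the left ones composed with a crossing (`OB.capR_eq`,
`OB.cupR_eq`). Hence `↓` is also a right dual, and left and right rotation produce the same downward
crossing. Rotating a token reverses products up to a Koszul sign, which is exactly the sign rule of
the anti-involution (`OB.td_mul`, `Bulb.tok_mul`).

For (2), let `a` have parity `p`. The image of the bubble with token `a` is `(-1)^(p σ)` times the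
oriented bubble of `inv a` plus `(-1)^σ` times that of `a` (`Bulb.cupE_tokE_capE`). After
specialization it has to equal `2 d str(a)`. For odd `a` all supertraces vanish, and for `σ = 1` one
has `d = 0`. What remains is `str(inv a) = str(a)` for even `a` (`superTrace_inv`): conjugation by
`inv` turns right multiplication by `inv a` into left multiplication by `a`, and left and right
multiplication by `a` are adjoint for the Frobenius form, so the traces agree. -/

theorem tensor_heq {X X' Y Y' Z Z' W W' : E} {f : X ⟶ X'} {g : Y ⟶ Y'} {f' : Z ⟶ Z'} {g' : W ⟶ W'}
    (hX : X = Z) (hX' : X' = Z') (hY : Y = W) (hY' : Y' = W') (hf : HEq f f') (hg : HEq g g') :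
    HEq (tensorHom (k := k) f g) (tensorHom (k := k) f' g') := by
  subst hX hX' hY hY'
  cases hf; cases hg; rfl

theorem comp_heq_comp {X Y Z X' Y' Z' : E} {f : X ⟶ Y} {g : Y ⟶ Z} {f' : X' ⟶ Y'} {g' : Y' ⟶ Z'}
    (hX : X = X') (hY : Y = Y') (hZ : Z = Z') (hf : HEq f f') (hg : HEq g g') :
    HEq (f ≫ g) (f' ≫ g') := by
  subst hX hY hZ
  cases hf; cases hg; rfl

theorem id_heq_id {X Y : E} (h : X = Y) : HEq (𝟙 X) (𝟙 Y) := by subst h; rfl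

/-- Together with `eq_conj_of_heq` this passes between transport along equalities of objects, as
used in the definitions, and heterogeneous equality, in which rebracketings of a strict tensor
product can be chained freely. -/
theorem conj_heq {X Y X' Y' : E} (hX : X' = X) (hY : Y = Y') (f : X ⟶ Y) :
    HEq (eqToHom hX ≫ f ≫ eqToHom hY) f := by
  subst hX hY; simp

theorem eq_conj_of_heq {X Y X' Y' : E} {f : X' ⟶ Y'} {g : X ⟶ Y} (hX : X' = X) (hY : Y = Y')
    (h : HEq f g) : f = eqToHom hX ≫ g ≫ eqToHom hY := by
  subst hX hY; simpa using h

theorem tensor_assoc_heq {X X' Y Y' Z Z' : E} (f : X ⟶ X') (g : Y ⟶ Y') (h : Z ⟶ Z') :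
    HEq (tensorHom (k := k) (tensorHom (k := k) f g) h)
      (tensorHom (k := k) f (tensorHom (k := k) g h)) := by
  rw [StrictMonoidalSupercategory.tensor_assoc]
  exact conj_heq _ _ _

theorem one_tensor_heq {X X' : E} (f : X ⟶ X') :
    HEq (tensorHom (k := k) (𝟙 (1 : E)) f) f := by
  rw [StrictMonoidalSupercategory.one_tensor]
  exact conj_heq _ _ _

theorem tensor_one_heq {X X' : E} (f : X ⟶ X') :
    HEq (tensorHom (k := k) f (𝟙 (1 : E))) f := by
  rw [StrictMonoidalSupercategory.tensor_one]
  exact conj_heq _ _ _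

/-- One of the two morphisms that pass each other is even, so no sign arises and the other one need
not be homogeneous: bilinearity reduces to the homogeneous case. -/
theorem interchange_even_left {X X' X'' Y Y' Y'' : E} (f : X ⟶ X') (f' : X' ⟶ X'')
    (g' : Y ⟶ Y') (g : Y' ⟶ Y'') (hf : f ∈ homParity (k := k) X X' 0) :
    tensorHom (k := k) f g' ≫ tensorHom (k := k) f' g = tensorHom (k := k) (f ≫ f') (g' ≫ g) := by
  refine homogeneous_induction k (P := fun g => tensorHom (k := k) f g' ≫ tensorHom (k := k) f' g =
    tensorHom (k := k) (f ≫ f') (g' ≫ g)) g ?_ ?_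
  · intro p g hg
    rw [StrictMonoidalSupercategory.interchange _ _ _ _ hf hg]; simp
  · intro g₁ g₂ h₁ h₂
    simp only [StrictMonoidalSupercategory.tensor_add, Preadditive.comp_add, h₁, h₂]

theorem interchange_even_right {X X' X'' Y Y' Y'' : E} (f : X ⟶ X') (f' : X' ⟶ X'')
    (g' : Y ⟶ Y') (g : Y' ⟶ Y'') (hg : g ∈ homParity (k := k) Y' Y'' 0) :
    tensorHom (k := k) f g' ≫ tensorHom (k := k) f' g = tensorHom (k := k) (f ≫ f') (g' ≫ g) := by
  refine homogeneous_induction k (P := fun f => tensorHom (k := k) f g' ≫ tensorHom (k := k) f' g =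
    tensorHom (k := k) (f ≫ f') (g' ≫ g)) f ?_ ?_
  · intro p f hf
    rw [StrictMonoidalSupercategory.interchange _ _ _ _ hf hg]; simp
  · intro g₁ g₂ h₁ h₂
    simp only [StrictMonoidalSupercategory.add_tensor, Preadditive.add_comp, h₁, h₂]

/-- `1_U ⊗ f` as a linear map. -/
def tensorLeftLinear (U : E) (X Y : E) : (X ⟶ Y) →ₗ[k] (U * X ⟶ U * Y) where
  toFun f := tensorHom (k := k) (𝟙 U) f
  map_add' := StrictMonoidalSupercategory.tensor_add _
  map_smul' c := StrictMonoidalSupercategory.tensor_smul c _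

/-- `f ⊗ 1_V` as a linear map. -/
def tensorRightLinear (V : E) (X Y : E) : (X ⟶ Y) →ₗ[k] (X * V ⟶ Y * V) where
  toFun f := tensorHom (k := k) f (𝟙 V)
  map_add' f f' := StrictMonoidalSupercategory.add_tensor f f' _
  map_smul' c f := StrictMonoidalSupercategory.smul_tensor c f _

/-- `f ↦ eqToHom ≫ f ≫ eqToHom` as a linear map. -/
def conjLinear {X Y X' Y' : E} (hX : X' = X) (hY : Y = Y') : (X ⟶ Y) →ₗ[k] (X' ⟶ Y') where
  toFun f := eqToHom hX ≫ f ≫ eqToHom hY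
  map_add' f f' := by subst hX hY; simp
  map_smul' c f := by subst hX hY; simp

end heq

/-! ### The universal property of presented strict monoidal supercategories -/

/-- The image of a word in the generating objects. -/
def objWord {O E : Type*} [Monoid E] (F : O → E) : List O → E
  | [] => 1
  | a :: l => F a * objWord F l

theorem objWord_append {O E : Type*} [Monoid E] (F : O → E) (X Y : List O) :
    objWord F (X ++ Y) = objWord F X * objWord F Y := by
  induction X with
  | nil => exact (one_mul _).symm
  | cons a l ih => exact (congrArg (F a * ·) ih).trans (mul_assoc _ _ _).symm

/-- Images of the generators of a signature in a strict monoidal supercategory. -/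
structure GenData (k : Type w) [Field k] (S : Signature.{u, v}) (E : Type*) [Category E]
    [Preadditive E] [Linear k E] [Monoid E] [StrictMonoidalSupercategory k E] where
  ob : S.Ob → E
  gen {s t : List S.Ob} {p : ZMod 2} (g : S.Gen s t p) : objWord ob s ⟶ objWord ob t
  gen_mem {s t : List S.Ob} {p : ZMod 2} (g : S.Gen s t p) :
    gen g ∈ homParity (k := k) (objWord ob s) (objWord ob t) p

namespace GenData

variable {k : Type w} [Field k] {S : Signature.{u, v}} {E : Type*} [Category E]
  [Preadditive E] [Linear k E] [Monoid E] [StrictMonoidalSupercategory k E] (G : GenData k S E)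

/-- The image of a word. -/
abbrev word (X : List S.Ob) : E := objWord G.ob X

/-- The image of a layer, up to transport. -/
def layerCore {X Y : List S.Ob} (l : Layer S X Y) :
    G.word l.left * (G.word l.src * G.word l.right) ⟶
      G.word l.left * (G.word l.tgt * G.word l.right) :=
  tensorHom (k := k) (𝟙 (G.word l.left)) (tensorHom (k := k) (G.gen l.gen) (𝟙 (G.word l.right)))

theorem word_sandwich {X U s V : List S.Ob} (h : X = U ++ (s ++ V)) :
    G.word X = G.word U * (G.word s * G.word V) := by
  rw [h, word, objWord_append, objWord_append]

/-- The image of a layer. -/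
def layerMap {X Y : List S.Ob} (l : Layer S X Y) : G.word X ⟶ G.word Y :=
  eqToHom (G.word_sandwich l.hX) ≫ G.layerCore l ≫ eqToHom (G.word_sandwich l.hY).symm

theorem layerMap_heq {X Y : List S.Ob} (l : Layer S X Y) : HEq (G.layerMap l) (G.layerCore l) :=
  conj_heq _ _ _

theorem layerMap_mem {X Y : List S.Ob} (l : Layer S X Y) :
    G.layerMap l ∈ homParity (k := k) (G.word X) (G.word Y) l.par := by
  refine conj_mem k _ _ ?_
  have := StrictMonoidalSupercategory.tensor_mem (k := k)
    (Supercategory.id_mem (k := k) (G.word l.left)) (StrictMonoidalSupercategory.tensor_mem (k := k)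
      (G.gen_mem l.gen) (Supercategory.id_mem (k := k) (G.word l.right)))
  rw [zero_add, add_zero] at this
  exact this

/-- Both sides tensor the image of one generator with the same identities and differ only in
bracketing, so strict associativity identifies them up to transport. -/
theorem layerMap_whiskerL (U : List S.Ob) {X Y : List S.Ob} (l : Layer S X Y) :
    HEq (G.layerMap (l.whiskerL U)) (tensorHom (k := k) (𝟙 (G.word U)) (G.layerMap l)) := by
  refine (G.layerMap_heq _).trans ?_
  have e := G.word_sandwich l.hX
  have e' := G.word_sandwich l.hY
  refine HEq.trans (tensor_heq k (objWord_append _ _ _) (objWord_append _ _ _) rfl rfl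
    (g' := tensorHom (k := k) (G.gen l.gen) (𝟙 (G.word l.right)))
    (id_heq_id (objWord_append G.ob U l.left)) HEq.rfl) ?_
  rw [← StrictMonoidalSupercategory.tensor_id (k := k)]
  refine (tensor_assoc_heq k _ _ _).trans ?_
  exact tensor_heq k rfl rfl e.symm e'.symm HEq.rfl (G.layerMap_heq l).symm

theorem layerMap_whiskerR (V : List S.Ob) {X Y : List S.Ob} (l : Layer S X Y) :
    HEq (G.layerMap (l.whiskerR V)) (tensorHom (k := k) (G.layerMap l) (𝟙 (G.word V))) := by
  refine (G.layerMap_heq _).trans ?_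
  have e := G.word_sandwich l.hX
  have e' := G.word_sandwich l.hY
  have h := objWord_append G.ob l.right V
  have h1 : HEq (tensorHom (k := k) (G.gen l.gen) (𝟙 (G.word (l.right ++ V))))
      (tensorHom (k := k) (tensorHom (k := k) (G.gen l.gen) (𝟙 (G.word l.right)))
        (𝟙 (G.word V))) := by
    refine (tensor_heq k rfl rfl h h HEq.rfl (id_heq_id h)).trans ?_
    rw [← StrictMonoidalSupercategory.tensor_id (k := k)]
    exact (tensor_assoc_heq k _ _ _).symm
  refine (tensor_heq k rfl rfl ?_ ?_ HEq.rfl h1).trans ?_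
  · exact (congrArg (G.word l.src * ·) h).trans (mul_assoc _ _ _).symm
  · exact (congrArg (G.word l.tgt * ·) h).trans (mul_assoc _ _ _).symm
  refine (tensor_assoc_heq k _ _ _).symm.trans ?_
  exact tensor_heq k e.symm e'.symm rfl rfl (G.layerMap_heq l).symm HEq.rfl

/-- The image of a diagram. -/
def diagMap {X Y : List S.Ob} : Diagram S X Y → (G.word X ⟶ G.word Y)
  | .nil X => 𝟙 (G.word X)
  | .cons l d => G.layerMap l ≫ diagMap d

theorem diagMap_comp {X Y Z : List S.Ob} (d : Diagram S X Y) (e : Diagram S Y Z) :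
    G.diagMap (d.comp e) = G.diagMap d ≫ G.diagMap e := by
  induction d with
  | nil => exact (Category.id_comp _).symm
  | cons l d ih => exact (congrArg (G.layerMap l ≫ ·) (ih e)).trans (Category.assoc _ _ _).symm

theorem diagMap_mem {X Y : List S.Ob} (d : Diagram S X Y) :
    G.diagMap d ∈ homParity (k := k) (G.word X) (G.word Y) d.parity := by
  induction d with
  | nil => exact Supercategory.id_mem _
  | cons l d ih => exact Supercategory.comp_mem (G.layerMap_mem l) ih

/-- Induction on the number of layers; stacking commutes with `1_U ⊗ -` because the identity is
even. -/
theorem diagMap_whiskerL (U : List S.Ob) {X Y : List S.Ob} (d : Diagram S X Y) :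
    HEq (G.diagMap (d.whiskerL U)) (tensorHom (k := k) (𝟙 (G.word U)) (G.diagMap d)) := by
  induction d with
  | nil X =>
    refine (id_heq_id (objWord_append _ _ _)).trans ?_
    rw [← StrictMonoidalSupercategory.tensor_id (k := k)]
    rfl
  | cons l d ih =>
    refine (comp_heq_comp (objWord_append _ _ _) (objWord_append _ _ _) (objWord_append _ _ _)
      (G.layerMap_whiskerL U l) ih).trans ?_
    rw [interchange_even_left k _ _ _ _ (Supercategory.id_mem _), Category.id_comp]
    rfl

theorem diagMap_whiskerR (V : List S.Ob) {X Y : List S.Ob} (d : Diagram S X Y) :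
    HEq (G.diagMap (d.whiskerR V)) (tensorHom (k := k) (G.diagMap d) (𝟙 (G.word V))) := by
  induction d with
  | nil X =>
    refine (id_heq_id (objWord_append _ _ _)).trans ?_
    rw [← StrictMonoidalSupercategory.tensor_id (k := k)]
    rfl
  | cons l d ih =>
    refine (comp_heq_comp (objWord_append _ _ _) (objWord_append _ _ _) (objWord_append _ _ _)
      (G.layerMap_whiskerR V l) ih).trans ?_
    rw [interchange_even_right k _ _ _ _ (Supercategory.id_mem _), Category.id_comp]
    rfl

/-- The image of a linear combination of diagrams. -/
def map {X Y : List S.Ob} : FreeHom k S X Y →ₗ[k] (G.word X ⟶ G.word Y) :=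
  Finsupp.linearCombination k G.diagMap

@[simp] theorem map_single {X Y : List S.Ob} (d : Diagram S X Y) (c : k) :
    G.map (Finsupp.single d c : FreeHom k S X Y) = c • G.diagMap d :=
  Finsupp.linearCombination_single k c d

theorem map_id (X : List S.Ob) : G.map (FreeHom.id k X) = 𝟙 (G.word X) :=
  (G.map_single _ _).trans (one_smul _ _)

theorem map_comp {X Y Z : List S.Ob} (f : FreeHom k S X Y) (g : FreeHom k S Y Z) :
    G.map (FreeHom.comp f g) = G.map f ≫ G.map g := by
  induction f using Finsupp.induction_linear with
  | zero => simp [FreeHom.comp]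
  | add f f' hf hf' => simp only [FreeHom.add_comp, map_add, hf, hf', Preadditive.add_comp]
  | single d a =>
    induction g using Finsupp.induction_linear with
    | zero => simp [FreeHom.comp]
    | add g g' hg hg' => simp only [FreeHom.comp_add, map_add, hg, hg', Preadditive.comp_add]
    | single e b =>
      simp only [FreeHom.single_comp_single, map_single, diagMap_comp, Linear.smul_comp,
        Linear.comp_smul, smul_smul, mul_comm]

theorem map_mem {X Y : List S.Ob} {p : ZMod 2} {f : FreeHom k S X Y}
    (hf : f ∈ FreeHom.homog k S X Y p) : G.map f ∈ homParity (k := k) (G.word X) (G.word Y) p := by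
  have : FreeHom.homog k S X Y p ≤ (homParity (k := k) (G.word X) (G.word Y) p).comap G.map := by
    refine FreeHom.homog_le fun d hd => ?_
    rw [Submodule.mem_comap, map_single, one_smul, ← hd]
    exact G.diagMap_mem d
  exact this hf

theorem map_whiskerL (U : List S.Ob) {X Y : List S.Ob} (f : FreeHom k S X Y) :
    G.map (FreeHom.whiskerL U f) = eqToHom (objWord_append G.ob U X) ≫
      tensorHom (k := k) (𝟙 (G.word U)) (G.map f) ≫ eqToHom (objWord_append G.ob U Y).symm := by
  have : G.map ∘ₗ FreeHom.whiskerL U = conjLinear k (objWord_append G.ob U X)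
      (objWord_append G.ob U Y).symm ∘ₗ tensorLeftLinear k (G.word U) _ _ ∘ₗ G.map := by
    refine Finsupp.lhom_ext' fun d => LinearMap.ext_ring ?_
    simp only [LinearMap.comp_apply, Finsupp.lsingle_apply, FreeHom.whiskerL_single, map_single,
      one_smul]
    exact eq_conj_of_heq _ _ (G.diagMap_whiskerL U d)
  exact LinearMap.congr_fun this f

theorem map_whiskerR (V : List S.Ob) {X Y : List S.Ob} (f : FreeHom k S X Y) :
    G.map (FreeHom.whiskerR V f) = eqToHom (objWord_append G.ob X V) ≫
      tensorHom (k := k) (G.map f) (𝟙 (G.word V)) ≫ eqToHom (objWord_append G.ob Y V).symm := by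
  have : G.map ∘ₗ FreeHom.whiskerR V = conjLinear k (objWord_append G.ob X V)
      (objWord_append G.ob Y V).symm ∘ₗ tensorRightLinear k (G.word V) _ _ ∘ₗ G.map := by
    refine Finsupp.lhom_ext' fun d => LinearMap.ext_ring ?_
    simp only [LinearMap.comp_apply, Finsupp.lsingle_apply, FreeHom.whiskerR_single, map_single,
      one_smul]
    exact eq_conj_of_heq _ _ (G.diagMap_whiskerR V d)
  exact LinearMap.congr_fun this f

variable (P : Presentation k S)

/-- The images of the generators satisfy the relations. -/
def Respects : Prop :=
  ∀ ⦃X Y : List S.Ob⦄ ⦃f g : FreeHom k S X Y⦄, P.Rel f g → G.map f = G.map g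

variable {G P}

/-- The morphisms killed by `G.map` are closed under composition and whiskering, and the interchange
relation holds in the target, so only the given relations have to be checked. -/
theorem Respects.map_eq_zero (h : G.Respects P) {X Y : List S.Ob} {f : FreeHom k S X Y}
    (hf : P.InIdeal f) : G.map f = 0 := by
  induction hf with
  | rel h' => rw [map_sub, h h', sub_self]
  | @interchange X X' Y Y' p q f g hf hg =>
    rw [map_sub, map_smul, map_comp, map_comp, map_whiskerL, map_whiskerL, map_whiskerR,
      map_whiskerR]
    simp only [Category.assoc, eqToHom_trans_assoc, eqToHom_refl, Category.id_comp]
    -- Both composites are now multiples of the tensor product of the two images: the first carries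
    -- the sign of `p * q`, the second no sign since only identities pass each other.
    rw [← Category.assoc (tensorHom (k := k) _ _), ← Category.assoc (tensorHom (k := k) _ _),
      StrictMonoidalSupercategory.interchange _ _ _ _ (G.map_mem hf) (G.map_mem hg),
      StrictMonoidalSupercategory.interchange _ _ _ _ (Supercategory.id_mem (k := k) _)
        (Supercategory.id_mem (k := k) _)]
    simp
  | zero => exact _root_.map_zero _
  | add _ _ hf hg => rw [map_add, hf, hg, add_zero]
  | smul c _ hf => rw [map_smul, hf, smul_zero]
  | comp_left f _ hg => rw [map_comp, hg, Limits.comp_zero]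
  | comp_right _ g hf => rw [map_comp, hf, Limits.zero_comp]
  | whiskerL U _ hf => rw [map_whiskerL, hf, SuperBrauer.tensor_zero]; simp
  | whiskerR V _ hf => rw [map_whiskerR, hf, SuperBrauer.zero_tensor]; simp

/-- The strict monoidal superfunctor determined by images of the generators which satisfy the
relations. -/
def Respects.lift (h : G.Respects P) : StrictMonoidalSuperfunctor k P.Cat E where
  obj X := G.word X.word
  map {X Y} f := (P.ideal X.word Y.word).liftQ G.map (fun _ hf => h.map_eq_zero hf) f
  map_id X := G.map_id X.word
  map_comp {X Y Z} f g := by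
    obtain ⟨f, rfl⟩ := P.ofDiag_surjective f
    obtain ⟨g, rfl⟩ := P.ofDiag_surjective g
    exact G.map_comp f g
  map_add f g := _root_.map_add _ f g
  map_smul c f := _root_.map_smul _ c f
  map_mem {X Y p f} hf := by
    obtain ⟨f, hf', rfl⟩ := P.exists_ofDiag_of_mem hf
    exact G.map_mem hf'
  obj_one := rfl
  obj_mul X Y := objWord_append _ _ _
  map_tensor {X X' Y Y'} f g := by
    obtain ⟨f, rfl⟩ := P.ofDiag_surjective f
    obtain ⟨g, rfl⟩ := P.ofDiag_surjective g
    refine (G.map_comp (FreeHom.whiskerL X.word g) (FreeHom.whiskerR Y'.word f)).trans ?_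
    rw [map_whiskerL, map_whiskerR]
    simp only [Category.assoc, eqToHom_trans_assoc, eqToHom_refl, Category.id_comp]
    -- The tensor product in a presented category puts the left factor above the right one, so only
    -- identities are interchanged and no sign appears.
    rw [← Category.assoc (tensorHom (k := k) _ _),
      interchange_even_left k _ _ _ _ (Supercategory.id_mem (k := k) _), Category.id_comp,
      Category.comp_id]
    rfl

end GenData

/-! ### Elementary properties and composition of strict monoidal superfunctors. -/

namespace StrictMonoidalSuperfunctor

variable {k : Type w} [Field k] {C D E : Type*} [Category C] [Preadditive C] [Linear k C] [Monoid C]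
  [StrictMonoidalSupercategory k C] [Category D] [Preadditive D] [Linear k D] [Monoid D]
  [StrictMonoidalSupercategory k D] [Category E] [Preadditive E] [Linear k E] [Monoid E]
  [StrictMonoidalSupercategory k E]

/-- The action on morphisms as a linear map. -/
def mapLinear (F : StrictMonoidalSuperfunctor k C D) (X Y : C) :
    (X ⟶ Y) →ₗ[k] (F.obj X ⟶ F.obj Y) where
  toFun f := F.map f
  map_add' := F.map_add
  map_smul' := F.map_smul

theorem map_zero (F : StrictMonoidalSuperfunctor k C D) (X Y : C) : F.map (0 : X ⟶ Y) = 0 :=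
  _root_.map_zero (F.mapLinear X Y)

theorem toFunctor_injective {F F' : StrictMonoidalSuperfunctor k C D}
    (h : F.toFunctor = F'.toFunctor) : F = F' := by
  cases F; cases F'
  cases h
  rfl

theorem map_tensor_heq (F : StrictMonoidalSuperfunctor k C D) {X X' Y Y' : C} (f : X ⟶ X')
    (g : Y ⟶ Y') :
    HEq (F.map (tensorHom (k := k) f g)) (tensorHom (k := k) (F.map f) (F.map g)) := by
  rw [F.map_tensor]
  exact conj_heq _ _ _

/-- The tensor product of the `Π`-envelope is written with `twist`; this is what makes it functorial
in the underlying supercategory. -/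
theorem map_twist (F : StrictMonoidalSuperfunctor k C D) (n : ZMod 2) {X Y : C} (f : X ⟶ Y) :
    F.map (twist k n f) = twist k n (F.map f) := by
  refine homogeneous_induction k (P := fun f => F.map (twist k n f) = twist k n (F.map f)) f ?_ ?_
  · intro p f hf
    rw [twist_of_mem k n p hf, twist_of_mem k n p (F.map_mem hf), F.map_smul]
  · intro f g hf hg
    rw [_root_.map_add, F.map_add, F.map_add, _root_.map_add, hf, hg]

/-- Composition of strict monoidal superfunctors. -/
def comp (F : StrictMonoidalSuperfunctor k C D) (G : StrictMonoidalSuperfunctor k D E) :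
    StrictMonoidalSuperfunctor k C E where
  toFunctor := F.toFunctor ⋙ G.toFunctor
  map_add f g := by simp only [Functor.comp_map, F.map_add, G.map_add]
  map_smul c f := by simp only [Functor.comp_map, F.map_smul, G.map_smul]
  map_mem hf := G.map_mem (F.map_mem hf)
  obj_one := (congrArg G.obj F.obj_one).trans G.obj_one
  obj_mul X Y := (congrArg G.obj (F.obj_mul X Y)).trans (G.obj_mul _ _)
  map_tensor {X X' Y Y'} f g := by
    simp only [Functor.comp_map, Functor.comp_obj, F.map_tensor, G.map_tensor, G.map_comp,
      eqToHom_map, Category.assoc, eqToHom_trans, eqToHom_trans_assoc]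

instance (F : StrictMonoidalSuperfunctor k C D) : F.toFunctor.Additive where
  map_add := F.map_add _ _

end StrictMonoidalSuperfunctor

/-! ### Superfunctors out of a presented supercategory: uniqueness and descent to quotients. -/

namespace Presentation

variable {k : Type w} [Field k] {S : Signature.{u, v}} (P : Presentation k S) {E : Type*}
  [Category E] [Preadditive E] [Linear k E] [Monoid E] [StrictMonoidalSupercategory k E]

theorem id_tensor_ofDiag (U : List S.Ob) {X Y : List S.Ob} (f : FreeHom k S X Y) :
    tensorHom (k := k) (𝟙 (⟨U⟩ : P.Cat)) (P.ofDiag f) = P.ofDiag (FreeHom.whiskerL U f) := by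
  refine (P.tensor_ofDiag (FreeHom.id k U) f).trans ?_
  rw [FreeHom.whiskerR_id, FreeHom.comp_id]

theorem ofDiag_tensor_id (V : List S.Ob) {X Y : List S.Ob} (f : FreeHom k S X Y) :
    tensorHom (k := k) (P.ofDiag f) (𝟙 (⟨V⟩ : P.Cat)) = P.ofDiag (FreeHom.whiskerR V f) := by
  refine (P.tensor_ofDiag f (FreeHom.id k V)).trans ?_
  rw [FreeHom.whiskerL_id, FreeHom.id_comp]

/-- The morphism given by a generator. -/
def genHom {s t : List S.Ob} {p : ZMod 2} (g : S.Gen s t p) : (⟨s⟩ : P.Cat) ⟶ ⟨t⟩ :=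
  P.ofDiag (FreeHom.layer k [] g [] (List.append_nil s).symm (List.append_nil t).symm)

/-- Layers become tensor products inside the presented category itself, so any strict monoidal
superfunctor is forced on them by its values on `genHom`. -/
theorem ofDiag_layer {U V s t : List S.Ob} {p : ZMod 2} (g : S.Gen s t p) :
    P.ofDiag (FreeHom.layer k U g V rfl rfl) =
      tensorHom (k := k) (𝟙 (⟨U⟩ : P.Cat)) (tensorHom (k := k) (P.genHom g) (𝟙 (⟨V⟩ : P.Cat))) := by
  rw [genHom, ofDiag_tensor_id]
  refine Eq.trans ?_ (P.id_tensor_ofDiag U _).symm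
  congr 1
  rw [FreeHom.layer, FreeHom.layer, FreeHom.whiskerR_single]
  refine Eq.trans ?_ (FreeHom.whiskerL_single _ _ _).symm
  congr 1
  simp only [Diagram.whiskerL, Diagram.whiskerR, Layer.whiskerL, Layer.whiskerR]
  congr 2
  exact (List.append_nil U).symm

section ext

variable {P} {F F' : StrictMonoidalSuperfunctor k P.Cat E}

theorem obj_eq_of_letters (hob : ∀ a, F.obj ⟨[a]⟩ = F'.obj ⟨[a]⟩) (X : P.Cat) :
    F.obj X = F'.obj X := by
  obtain ⟨X⟩ := X
  induction X with
  | nil => exact F.obj_one.trans F'.obj_one.symm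
  | cons a l ih =>
    exact (F.obj_mul ⟨[a]⟩ ⟨l⟩).trans
      ((congrArg₂ (· * ·) (hob a) ih).trans (F'.obj_mul ⟨[a]⟩ ⟨l⟩).symm)

/-- Two superfunctors that agree on letters agree on words only up to a proof of equality, hence the
heterogeneous statement. The induction splits off the bottom layer of the diagram. -/
theorem map_heq_of_generators (hob : ∀ a, F.obj ⟨[a]⟩ = F'.obj ⟨[a]⟩)
    (hgen : ∀ {s t : List S.Ob} {p : ZMod 2} (g : S.Gen s t p),
      HEq (F.map (P.genHom g)) (F'.map (P.genHom g))) {X Y : List S.Ob} (d : Diagram S X Y) :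
    HEq (F.map (P.ofDiag (Finsupp.single d 1))) (F'.map (P.ofDiag (Finsupp.single d 1))) := by
  have ho := obj_eq_of_letters (F := F) (F' := F') hob
  have hid : ∀ X : P.Cat, HEq (F.map (𝟙 X)) (F'.map (𝟙 X)) := fun X => by
    rw [F.map_id, F'.map_id]
    exact id_heq_id (ho X)
  induction d with
  | nil X => exact hid ⟨X⟩
  | @cons X Y Z l d ih =>
    have e : P.ofDiag (Finsupp.single (Diagram.cons l d) 1) =
        P.ofDiag (Finsupp.single (Diagram.cons l (.nil Y)) 1) ≫ P.ofDiag (Finsupp.single d 1) := by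
      rw [← ofDiag_comp, FreeHom.single_comp_single, one_mul]
      rfl
    rw [e, F.map_comp, F'.map_comp]
    refine comp_heq_comp (ho _) (ho _) (ho _) ?_ ih
    obtain ⟨U, V, s, t, p, g, rfl, rfl⟩ := l
    have e' := P.ofDiag_layer (U := U) (V := V) g
    rw [FreeHom.layer] at e'
    rw [e']
    refine (F.map_tensor_heq _ _).trans (HEq.trans ?_ (F'.map_tensor_heq _ _).symm)
    refine tensor_heq k (ho _) (ho _) (ho _) (ho _) (hid _) ?_
    refine (F.map_tensor_heq _ _).trans (HEq.trans ?_ (F'.map_tensor_heq _ _).symm)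
    exact tensor_heq k (ho _) (ho _) (ho _) (ho _) (hgen g) (hid _)

/-- A strict monoidal superfunctor is determined by its values on generators. -/
theorem superfunctor_ext (hob : ∀ a, F.obj ⟨[a]⟩ = F'.obj ⟨[a]⟩)
    (hgen : ∀ {s t : List S.Ob} {p : ZMod 2} (g : S.Gen s t p),
      HEq (F.map (P.genHom g)) (F'.map (P.genHom g))) : F = F' := by
  have ho := obj_eq_of_letters (F := F) (F' := F') hob
  refine StrictMonoidalSuperfunctor.toFunctor_injective (CategoryTheory.Functor.ext ho ?_)
  intro X Y f
  obtain ⟨f, rfl⟩ := P.ofDiag_surjective f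
  have : F.mapLinear X Y ∘ₗ P.mkHom = conjLinear k (ho X) (ho Y).symm ∘ₗ F'.mapLinear X Y ∘ₗ P.mkHom := by
    refine Finsupp.lhom_ext' fun d => LinearMap.ext_ring ?_
    exact eq_conj_of_heq _ _ (map_heq_of_generators hob hgen d)
  exact LinearMap.congr_fun this f

end ext

section descend

variable {P} {Q : Presentation k S}
  (h : ∀ {X Y : List S.Ob} {f g : FreeHom k S X Y}, P.Rel f g → Q.Rel f g)

/-- The quotient functor as a strict monoidal superfunctor. -/
def quotientSuperfunctor : StrictMonoidalSuperfunctor k P.Cat Q.Cat where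
  toFunctor := quotientFunctor P Q h
  map_add f g := _root_.map_add _ f g
  map_smul c f := _root_.map_smul _ c f
  map_mem {X Y p f} hf := by
    obtain ⟨f, hf', rfl⟩ := P.exists_ofDiag_of_mem hf
    exact Q.ofDiag_mem hf'
  obj_one := rfl
  obj_mul _ _ := rfl
  map_tensor {X X' Y Y'} f g := by
    obtain ⟨f, rfl⟩ := P.ofDiag_surjective f
    obtain ⟨g, rfl⟩ := P.ofDiag_surjective g
    exact ((Category.id_comp (_ ≫ 𝟙 _)).trans (Category.comp_id _)).symm

variable {F : StrictMonoidalSuperfunctor k P.Cat E}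

/-- The same induction as for `GenData.Respects.map_eq_zero`, now for a superfunctor that is already
defined: interchange holds in the source `P.Cat`, so only the relations of `Q` matter. -/
theorem map_eq_zero_of_inIdeal (hF : ∀ ⦃X Y : List S.Ob⦄ ⦃f g : FreeHom k S X Y⦄, Q.Rel f g →
      F.map (P.ofDiag f) = F.map (P.ofDiag g)) {X Y : List S.Ob} {f : FreeHom k S X Y}
    (hf : Q.InIdeal f) : F.map (P.ofDiag f) = 0 := by
  induction hf with
  | @rel X Y f g h' =>
    have e : P.ofDiag (f - g) = P.ofDiag f - P.ofDiag g := _root_.map_sub P.mkHom f g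
    exact (congrArg F.map e).trans ((_root_.map_sub (F.mapLinear _ _) _ _).trans
      (sub_eq_zero.2 (hF h')))
  | interchange hf hg =>
    exact (congrArg F.map ((Submodule.Quotient.mk_eq_zero _).2 (InIdeal.interchange hf hg))).trans
      (F.map_zero _ _)
  | zero => exact F.map_zero _ _
  | add _ _ hf hg => rw [ofDiag_add, F.map_add, hf, hg, add_zero]
  | smul c _ hf => rw [ofDiag_smul, F.map_smul, hf, smul_zero]
  | comp_left f _ hg => rw [ofDiag_comp, F.map_comp, hg, Limits.comp_zero]
  | comp_right _ g hf => rw [ofDiag_comp, F.map_comp, hf, Limits.zero_comp]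
  | whiskerL U _ hf =>
    rw [← id_tensor_ofDiag, F.map_tensor, hf, SuperBrauer.tensor_zero]; simp
  | whiskerR V _ hf =>
    rw [← ofDiag_tensor_id, F.map_tensor, hf, SuperBrauer.zero_tensor]; simp

/-- A strict monoidal superfunctor which respects additional relations descends. -/
def descend (F : StrictMonoidalSuperfunctor k P.Cat E)
    (hF : ∀ ⦃X Y : List S.Ob⦄ ⦃f g : FreeHom k S X Y⦄, Q.Rel f g →
      F.map (P.ofDiag f) = F.map (P.ofDiag g)) : StrictMonoidalSuperfunctor k Q.Cat E where
  obj X := F.obj ⟨X.word⟩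
  map {X Y} f := (Q.ideal X.word Y.word).liftQ (F.mapLinear ⟨X.word⟩ ⟨Y.word⟩ ∘ₗ P.mkHom)
    (fun _ hf => map_eq_zero_of_inIdeal hF hf) f
  map_id X := F.map_id ⟨X.word⟩
  map_comp {X Y Z} f g := by
    obtain ⟨f, rfl⟩ := Q.ofDiag_surjective f
    obtain ⟨g, rfl⟩ := Q.ofDiag_surjective g
    exact F.map_comp (P.ofDiag f) (P.ofDiag g)
  map_add f g := _root_.map_add _ f g
  map_smul c f := _root_.map_smul _ c f
  map_mem {X Y p f} hf := by
    obtain ⟨f, hf', rfl⟩ := Q.exists_ofDiag_of_mem hf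
    exact F.map_mem (P.ofDiag_mem hf')
  obj_one := F.obj_one
  obj_mul X Y := F.obj_mul ⟨X.word⟩ ⟨Y.word⟩
  map_tensor {X X' Y Y'} f g := by
    obtain ⟨f, rfl⟩ := Q.ofDiag_surjective f
    obtain ⟨g, rfl⟩ := Q.ofDiag_surjective g
    exact F.map_tensor (P.ofDiag f) (P.ofDiag g)

theorem quotient_comp_descend (hF : ∀ ⦃X Y : List S.Ob⦄ ⦃f g : FreeHom k S X Y⦄, Q.Rel f g →
      F.map (P.ofDiag f) = F.map (P.ofDiag g)) :
    quotientFunctor P Q h ⋙ (descend F hF).toFunctor = F.toFunctor := by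
  refine CategoryTheory.Functor.ext (fun X => rfl) fun X Y f => ?_
  obtain ⟨f, rfl⟩ := P.ofDiag_surjective f
  exact ((Category.id_comp (_ ≫ 𝟙 _)).trans (Category.comp_id _)).symm

/-- The quotient functor is the identity on words and surjective on morphisms, hence can be
cancelled. -/
theorem quotient_cancel {F F' : StrictMonoidalSuperfunctor k Q.Cat E}
    (e : quotientFunctor P Q h ⋙ F.toFunctor = quotientFunctor P Q h ⋙ F'.toFunctor) : F = F' := by
  refine StrictMonoidalSuperfunctor.toFunctor_injective (CategoryTheory.Functor.ext
    (fun X => Functor.congr_obj e ⟨X.word⟩) fun X Y f => ?_)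
  obtain ⟨f, rfl⟩ := Q.ofDiag_surjective f
  exact Functor.congr_hom e (P.ofDiag f : (⟨X.word⟩ : P.Cat) ⟶ ⟨Y.word⟩)

end descend

end Presentation

/-! ### Mixed crossings in the presence of a left dual -/

open OBOb

/-- Endofunctors `F a` (tensoring on the left with `a`), an involutive crossing of `↑` with itself
satisfying the braid relation, a left dual `↓` of `↑` and mixed crossings obtained by rotation, the
crossing `↓ ↑ ⟶ ↑ ↓` being invertible. -/
structure DualCrossing (C : Type*) [Category C] where
  F : OBOb → C ⥤ C
  x (a b : OBOb) (Z : C) : (F a).obj ((F b).obj Z) ⟶ (F b).obj ((F a).obj Z)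
  cap (Z : C) : (F down).obj ((F up).obj Z) ⟶ Z
  cup (Z : C) : Z ⟶ (F up).obj ((F down).obj Z)
  x_nat (a b : OBOb) {Z Z' : C} (g : Z ⟶ Z') :
    x a b Z ≫ (F b).map ((F a).map g) = (F a).map ((F b).map g) ≫ x a b Z'
  cap_nat {Z Z' : C} (g : Z ⟶ Z') : cap Z ≫ g = (F down).map ((F up).map g) ≫ cap Z'
  cup_nat {Z Z' : C} (g : Z ⟶ Z') : cup Z ≫ (F up).map ((F down).map g) = g ≫ cup Z'
  zigzag_down (Z : C) : (F down).map (cup Z) ≫ cap ((F down).obj Z) = 𝟙 _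
  zigzag_up (Z : C) : cup ((F up).obj Z) ≫ (F up).map (cap Z) = 𝟙 _
  up_up (Z : C) : x up up Z ≫ x up up Z = 𝟙 _
  braid_up (Z : C) : x up up ((F up).obj Z) ≫ (F up).map (x up up Z) ≫ x up up ((F up).obj Z) =
    (F up).map (x up up Z) ≫ x up up ((F up).obj Z) ≫ (F up).map (x up up Z)
  rotate (b : OBOb) (Z : C) : x down b Z = (F down).map ((F b).map (cup Z)) ≫
    (F down).map (x b up ((F down).obj Z)) ≫ cap ((F b).obj ((F down).obj Z))
  up_down (Z : C) : x up down Z ≫ x down up Z = 𝟙 _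
  down_up (Z : C) : x down up Z ≫ x up down Z = 𝟙 _

namespace DualCrossing

variable {C : Type*} [Category C] (D : DualCrossing C)

/-- Inserting the rotation formula creates a cup next to the cap being slid; naturality brings them
together and they straighten by `zigzag_up`. -/
theorem cap_slide (b : OBOb) (Z : C) : D.x down b ((D.F up).obj Z) ≫ (D.F b).map (D.cap Z) =
    (D.F down).map (D.x b up Z) ≫ D.cap ((D.F b).obj Z) := by
  rw [D.rotate, Category.assoc, Category.assoc, D.cap_nat, ← Functor.map_comp_assoc,
    ← Functor.map_comp_assoc, Category.assoc, D.x_nat, ← Functor.map_comp_assoc, D.zigzag_up]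
  simp

theorem cup_slide (b : OBOb) (Z : C) : D.cup ((D.F b).obj Z) ≫ (D.F up).map (D.x down b Z) =
    (D.F b).map (D.cup Z) ≫ D.x b up ((D.F down).obj Z) := by
  rw [D.rotate, Functor.map_comp, ← Category.assoc, D.cup_nat, Category.assoc, Functor.map_comp,
    ← Category.assoc (D.cup _), D.cup_nat, Category.assoc, D.zigzag_up, Category.comp_id]

/-- A morphism out of `↓ X` is determined by its mate. -/
theorem down_hom_ext {X Y : C} {f g : (D.F down).obj X ⟶ Y}
    (h : D.cup X ≫ (D.F up).map f = D.cup X ≫ (D.F up).map g) : f = g := by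
  -- A morphism is recovered from its mate by bending the strand back with the left cap.
  have key : ∀ f : (D.F down).obj X ⟶ Y,
      f = (D.F down).map (D.cup X ≫ (D.F up).map f) ≫ D.cap Y := fun f => by
    rw [Functor.map_comp, Category.assoc, ← D.cap_nat, ← Category.assoc, D.zigzag_down,
      Category.id_comp]
  rw [key f, key g, h]

/-- Bending both strands turns the crossing of two `↓` strands into the crossing of two `↑` strands:
each cup converts one orientation through `cup_slide`. -/
theorem cup_cup_down_down (Z : C) : D.cup Z ≫ (D.F up).map (D.cup ((D.F down).obj Z)) ≫
    (D.F up).map ((D.F up).map (D.x down down Z)) =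
      D.cup Z ≫ (D.F up).map (D.cup ((D.F down).obj Z)) ≫ D.x up up _ := by
  rw [← Functor.map_comp, D.cup_slide, Functor.map_comp, ← Category.assoc, D.cup_nat,
    Category.assoc, D.cup_slide, ← Category.assoc]

/-- By `cup_cup_down_down` the twofold mate of the square is the square of the upward crossing,
which is the identity. -/
theorem down_down (Z : C) : D.x down down Z ≫ D.x down down Z = 𝟙 _ := by
  refine D.down_hom_ext (D.down_hom_ext ?_)
  have e := D.cup_cup_down_down Z
  have e' := reassoc_of% e
  simp only [Functor.map_comp, CategoryTheory.Functor.map_id, Category.comp_id]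
  rw [e', D.x_nat, reassoc_of% e, D.up_up, Category.comp_id]

theorem x_x (a b : OBOb) (Z : C) : D.x a b Z ≫ D.x b a Z = 𝟙 _ := by
  cases a <;> cases b
  exacts [D.up_up Z, D.up_down Z, D.down_up Z, D.down_down Z]

theorem map_x_x (c a b : OBOb) (Z : C) :
    (D.F c).map (D.x a b Z) ≫ (D.F c).map (D.x b a Z) = 𝟙 _ := by
  rw [← Functor.map_comp, D.x_x, CategoryTheory.Functor.map_id]

/-- The braid relation for three strands. -/
def Braid (a b c : OBOb) : Prop := ∀ Z, D.x a b ((D.F c).obj Z) ≫ (D.F b).map (D.x a c Z) ≫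
    D.x b c ((D.F a).obj Z) =
  (D.F a).map (D.x b c Z) ≫ D.x a c ((D.F b).obj Z) ≫ (D.F c).map (D.x a b Z)

variable {D}

/-- Composing the braid relation on both sides with the inverse crossing of the first two strands
gives the relation with these strands exchanged; `swap_right` does this for the last two. -/
theorem Braid.swap_left {a b c : OBOb} (h : D.Braid a b c) : D.Braid b a c := fun Z => by
  have h := D.x b a _ ≫= h Z =≫ (D.F c).map (D.x b a Z)
  simp only [Category.assoc, D.map_x_x, Category.comp_id, reassoc_of% D.x_x] at h
  exact h.symm

theorem Braid.swap_right {a b c : OBOb} (h : D.Braid a b c) : D.Braid a c b := fun Z => by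
  have h := (D.F a).map (D.x c b Z) ≫= h Z =≫ D.x c b _
  simp only [Category.assoc, D.x_x, Category.comp_id, reassoc_of% D.map_x_x] at h
  exact h.symm

/-- Take the mate with respect to the leading `↓` strand. The cup passes through both crossings of
that strand by `cup_slide`, which turns them into crossings with a trailing `↑` strand, where the
hypothesis applies. -/
theorem Braid.rotate {b c : OBOb} (h : D.Braid b c up) : D.Braid down b c := fun Z => by
  refine D.down_hom_ext ?_
  simp only [Functor.map_comp]
  have e := congrArg (D.F b).map (D.cup_slide c Z)
  have e' := congrArg (D.F c).map (D.cup_slide b Z)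
  simp only [Functor.map_comp] at e e'
  rw [reassoc_of% D.cup_slide, reassoc_of% D.x_nat, reassoc_of% e, reassoc_of% D.cup_nat,
    reassoc_of% D.cup_slide, D.x_nat, reassoc_of% e', reassoc_of% D.x_nat, h]

variable (D)

theorem braid (a b c : OBOb) : D.Braid a b c := by
  -- Each rotation replaces a trailing `↑` by a leading `↓`, so one relation is obtained for every
  -- number of downward strands; the swaps then reach all eight orientations.
  have h0 : D.Braid up up up := D.braid_up
  have h1 := h0.rotate
  have h2 := h1.swap_left.swap_left.rotate
  have h3 := h2.rotate
  cases a <;> cases b <;> cases c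
  exacts [h0, h1.swap_left.swap_right, h1.swap_left, h2.swap_right.swap_left, h1, h2.swap_right, h2,
    h3]

/-- The cap `↑ ↓ ⟶ 1`. -/
def capR (Z : C) : (D.F up).obj ((D.F down).obj Z) ⟶ Z := D.x up down Z ≫ D.cap Z

/-- The cup `1 ⟶ ↓ ↑`. -/
def cupR (Z : C) : Z ⟶ (D.F down).obj ((D.F up).obj Z) := D.cup Z ≫ D.x up down Z

theorem capR_nat {Z Z' : C} (g : Z ⟶ Z') :
    D.capR Z ≫ g = (D.F up).map ((D.F down).map g) ≫ D.capR Z' := by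
  rw [capR, capR, Category.assoc, D.cap_nat, reassoc_of% D.x_nat]

theorem cupR_nat {Z Z' : C} (g : Z ⟶ Z') :
    D.cupR Z ≫ (D.F down).map ((D.F up).map g) = g ≫ D.cupR Z' := by
  rw [cupR, cupR, Category.assoc, D.x_nat, ← Category.assoc, D.cup_nat, Category.assoc]

theorem down_up_capR (Z : C) : D.x down up Z ≫ D.capR Z = D.cap Z := by
  rw [capR, ← Category.assoc, D.down_up, Category.id_comp]

/-- Write the right cap as a crossing followed by the left cap and express the left cap by
`cap_slide`. The three crossings are rearranged by the braid relation, after which two of them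
cancel. -/
theorem capR_slide (b : OBOb) (Z : C) : D.x up b ((D.F down).obj Z) ≫ (D.F b).map (D.capR Z) =
    (D.F up).map (D.x b down Z) ≫ D.capR ((D.F b).obj Z) := by
  have e : (D.F b).map (D.cap Z) = D.x b down _ ≫ (D.F down).map (D.x b up Z) ≫ D.cap _ := by
    rw [← D.cap_slide, ← Category.assoc, D.x_x, Category.id_comp]
  have h := D.braid up b down Z
  rw [capR, capR, Functor.map_comp, e, reassoc_of% h, reassoc_of% D.map_x_x]

/-- Sliding the cap and then the cup past the `↑` strand converts the right zigzag into a left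
zigzag together with two mutually inverse crossings. -/
theorem zigzagR_up (Z : C) : (D.F up).map (D.cupR Z) ≫ D.capR ((D.F up).obj Z) = 𝟙 _ := by
  rw [cupR, Functor.map_comp, Category.assoc, ← D.capR_slide, ← Category.assoc, ← D.cup_slide,
    capR, Functor.map_comp, Category.assoc, reassoc_of% D.map_x_x, D.zigzag_up]

theorem zigzagR_down (Z : C) : D.cupR ((D.F down).obj Z) ≫ (D.F down).map (D.capR Z) = 𝟙 _ := by
  have e : (D.F down).map (D.capR Z) =
      D.x down up _ ≫ (D.F up).map (D.x down down Z) ≫ D.capR _ := by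
    rw [← D.capR_slide, ← Category.assoc, D.x_x, Category.id_comp]
  rw [e, cupR, Category.assoc, reassoc_of% D.x_x, reassoc_of% D.cup_slide, D.down_up_capR,
    D.zigzag_down]

/-- Rotating with the right cap and cup yields the downward crossing obtained by left rotation. This
is needed because `downCross` is a right rotation, whereas `DualCrossing.rotate` is a left one. -/
theorem down_down_eq (Z : C) : D.cupR ((D.F down).obj ((D.F down).obj Z)) ≫
    (D.F down).map (D.x up down ((D.F down).obj Z)) ≫
      (D.F down).map ((D.F down).map (D.capR Z)) = D.x down down Z := by
  rw [← Functor.map_comp, D.capR_slide, Functor.map_comp, ← Category.assoc, D.cupR_nat,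
    Category.assoc, D.zigzagR_down, Category.comp_id]

/-- A morphism into `↓ Y` is determined by its mate. -/
theorem hom_down_ext {X Y : C} {f g : X ⟶ (D.F down).obj Y}
    (h : (D.F up).map f ≫ D.capR Y = (D.F up).map g ≫ D.capR Y) : f = g := by
  have key : ∀ f : X ⟶ (D.F down).obj Y,
      f = D.cupR X ≫ (D.F down).map ((D.F up).map f ≫ D.capR Y) := fun f => by
    rw [Functor.map_comp, ← Category.assoc, D.cupR_nat, Category.assoc, D.zigzagR_down,
      Category.comp_id]
  rw [key f, key g, h]

/-- An endomorphism of the strand `↑` which commutes with the crossing. -/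
structure Token where
  t (Z : C) : (D.F up).obj Z ⟶ (D.F up).obj Z
  nat_x (a b : OBOb) (Z : C) : (D.F up).map (D.x a b Z) ≫ t _ = t _ ≫ (D.F up).map (D.x a b Z)
  nat_cap (Z : C) : (D.F up).map (D.cap Z) ≫ t _ = t _ ≫ (D.F up).map (D.cap Z)
  cross (Z : C) : t ((D.F up).obj Z) ≫ D.x up up Z = D.x up up Z ≫ (D.F up).map (t Z)

namespace Token

variable {D} (T : D.Token)

/-- The rotation of `t`. -/
def td (Z : C) : (D.F down).obj Z ⟶ (D.F down).obj Z :=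
  D.cupR ((D.F down).obj Z) ≫ (D.F down).map (T.t ((D.F down).obj Z)) ≫ (D.F down).map (D.capR Z)

/-- The token on a strand of either orientation. -/
def tok : ∀ (a : OBOb) (Z : C), (D.F a).obj Z ⟶ (D.F a).obj Z
  | up => T.t
  | down => T.td

/-- The rotated token carries a right cup and cap; the outer cap straightens the cup by `zigzagR_up`
and leaves the original token on the other leg. -/
theorem td_capR (Z : C) : (D.F up).map (T.td Z) ≫ D.capR Z = T.t _ ≫ D.capR Z := by
  rw [td, Functor.map_comp, Functor.map_comp, Category.assoc, Category.assoc, ← D.capR_nat,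
    ← Category.assoc ((D.F up).map ((D.F down).map _)), ← D.capR_nat, Category.assoc,
    reassoc_of% D.zigzagR_up]

theorem t_capR (Z : C) : (D.F up).map (D.capR Z) ≫ T.t _ = T.t _ ≫ (D.F up).map (D.capR Z) := by
  rw [capR, Functor.map_comp, Category.assoc, T.nat_cap, reassoc_of% T.nat_x]

/-- Conjugation by the involutive crossing exchanges sliding from the first strand with sliding from
the second; `cross_first` is the converse. -/
theorem cross_second {a b : OBOb} (h : ∀ Z, T.tok a ((D.F b).obj Z) ≫ D.x a b Z =
    D.x a b Z ≫ (D.F b).map (T.tok a Z)) (Z : C) :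
    (D.F b).map (T.tok a Z) ≫ D.x b a Z = D.x b a Z ≫ T.tok a ((D.F b).obj Z) := by
  have h := D.x b a _ ≫= h Z =≫ D.x b a _
  simp only [Category.assoc, D.x_x, Category.comp_id, reassoc_of% D.x_x] at h
  exact h.symm

theorem cross_first {a b : OBOb} (h : ∀ Z,
    (D.F b).map (T.tok a Z) ≫ D.x b a Z = D.x b a Z ≫ T.tok a ((D.F b).obj Z)) (Z : C) :
    T.tok a ((D.F b).obj Z) ≫ D.x a b Z = D.x a b Z ≫ (D.F b).map (T.tok a Z) := by
  have h := D.x a b _ ≫= h Z =≫ D.x a b _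
  simp only [Category.assoc, D.x_x, Category.comp_id, reassoc_of% D.x_x] at h
  exact h.symm

/-- After passing to mates under the right cap, `td_capR` replaces the rotated token by `t` on a `↑`
strand and `capR_slide` moves the cap through the crossing, so the hypothesis on `↑` applies. -/
theorem td_cross {b : OBOb} (h : ∀ Z, T.t ((D.F b).obj Z) ≫ D.x up b Z =
    D.x up b Z ≫ (D.F b).map (T.t Z)) (Z : C) :
    (D.F b).map (T.td Z) ≫ D.x b down Z = D.x b down Z ≫ T.td ((D.F b).obj Z) := by
  refine D.hom_down_ext ?_
  rw [Functor.map_comp, Functor.map_comp, Category.assoc, Category.assoc, T.td_capR,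
    ← D.capR_slide, reassoc_of% T.nat_x, ← D.capR_slide, ← Category.assoc, ← D.x_nat,
    Category.assoc, ← Functor.map_comp, T.td_capR, Functor.map_comp, reassoc_of% h]

/-- Under the right cap the `↑ ↓` crossing becomes, by `capR_slide`, an `↑ ↑` crossing, through
which the token slides by assumption. -/
theorem cross_up_down (Z : C) : T.t ((D.F down).obj Z) ≫ D.x up down Z =
    D.x up down Z ≫ (D.F down).map (T.t Z) := by
  have h := T.cross_second (a := up) (b := up) T.cross
  dsimp only [tok] at h
  refine D.hom_down_ext ?_
  rw [Functor.map_comp, Functor.map_comp, Category.assoc, Category.assoc, ← D.capR_slide,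
    reassoc_of% h, ← T.t_capR, ← D.capR_nat, ← Category.assoc ((D.F up).map (D.x up down Z)),
    ← D.capR_slide, Category.assoc]

/-- Tokens on the first strand slide through crossings. -/
theorem tok_cross (a b : OBOb) (Z : C) : T.tok a ((D.F b).obj Z) ≫ D.x a b Z =
    D.x a b Z ≫ (D.F b).map (T.tok a Z) := by
  cases a <;> cases b
  · exact T.cross Z
  · exact T.cross_up_down Z
  · exact T.cross_first (a := down) (T.td_cross T.cross) Z
  · exact T.cross_first (a := down) (T.td_cross T.cross_up_down) Z

/-- The left cap is a crossing followed by the right cap, so the claim is `td_capR` after sliding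
the tokens through the crossing. -/
theorem td_cap (Z : C) : T.td ((D.F up).obj Z) ≫ D.cap Z = (D.F down).map (T.t Z) ≫ D.cap Z := by
  have h := T.tok_cross down up Z
  have h' := T.cross_second (a := up) (b := down) (T.tok_cross up down) Z
  dsimp only [tok] at h h'
  rw [← D.down_up_capR, reassoc_of% h, T.td_capR, reassoc_of% h']

/-- Unfold the right cap as crossing and left cap; the crossing slides down past the token and turns
the left cup into the right cup. The two orientations of a bubble thus have the same value. -/
theorem clockwise_bubble (Z : C) : D.cup Z ≫ T.t _ ≫ D.capR Z =
    D.cupR Z ≫ (D.F down).map (T.t Z) ≫ D.cap Z := by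
  rw [capR, cupR, reassoc_of% T.cross_up_down, Category.assoc]

end Token

end DualCrossing

/-! ### Whiskering in presented supercategories -/

namespace Presentation

open FreeHom

variable {k : Type w} [Field k] {S : Signature.{u, v}} (P : Presentation k S)

/-- `1_a ⊗ -` for a generating object `a`. -/
def consF (a : S.Ob) : P.Cat ⥤ P.Cat where
  obj X := ⟨a :: X.word⟩
  map {X Y} f := P.homWhiskerL [a] f
  map_id X := congrArg P.mkHom (FreeHom.whiskerL_id [a] X.word)
  map_comp {X Y Z} f g := by
    obtain ⟨f, rfl⟩ := P.ofDiag_surjective f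
    obtain ⟨g, rfl⟩ := P.ofDiag_surjective g
    exact congrArg P.mkHom (FreeHom.whiskerL_comp [a] f g)

theorem consF_map_eq_tensor (a : S.Ob) {X Y : P.Cat} (f : X ⟶ Y) :
    (P.consF a).map f = tensorHom (k := k) (𝟙 (⟨[a]⟩ : P.Cat)) f := by
  obtain ⟨f, rfl⟩ := P.ofDiag_surjective f
  exact (P.id_tensor_ofDiag [a] f).symm

theorem consF_map_smul (a : S.Ob) {X Y : P.Cat} (c : k) (f : X ⟶ Y) :
    (P.consF a).map (c • f) = c • (P.consF a).map f := _root_.map_smul (P.homWhiskerL [a]) c f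

/-- `f ⊗ 1_Z`. -/
def tail {s t : List S.Ob} (f : FreeHom k S s t) (Z : P.Cat) :
    (⟨s ++ Z.word⟩ : P.Cat) ⟶ ⟨t ++ Z.word⟩ :=
  P.ofDiag (FreeHom.whiskerR Z.word f)

theorem tail_mem {s t : List S.Ob} {f : FreeHom k S s t} {p : ZMod 2} (hf : f ∈ homog k S s t p)
    (Z : P.Cat) : P.tail f Z ∈ homParity (k := k) (⟨s ++ Z.word⟩ : P.Cat) ⟨t ++ Z.word⟩ p :=
  P.ofDiag_mem (whiskerR_mem_homog _ hf)

theorem tail_comp {r s t : List S.Ob} (f : FreeHom k S r s) (g : FreeHom k S s t) (Z : P.Cat) :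
    P.tail (FreeHom.comp f g) Z = P.tail f Z ≫ P.tail g Z :=
  congrArg P.ofDiag (FreeHom.whiskerR_comp _ f g)

theorem tail_id (s : List S.Ob) (Z : P.Cat) : P.tail (FreeHom.id k s) Z = 𝟙 _ :=
  congrArg P.ofDiag (FreeHom.whiskerR_id _ _)

theorem tail_add {s t : List S.Ob} (f g : FreeHom k S s t) (Z : P.Cat) :
    P.tail (f + g) Z = P.tail f Z + P.tail g Z :=
  congrArg P.ofDiag (_root_.map_add _ f g)

theorem tail_smul {s t : List S.Ob} (c : k) (f : FreeHom k S s t) (Z : P.Cat) :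
    P.tail (c • f) Z = c • P.tail f Z :=
  congrArg P.ofDiag (_root_.map_smul _ c f)

theorem castHom_rfl {X Y : List S.Ob} (f : FreeHom k S X Y) : castHom rfl rfl f = f :=
  Finsupp.mapDomain_id

theorem tail_whiskerL (a : S.Ob) {s t : List S.Ob} (f : FreeHom k S s t) (Z : P.Cat) :
    P.tail (FreeHom.whiskerL [a] f) Z = (P.consF a).map (P.tail f Z) :=
  congrArg P.ofDiag ((FreeHom.whiskerR_whiskerL [a] Z.word f).trans (castHom_rfl _))

/-- Layers store proofs about their boundary words; this absorbs different presentations of the same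
word, such as a trailing empty list. -/
theorem layer_heq {U V s t : List S.Ob} {p : ZMod 2} (g : S.Gen s t p) {X Y X' Y' : List S.Ob}
    (hX : X = U ++ (s ++ V)) (hY : Y = U ++ (t ++ V)) (hX' : X' = U ++ (s ++ V))
    (hY' : Y' = U ++ (t ++ V)) :
    HEq (P.ofDiag (FreeHom.layer k U g V hX hY)) (P.ofDiag (FreeHom.layer k U g V hX' hY')) := by
  subst hX hY hX' hY'; rfl

theorem tail_layer {U V s t : List S.Ob} {p : ZMod 2} (g : S.Gen s t p) {X Y : List S.Ob}
    (hX : X = U ++ (s ++ V)) (hY : Y = U ++ (t ++ V)) (Z : P.Cat) :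
    P.tail (FreeHom.layer k U g V hX hY) Z =
      P.ofDiag (FreeHom.layer k U g (V ++ Z.word) (by rw [hX]; simp) (by rw [hY]; simp)) := by
  rw [tail, FreeHom.layer, FreeHom.whiskerR_single]
  rfl

/-- `g ⊗ 1_Z` for a generator `g`. -/
def genTail {s t : List S.Ob} {p : ZMod 2} (g : S.Gen s t p) (Z : P.Cat) :
    (⟨s ++ Z.word⟩ : P.Cat) ⟶ ⟨t ++ Z.word⟩ :=
  P.ofDiag (FreeHom.layer k [] g Z.word)

theorem tail_layer_heq {V s t : List S.Ob} {p : ZMod 2} (g : S.Gen s t p) {X Y : List S.Ob}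
    (hX : X = [] ++ (s ++ V)) (hY : Y = [] ++ (t ++ V)) (Z : P.Cat) :
    HEq (P.tail (FreeHom.layer k [] g V hX hY) Z) (P.genTail g ⟨V ++ Z.word⟩) := by
  rw [tail_layer]
  exact P.layer_heq g _ _ _ _

theorem tail_layer_cons (a : S.Ob) (U V : List S.Ob) {s t : List S.Ob} {p : ZMod 2}
    (g : S.Gen s t p) {X Y : List S.Ob} (hX : X = U ++ (s ++ V)) (hY : Y = U ++ (t ++ V))
    (Z : P.Cat) :
    P.tail (FreeHom.layer k (a :: U) g V (congrArg (a :: ·) hX) (congrArg (a :: ·) hY)) Z =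
      (P.consF a).map (P.tail (FreeHom.layer k U g V hX hY) Z) :=
  (congrArg (fun f => P.tail f Z) (FreeHom.whiskerL_single [a] _ _).symm).trans
    (P.tail_whiskerL a (FreeHom.layer k U g V hX hY) Z)

theorem genTail_mem {s t : List S.Ob} {p : ZMod 2} (g : S.Gen s t p) (Z : P.Cat) :
    P.genTail g Z ∈ homParity (k := k) (⟨s ++ Z.word⟩ : P.Cat) ⟨t ++ Z.word⟩ p :=
  P.ofDiag_mem (layer_mem_homog _ _ _ _ _)

theorem genTail_eq_tail {s t : List S.Ob} {p : ZMod 2} (g : S.Gen s t p) (Z : P.Cat) :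
    P.genTail g Z = P.tail (FreeHom.layer k [] g [] (List.append_nil s).symm
      (List.append_nil t).symm) Z := by
  rw [tail_layer]
  rfl

theorem tail_of_rel {s t : List S.Ob} {f g : FreeHom k S s t} (h : P.Rel f g) (Z : P.Cat) :
    P.tail f Z = P.tail g Z := by
  refine (P.ofDiag_eq_iff _ _).2 ?_
  rw [← _root_.map_sub]
  exact .whiskerR _ (.rel h)

theorem ofDiag_whiskerL_eq (a : S.Ob) (U : List S.Ob) {X Y : List S.Ob} (g : FreeHom k S X Y) :
    P.ofDiag (FreeHom.whiskerL (a :: U) g) = (P.consF a).map (P.ofDiag (FreeHom.whiskerL U g)) :=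
  congrArg P.ofDiag ((FreeHom.whiskerL_append [a] U g).trans (castHom_rfl _))

/-- The image of `g` under `1_U ⊗ -`. -/
def wordMap : ∀ (U : List S.Ob) {X Y : P.Cat}, (X ⟶ Y) →
    ((⟨U ++ X.word⟩ : P.Cat) ⟶ ⟨U ++ Y.word⟩)
  | [], _, _, g => g
  | a :: U, _, _, g => (P.consF a).map (wordMap U g)

theorem wordMap_ofDiag (U : List S.Ob) {X Y : List S.Ob} (g : FreeHom k S X Y) :
    P.wordMap U (P.ofDiag g) = P.ofDiag (FreeHom.whiskerL U g) := by
  induction U with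
  | nil => exact congrArg P.ofDiag (FreeHom.whiskerL_nil g).symm
  | cons a U ih => exact (congrArg (P.consF a).map ih).trans (P.ofDiag_whiskerL_eq a U g).symm

/-- The interchange relation in a form where `1_s ⊗ g` is an iterated application of `consF`. For a
concrete word `s` this unfolds definitionally to the composites of functors used in `DualCrossing`.
-/
theorem tail_exchange {s t : List S.Ob} {f : FreeHom k S s t} {p q : ZMod 2}
    (hf : f ∈ homog k S s t p) {Z Z' : P.Cat} {g : Z ⟶ Z'} (hg : g ∈ homParity (k := k) Z Z' q) :
    P.tail f Z ≫ P.wordMap t g = sgn k (p * q) • (P.wordMap s g ≫ P.tail f Z') := by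
  obtain ⟨g, hg', rfl⟩ := P.exists_ofDiag_of_mem hg
  refine (congrArg (P.tail f Z ≫ ·) (P.wordMap_ofDiag t g)).trans ?_
  refine Eq.trans ?_ (congrArg (fun h => sgn k (p * q) • (h ≫ P.tail f Z'))
    (P.wordMap_ofDiag s g)).symm
  exact (P.ofDiag_eq_iff _ _).2 (.interchange hf hg')

theorem wordMap_add (U : List S.Ob) {X Y : P.Cat} (f g : X ⟶ Y) :
    P.wordMap U (f + g) = P.wordMap U f + P.wordMap U g := by
  induction U with
  | nil => rfl
  | cons a U ih =>
    exact (congrArg (P.consF a).map ih).trans (_root_.map_add (P.homWhiskerL [a]) _ _)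

/-- For even `f` the exchange carries no sign, so it extends from homogeneous `g` to all `g` and
becomes naturality. -/
theorem tail_natural {s t : List S.Ob} {f : FreeHom k S s t} (hf : f ∈ homog k S s t 0)
    {Z Z' : P.Cat} (g : Z ⟶ Z') : P.tail f Z ≫ P.wordMap t g = P.wordMap s g ≫ P.tail f Z' := by
  refine homogeneous_induction k (P := fun g => P.tail f Z ≫ P.wordMap t g =
    P.wordMap s g ≫ P.tail f Z') g ?_ ?_
  · intro p g hg
    rw [P.tail_exchange hf hg, zero_mul, sgn_zero, one_smul]
  · intro g g' hg hg'
    rw [wordMap_add, wordMap_add, Preadditive.comp_add, Preadditive.add_comp, hg, hg']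

theorem genTail_exchange {s t : List S.Ob} {p q : ZMod 2} (g : S.Gen s t p)
    {Z Z' : P.Cat} {h : Z ⟶ Z'} (hh : h ∈ homParity (k := k) Z Z' q) :
    P.genTail g Z ≫ P.wordMap t h = sgn k (p * q) • (P.wordMap s h ≫ P.genTail g Z') := by
  rw [genTail_eq_tail, genTail_eq_tail]
  exact P.tail_exchange (layer_mem_homog _ _ _ _ _) hh

theorem genTail_natural {s t : List S.Ob} (g : S.Gen s t 0)
    {Z Z' : P.Cat} (h : Z ⟶ Z') :
    P.genTail g Z ≫ P.wordMap t h = P.wordMap s h ≫ P.genTail g Z' := by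
  rw [genTail_eq_tail, genTail_eq_tail]
  exact P.tail_natural (layer_mem_homog _ _ _ _ _) h

end Presentation

/-! ### The crossings of the oriented Brauer supercategory -/

section orientedBrauer

open OBOb FreeHom

variable {k : Type w} {A : Type v} [Field k] [Ring A] [Algebra k A]
  (𝒜 : ZMod 2 → Submodule k A) [GradedAlgebra 𝒜]

/-- The crossing of two downward strands as a left rotation. -/
def leftDownCross : OBFree 𝒜 [down, down] [down, down] :=
  obComp 𝒜 (Y := [down, down, up, down]) (obLayer 𝒜 [down, down] .leftCup []) <|
  obComp 𝒜 (Y := [down, up, down, down])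
    (whiskerL (S := OBSig 𝒜) [down] (whiskerR (S := OBSig 𝒜) [down] (leftCross 𝒜))) <|
  obLayer 𝒜 [] .leftCap [down, down]

/-- The crossings of strands of all orientations. -/
def obCross : ∀ a b : OBOb, OBFree 𝒜 [a, b] [b, a]
  | up, up => obLayer 𝒜 [] .cross []
  | up, down => rightCross 𝒜
  | down, up => leftCross 𝒜
  | down, down => leftDownCross 𝒜

theorem leftDownCross_mem : leftDownCross 𝒜 ∈ homog k (OBSig 𝒜) [down, down] [down, down] 0 :=
  comp_even (obLayer_mem 𝒜 _ _ _) (comp_even (whiskerL_mem_homog _ (whiskerR_mem_homog _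
    (leftCross_mem 𝒜))) (obLayer_mem 𝒜 _ _ _) rfl) rfl

theorem obCross_mem (a b : OBOb) : obCross 𝒜 a b ∈ homog k (OBSig 𝒜) [a, b] [b, a] 0 := by
  cases a <;> cases b
  exacts [obLayer_mem 𝒜 _ _ _, rightCross_mem 𝒜, leftCross_mem 𝒜, leftDownCross_mem 𝒜]


namespace OB

/-- Tensoring on the left with `a`. -/
abbrev F (a : OBOb) : (OB 𝒜).Cat ⥤ (OB 𝒜).Cat := (OB 𝒜).consF a

/-- The word of an object. -/
abbrev wd (Z : (OB 𝒜).Cat) : List OBOb := Z.word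

/-- The crossings, tensored with identities on the right. -/
def cross (a b : OBOb) (Z : (OB 𝒜).Cat) :
    (F 𝒜 a).obj ((F 𝒜 b).obj Z) ⟶ (F 𝒜 b).obj ((F 𝒜 a).obj Z) :=
  (OB 𝒜).tail (obCross 𝒜 a b) Z

/-- The left cap, tensored with identities on the right. -/
def leftCap (Z : (OB 𝒜).Cat) : (F 𝒜 down).obj ((F 𝒜 up).obj Z) ⟶ Z :=
  (OB 𝒜).genTail (S := OBSig 𝒜) OBGen.leftCap Z

/-- The left cup, tensored with identities on the right. -/
def leftCup (Z : (OB 𝒜).Cat) : Z ⟶ (F 𝒜 up).obj ((F 𝒜 down).obj Z) :=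
  (OB 𝒜).genTail (S := OBSig 𝒜) OBGen.leftCup Z

/-- The right cap, tensored with identities on the right. -/
def rightCap (Z : (OB 𝒜).Cat) : (F 𝒜 up).obj ((F 𝒜 down).obj Z) ⟶ Z :=
  (OB 𝒜).genTail (S := OBSig 𝒜) OBGen.rightCap Z

/-- The right cup, tensored with identities on the right. -/
def rightCup (Z : (OB 𝒜).Cat) : Z ⟶ (F 𝒜 down).obj ((F 𝒜 up).obj Z) :=
  (OB 𝒜).genTail (S := OBSig 𝒜) OBGen.rightCup Z

/-- The upward token, tensored with identities on the right. -/
def tok {p : ZMod 2} (a : 𝒜 p) (Z : (OB 𝒜).Cat) : (F 𝒜 up).obj Z ⟶ (F 𝒜 up).obj Z :=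
  (OB 𝒜).genTail (S := OBSig 𝒜) (OBGen.tok a) Z

theorem cross_nat (a b : OBOb) {Z Z' : (OB 𝒜).Cat} (g : Z ⟶ Z') :
    cross 𝒜 a b Z ≫ (F 𝒜 b).map ((F 𝒜 a).map g) =
      (F 𝒜 a).map ((F 𝒜 b).map g) ≫ cross 𝒜 a b Z' :=
  (OB 𝒜).tail_natural (obCross_mem 𝒜 a b) g

theorem leftCap_nat {Z Z' : (OB 𝒜).Cat} (g : Z ⟶ Z') :
    leftCap 𝒜 Z ≫ g = (F 𝒜 down).map ((F 𝒜 up).map g) ≫ leftCap 𝒜 Z' :=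
  (OB 𝒜).genTail_natural (S := OBSig 𝒜) OBGen.leftCap g

theorem leftCup_nat {Z Z' : (OB 𝒜).Cat} (g : Z ⟶ Z') :
    leftCup 𝒜 Z ≫ (F 𝒜 up).map ((F 𝒜 down).map g) = g ≫ leftCup 𝒜 Z' :=
  (OB 𝒜).genTail_natural (S := OBSig 𝒜) OBGen.leftCup g

section components

variable {Z : (OB 𝒜).Cat}

/-- The values `f'` and `g'` are free variables so that a defining relation can be transcribed layer
by layer, with words compared only up to definitional unfolding. -/
theorem tail_obComp {r s t : List OBOb} {f : OBFree 𝒜 r s} {g : OBFree 𝒜 s t}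
    {f' : (⟨r ++ wd 𝒜 Z⟩ : (OB 𝒜).Cat) ⟶ ⟨s ++ wd 𝒜 Z⟩}
    {g' : (⟨s ++ wd 𝒜 Z⟩ : (OB 𝒜).Cat) ⟶ ⟨t ++ wd 𝒜 Z⟩}
    (hf : (OB 𝒜).tail f Z = f') (hg : (OB 𝒜).tail g Z = g') :
    (OB 𝒜).tail (obComp 𝒜 f g) Z = f' ≫ g' := by
  rw [← hf, ← hg]
  exact (OB 𝒜).tail_comp f g Z

theorem tail_cons (a : OBOb) {U V s t : List OBOb} {p : ZMod 2} {g : OBGen 𝒜 s t p}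
    {f' : (⟨U ++ (s ++ V) ++ wd 𝒜 Z⟩ : (OB 𝒜).Cat) ⟶ ⟨U ++ (t ++ V) ++ wd 𝒜 Z⟩}
    (h : (OB 𝒜).tail (obLayer 𝒜 U g V) Z = f') :
    (OB 𝒜).tail (obLayer 𝒜 (a :: U) g V) Z = (F 𝒜 a).map f' := by
  rw [← h]
  exact (OB 𝒜).tail_layer_cons (S := OBSig 𝒜) a U V g rfl rfl Z

theorem tail_cross (V : List OBOb) : (OB 𝒜).tail (obLayer 𝒜 [] .cross V) Z =
    cross 𝒜 up up ⟨V ++ wd 𝒜 Z⟩ :=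
  (eq_of_heq ((OB 𝒜).tail_layer_heq (S := OBSig 𝒜) _ rfl rfl Z)).trans
    ((OB 𝒜).genTail_eq_tail (S := OBSig 𝒜) _ _)

theorem tail_leftCap (V : List OBOb) : (OB 𝒜).tail (obLayer 𝒜 [] .leftCap V) Z =
    leftCap 𝒜 ⟨V ++ wd 𝒜 Z⟩ :=
  eq_of_heq ((OB 𝒜).tail_layer_heq (S := OBSig 𝒜) _ rfl rfl Z)

theorem tail_leftCup (V : List OBOb) : (OB 𝒜).tail (obLayer 𝒜 [] .leftCup V) Z =
    leftCup 𝒜 ⟨V ++ wd 𝒜 Z⟩ :=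
  eq_of_heq ((OB 𝒜).tail_layer_heq (S := OBSig 𝒜) _ rfl rfl Z)

theorem tail_rightCap (V : List OBOb) : (OB 𝒜).tail (obLayer 𝒜 [] .rightCap V) Z =
    rightCap 𝒜 ⟨V ++ wd 𝒜 Z⟩ :=
  eq_of_heq ((OB 𝒜).tail_layer_heq (S := OBSig 𝒜) _ rfl rfl Z)

theorem tail_rightCup (V : List OBOb) : (OB 𝒜).tail (obLayer 𝒜 [] .rightCup V) Z =
    rightCup 𝒜 ⟨V ++ wd 𝒜 Z⟩ :=
  eq_of_heq ((OB 𝒜).tail_layer_heq (S := OBSig 𝒜) _ rfl rfl Z)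

theorem tail_tok {p : ZMod 2} (a : 𝒜 p) (V : List OBOb) :
    (OB 𝒜).tail (obLayer 𝒜 [] (.tok a) V) Z = tok 𝒜 a ⟨V ++ wd 𝒜 Z⟩ :=
  eq_of_heq ((OB 𝒜).tail_layer_heq (S := OBSig 𝒜) _ rfl rfl Z)

theorem tail_whisker (a c : OBOb) {b d b' d' : OBOb} (f : OBFree 𝒜 [b, d] [b', d']) :
    (OB 𝒜).tail (whiskerL (S := OBSig 𝒜) [a] (whiskerR (S := OBSig 𝒜) [c] f)) Z =
      (F 𝒜 a).map ((OB 𝒜).tail f ⟨c :: wd 𝒜 Z⟩) := by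
  refine ((OB 𝒜).tail_whiskerL (S := OBSig 𝒜) a _ Z).trans (congrArg (F 𝒜 a).map ?_)
  exact congrArg (OB 𝒜).ofDiag ((FreeHom.whiskerR_append (S := OBSig 𝒜) [c] (wd 𝒜 Z) f).trans
    (Presentation.castHom_rfl _))

end components

theorem zigzag_down (Z : (OB 𝒜).Cat) :
    (F 𝒜 down).map (leftCup 𝒜 Z) ≫ leftCap 𝒜 ((F 𝒜 down).obj Z) = 𝟙 _ :=
  (tail_obComp 𝒜 (tail_cons 𝒜 down (tail_leftCup 𝒜 [])) (tail_leftCap 𝒜 [down])).symm.trans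
    (((OB 𝒜).tail_of_rel OBRel.left_zigzag_down Z).trans ((OB 𝒜).tail_id _ Z))

theorem zigzag_up (Z : (OB 𝒜).Cat) :
    leftCup 𝒜 ((F 𝒜 up).obj Z) ≫ (F 𝒜 up).map (leftCap 𝒜 Z) = 𝟙 _ :=
  (tail_obComp 𝒜 (tail_leftCup 𝒜 [up]) (tail_cons 𝒜 up (tail_leftCap 𝒜 []))).symm.trans
    (((OB 𝒜).tail_of_rel OBRel.left_zigzag_up Z).trans ((OB 𝒜).tail_id _ Z))

theorem cross_cross (Z : (OB 𝒜).Cat) : cross 𝒜 up up Z ≫ cross 𝒜 up up Z = 𝟙 _ :=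
  (tail_obComp 𝒜 (tail_cross 𝒜 []) (tail_cross 𝒜 [])).symm.trans
    (((OB 𝒜).tail_of_rel OBRel.cross_cross Z).trans ((OB 𝒜).tail_id _ Z))

theorem braid_up (Z : (OB 𝒜).Cat) :
    cross 𝒜 up up ((F 𝒜 up).obj Z) ≫ (F 𝒜 up).map (cross 𝒜 up up Z) ≫
        cross 𝒜 up up ((F 𝒜 up).obj Z) =
      (F 𝒜 up).map (cross 𝒜 up up Z) ≫ cross 𝒜 up up ((F 𝒜 up).obj Z) ≫
        (F 𝒜 up).map (cross 𝒜 up up Z) :=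
  (tail_obComp 𝒜 (tail_cross 𝒜 [up]) (tail_obComp 𝒜 (tail_cons 𝒜 up (tail_cross 𝒜 []))
    (tail_cross 𝒜 [up]))).symm.trans (((OB 𝒜).tail_of_rel OBRel.braid Z).trans
      (tail_obComp 𝒜 (tail_cons 𝒜 up (tail_cross 𝒜 [])) (tail_obComp 𝒜 (tail_cross 𝒜 [up])
        (tail_cons 𝒜 up (tail_cross 𝒜 [])))))

theorem rotate (b : OBOb) (Z : (OB 𝒜).Cat) : cross 𝒜 down b Z =
    (F 𝒜 down).map ((F 𝒜 b).map (leftCup 𝒜 Z)) ≫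
      (F 𝒜 down).map (cross 𝒜 b up ((F 𝒜 down).obj Z)) ≫
        leftCap 𝒜 ((F 𝒜 b).obj ((F 𝒜 down).obj Z)) := by
  -- Both crossings starting with `↓` are defined as left rotations, `leftCross` of the upward
  -- crossing and `leftDownCross` of `leftCross`, so the formula only has to be read off.
  cases b
  · exact tail_obComp 𝒜 (tail_cons 𝒜 down (tail_cons 𝒜 up (tail_leftCup 𝒜 [])))
      (tail_obComp 𝒜 (tail_cons 𝒜 down (tail_cross 𝒜 [down])) (tail_leftCap 𝒜 [up, down]))
  · exact tail_obComp 𝒜 (tail_cons 𝒜 down (tail_cons 𝒜 down (tail_leftCup 𝒜 [])))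
      (tail_obComp 𝒜 (tail_whisker 𝒜 down down (leftCross 𝒜)) (tail_leftCap 𝒜 [down, down]))

theorem up_down_eq (Z : (OB 𝒜).Cat) : cross 𝒜 up down Z =
    rightCup 𝒜 ((F 𝒜 up).obj ((F 𝒜 down).obj Z)) ≫
      (F 𝒜 down).map (cross 𝒜 up up ((F 𝒜 down).obj Z)) ≫
        (F 𝒜 down).map ((F 𝒜 up).map (rightCap 𝒜 Z)) :=
  tail_obComp 𝒜 (tail_rightCup 𝒜 [up, down]) (tail_obComp 𝒜 (tail_cons 𝒜 down (tail_cross 𝒜 [down]))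
    (tail_cons 𝒜 down (tail_cons 𝒜 up (tail_rightCap 𝒜 []))))

theorem up_down (Z : (OB 𝒜).Cat) : cross 𝒜 up down Z ≫ cross 𝒜 down up Z = 𝟙 _ :=
  (tail_obComp 𝒜 rfl rfl).symm.trans
    (((OB 𝒜).tail_of_rel OBRel.rightCross_leftCross Z).trans ((OB 𝒜).tail_id _ Z))

theorem down_up (Z : (OB 𝒜).Cat) : cross 𝒜 down up Z ≫ cross 𝒜 up down Z = 𝟙 _ :=
  (tail_obComp 𝒜 rfl rfl).symm.trans
    (((OB 𝒜).tail_of_rel OBRel.leftCross_rightCross Z).trans ((OB 𝒜).tail_id _ Z))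

theorem left_curl (Z : (OB 𝒜).Cat) : rightCup 𝒜 ((F 𝒜 up).obj Z) ≫
    (F 𝒜 down).map (cross 𝒜 up up Z) ≫ leftCap 𝒜 ((F 𝒜 up).obj Z) = 𝟙 _ :=
  (tail_obComp 𝒜 (tail_rightCup 𝒜 [up]) (tail_obComp 𝒜 (tail_cons 𝒜 down (tail_cross 𝒜 []))
    (tail_leftCap 𝒜 [up]))).symm.trans
    (((OB 𝒜).tail_of_rel OBRel.left_curl Z).trans ((OB 𝒜).tail_id _ Z))

theorem right_curl (Z : (OB 𝒜).Cat) : (F 𝒜 up).map (leftCup 𝒜 Z) ≫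
    cross 𝒜 up up ((F 𝒜 down).obj Z) ≫ (F 𝒜 up).map (rightCap 𝒜 Z) = 𝟙 _ :=
  (tail_obComp 𝒜 (tail_cons 𝒜 up (tail_leftCup 𝒜 [])) (tail_obComp 𝒜 (tail_cross 𝒜 [down])
    (tail_cons 𝒜 up (tail_rightCap 𝒜 [])))).symm.trans
    (((OB 𝒜).tail_of_rel OBRel.right_curl Z).trans ((OB 𝒜).tail_id _ Z))

/-- The crossings, left cap and left cup of the oriented Brauer supercategory. -/
def dual : DualCrossing (OB 𝒜).Cat where
  F := F 𝒜
  x := cross 𝒜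
  cap := leftCap 𝒜
  cup := leftCup 𝒜
  x_nat := cross_nat 𝒜
  cap_nat := leftCap_nat 𝒜
  cup_nat := leftCup_nat 𝒜
  zigzag_down := zigzag_down 𝒜
  zigzag_up := zigzag_up 𝒜
  up_up := cross_cross 𝒜
  braid_up := braid_up 𝒜
  rotate := rotate 𝒜
  up_down := up_down 𝒜
  down_up := down_up 𝒜

theorem rightCup_nat {Z Z' : (OB 𝒜).Cat} (g : Z ⟶ Z') :
    rightCup 𝒜 Z ≫ (F 𝒜 down).map ((F 𝒜 up).map g) = g ≫ rightCup 𝒜 Z' :=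
  (OB 𝒜).genTail_natural (S := OBSig 𝒜) OBGen.rightCup g

/-- Expand the `↑ ↓` crossing. The left cap moves past the right cap by naturality and closes a left
curl, which is the identity; only the right cap is left. -/
theorem capR_eq (Z : (OB 𝒜).Cat) : (dual 𝒜).capR Z = rightCap 𝒜 Z := by
  change cross 𝒜 up down Z ≫ leftCap 𝒜 Z = rightCap 𝒜 Z
  rw [up_down_eq, Category.assoc, Category.assoc, ← leftCap_nat, reassoc_of% (left_curl 𝒜)]

/-- The reflected argument, with the right curl in place of the left one. -/
theorem cupR_eq (Z : (OB 𝒜).Cat) : (dual 𝒜).cupR Z = rightCup 𝒜 Z := by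
  change leftCup 𝒜 Z ≫ cross 𝒜 up down Z = rightCup 𝒜 Z
  rw [up_down_eq, ← Category.assoc, ← rightCup_nat, Category.assoc, ← Functor.map_comp,
    ← Functor.map_comp, right_curl]
  exact ((congrArg (rightCup 𝒜 Z ≫ ·) (CategoryTheory.Functor.map_id _ _)).trans (Category.comp_id _))

theorem tail_downCross (Z : (OB 𝒜).Cat) :
    (OB 𝒜).tail (downCross 𝒜) Z = cross 𝒜 down down Z := by
  have h : (OB 𝒜).tail (downCross 𝒜) Z =
      rightCup 𝒜 ((F 𝒜 down).obj ((F 𝒜 down).obj Z)) ≫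
        (F 𝒜 down).map (cross 𝒜 up down ((F 𝒜 down).obj Z)) ≫
          (F 𝒜 down).map ((F 𝒜 down).map (rightCap 𝒜 Z)) :=
    tail_obComp 𝒜 (tail_rightCup 𝒜 [down, down]) (tail_obComp 𝒜
      (tail_whisker 𝒜 down down (rightCross 𝒜))
      (tail_cons 𝒜 down (tail_cons 𝒜 down (tail_rightCap 𝒜 []))))
  have e := (dual 𝒜).down_down_eq Z
  rw [cupR_eq, capR_eq] at e
  exact h.trans e

/-- Tokens of the oriented Brauer supercategory. -/
def token {p : ZMod 2} (a : 𝒜 p) : (dual 𝒜).Token where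
  t := tok 𝒜 a
  nat_x b c Z := by
    have h := (OB 𝒜).genTail_exchange (S := OBSig 𝒜) (OBGen.tok a)
      ((OB 𝒜).tail_mem (obCross_mem 𝒜 b c) Z)
    rw [mul_zero, sgn_zero, one_smul] at h
    exact h.symm
  nat_cap Z := by
    have h := (OB 𝒜).genTail_exchange (S := OBSig 𝒜) (OBGen.tok a)
      ((OB 𝒜).genTail_mem (S := OBSig 𝒜) OBGen.leftCap Z)
    rw [mul_zero, sgn_zero, one_smul] at h
    exact h.symm
  cross Z :=
    (tail_obComp 𝒜 (tail_tok 𝒜 a [up]) (tail_cross 𝒜 [])).symm.trans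
      (((OB 𝒜).tail_of_rel (OBRel.tok_cross a) Z).trans
        (tail_obComp 𝒜 (tail_cross 𝒜 []) (tail_cons 𝒜 up (tail_tok 𝒜 a []))))

theorem tail_downTok {p : ZMod 2} (a : 𝒜 p) (Z : (OB 𝒜).Cat) :
    (OB 𝒜).tail (downTok 𝒜 a) Z = (token 𝒜 a).td Z := by
  have h : (OB 𝒜).tail (downTok 𝒜 a) Z = rightCup 𝒜 ((F 𝒜 down).obj Z) ≫
      (F 𝒜 down).map (tok 𝒜 a ((F 𝒜 down).obj Z)) ≫ (F 𝒜 down).map (rightCap 𝒜 Z) :=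
    tail_obComp 𝒜 (tail_rightCup 𝒜 [down]) (tail_obComp 𝒜
      (tail_cons 𝒜 down (tail_tok 𝒜 a [down])) (tail_cons 𝒜 down (tail_rightCap 𝒜 [])))
  have e : (token 𝒜 a).td Z = (dual 𝒜).cupR ((F 𝒜 down).obj Z) ≫
      (F 𝒜 down).map (tok 𝒜 a ((F 𝒜 down).obj Z)) ≫ (F 𝒜 down).map ((dual 𝒜).capR Z) := rfl
  rw [cupR_eq, capR_eq] at e
  exact h.trans e.symm

theorem tok_one (Z : (OB 𝒜).Cat) : tok 𝒜 (homOne 𝒜) Z = 𝟙 _ :=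
  (tail_tok 𝒜 _ []).symm.trans
    (((OB 𝒜).tail_of_rel OBRel.tok_one Z).trans ((OB 𝒜).tail_id _ Z))

theorem tok_add {p : ZMod 2} (a b : 𝒜 p) (Z : (OB 𝒜).Cat) :
    tok 𝒜 (a + b) Z = tok 𝒜 a Z + tok 𝒜 b Z :=
  (tail_tok 𝒜 _ []).symm.trans
    (((OB 𝒜).tail_of_rel (OBRel.tok_add a b) Z).trans (((OB 𝒜).tail_add _ _ Z).trans
      (congrArg₂ (· + ·) (tail_tok 𝒜 a []) (tail_tok 𝒜 b []))))

theorem tok_smul {p : ZMod 2} (c : k) (a : 𝒜 p) (Z : (OB 𝒜).Cat) :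
    tok 𝒜 (c • a) Z = c • tok 𝒜 a Z :=
  (tail_tok 𝒜 _ []).symm.trans
    (((OB 𝒜).tail_of_rel (OBRel.tok_smul c a) Z).trans (((OB 𝒜).tail_smul _ _ Z).trans
      (congrArg (c • ·) (tail_tok 𝒜 a []))))

theorem tok_mul {p q : ZMod 2} (a : 𝒜 p) (b : 𝒜 q) (Z : (OB 𝒜).Cat) :
    tok 𝒜 b Z ≫ tok 𝒜 a Z = tok 𝒜 (homMul 𝒜 a b) Z :=
  (tail_obComp 𝒜 (tail_tok 𝒜 b []) (tail_tok 𝒜 a [])).symm.trans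
    (((OB 𝒜).tail_of_rel (OBRel.tok_mul a b) Z).trans (tail_tok 𝒜 _ []))

end OB

end orientedBrauer

/-! ### Components of morphisms in the additive envelope -/

namespace AddEnv

section single

variable {C : Type*} [Category C] [Preadditive C]

/-- The formal sum with a single summand. -/
def single (X : C) : AddEnv C := ⟨1, fun _ => X⟩

/-- The `1 × 1` matrix with entry `f`. -/
def singleHom {X Y : C} (f : X ⟶ Y) : single X ⟶ single Y := ⟨fun _ _ => f⟩

theorem idEntry_self {n : ℕ} (X : Fin n → C) (i : Fin n) : idEntry X i i = 𝟙 (X i) :=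
  (dif_pos rfl).trans (eqToHom_refl _ _)

theorem singleHom_id (X : C) : singleHom (𝟙 X) = 𝟙 (single X) := hom_ext fun i j => by
  have h : i = j := Subsingleton.elim (α := Fin 1) _ _
  subst h
  exact (idEntry_self (fun _ : Fin 1 => X) i).symm

theorem singleHom_comp {X Y Z : C} (f : X ⟶ Y) (g : Y ⟶ Z) :
    singleHom (f ≫ g) = singleHom f ≫ singleHom g := hom_ext fun i j => by
  rw [comp_entry]
  exact (Fin.sum_univ_one (fun l : Fin 1 => f ≫ g)).symm

/-- The inclusion of a summand. -/
def incl {n : ℕ} (X : Fin n → C) (i : Fin n) : single (X i) ⟶ (⟨n, X⟩ : AddEnv C) :=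
  ⟨fun _ j => idEntry X i j⟩

/-- The projection to a summand. -/
def proj {n : ℕ} (X : Fin n → C) (i : Fin n) : (⟨n, X⟩ : AddEnv C) ⟶ single (X i) :=
  ⟨fun j _ => idEntry X j i⟩

theorem idEntry_ne {n : ℕ} (X : Fin n → C) {i j : Fin n} (h : i ≠ j) : idEntry X i j = 0 :=
  dif_neg h

theorem sum_entry {X Y : AddEnv C} {ι : Type*} (s : Finset ι) (f : ι → (X ⟶ Y)) (i j) :
    (∑ l ∈ s, f l).entry i j = ∑ l ∈ s, (f l).entry i j :=
  map_sum (AddMonoidHom.mk' (fun f : X ⟶ Y => f.entry i j) fun _ _ => rfl) f s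

/-- This resolution of the identity is the reason why testing on summands suffices. -/
theorem sum_proj_incl {n : ℕ} (X : Fin n → C) :
    ∑ i, proj X i ≫ incl X i = 𝟙 (⟨n, X⟩ : AddEnv C) := hom_ext fun a b => by
  rw [sum_entry, id_entry]
  have h : ∀ i, (proj X i ≫ incl X i).entry a b = idEntry X a i ≫ idEntry X i b := fun i => by
    rw [comp_entry]
    exact Fin.sum_univ_one (fun l : Fin 1 => idEntry X a i ≫ idEntry X i b)
  simp only [h]
  rw [Finset.sum_eq_single a]
  · rw [idEntry_self, Category.id_comp]
  · intro i _ hi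
    rw [idEntry_ne X hi.symm, Limits.zero_comp]
  · intro h
    exact absurd (Finset.mem_univ _) h

theorem incl_comp_entry {n : ℕ} (X : Fin n → C) (i : Fin n) {W : AddEnv C}
    (M : (⟨n, X⟩ : AddEnv C) ⟶ W) (a) (j : Fin W.size) :
    (incl X i ≫ M).entry a j = M.entry i j := by
  rw [comp_entry]
  change ∑ l, idEntry X i l ≫ M.entry l j = _
  rw [Finset.sum_eq_single i]
  · rw [idEntry_self, Category.id_comp]
  · intro l _ hl
    rw [idEntry_ne X hl.symm, Limits.zero_comp]
  · intro h
    exact absurd (Finset.mem_univ _) h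

theorem singleHom_comp_entry {X Y : C} (f : X ⟶ Y) {W : AddEnv C} (M : single Y ⟶ W) (a)
    (j : Fin W.size) : (singleHom f ≫ M).entry a j = f ≫ M.entry (0 : Fin 1) j := by
  rw [comp_entry]
  exact Fin.sum_univ_one (fun l : Fin 1 => f ≫ M.entry l j)

variable (k : Type*) [Field k] [Linear k C]

variable [Supercategory k C]

theorem incl_mem {n : ℕ} (X : Fin n → C) (i : Fin n) :
    incl X i ∈ homParity (k := k) (single (X i)) (⟨n, X⟩ : AddEnv C) 0 :=
  fun _ _ => idEntry_mem k X _ _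

end single

section tensor

variable (k : Type*) [Field k] {C : Type*} [Category C] [Preadditive C] [Linear k C] [Monoid C]
  [StrictMonoidalSupercategory k C]

/-- The summands of a tensor product are numbered lexicographically by one index. The family `G`
records the entries of `M` by pairs, so that picking out a summand is not obstructed by dependent
types. -/
theorem incl_tensor_comp_entry {m n : ℕ} (X : Fin m → C) (Y : Fin n → C) (i : Fin m) (j : Fin n)
    {W : AddEnv C} (M : (⟨m, X⟩ : AddEnv C) * (⟨n, Y⟩ : AddEnv C) ⟶ W) (b : Fin W.size)
    (G : ∀ a a', X a * Y a' ⟶ W.obj b)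
    (hG : ∀ l : Fin (m * n), M.entry l b = G l.divNat l.modNat) (a) :
    (tensorHom (k := k) (incl X i) (incl Y j) ≫ M).entry a b = G i j := by
  rw [comp_entry]
  refine (Finset.sum_congr rfl fun l _ => congrArg _ (hG l)).trans ?_
  refine (sum_divNat_modNat (fun a a' =>
    tensorHom (k := k) (idEntry X i a) (idEntry Y j a') ≫ G a a')).trans ?_
  rw [Finset.sum_eq_single i, Finset.sum_eq_single j]
  · rw [idEntry_self, idEntry_self, StrictMonoidalSupercategory.tensor_id, Category.id_comp]
  · intro l _ hl
    rw [idEntry_ne Y hl.symm, SuperBrauer.tensor_zero, Limits.zero_comp]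
  · intro h
    exact absurd (Finset.mem_univ _) h
  · intro l _ hl
    simp only [idEntry_ne X hl.symm, SuperBrauer.zero_tensor, Limits.zero_comp,
      Finset.sum_const_zero]
  · intro h
    exact absurd (Finset.mem_univ _) h

end tensor

end AddEnv

/-- The morphism `f_r^s : Π^r X ⟶ Π^s Y`. -/
def PiEnv.homMk {C : Type*} [Category C] (r s : ZMod 2) {X Y : C} (f : X ⟶ Y) :
    (⟨r, X⟩ : PiEnv C) ⟶ ⟨s, Y⟩ := PiEnv.Hom.mk f

/-! ### Components of morphisms out of powers of `↑ ⊕ Π^σ ↓` -/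

namespace Bulb

open OBOb FreeHom AddEnv

variable {k : Type w} {A : Type v} [Field k] [Ring A] [Algebra k A]
  (𝒜 : ZMod 2 → Submodule k A) [GradedAlgebra 𝒜] (σ : ZMod 2)

/-- The parity shift of a letter. -/
def pr : OBOb → ZMod 2
  | up => 0
  | down => σ

/-- The parity shift of a word. -/
def par : List OBOb → ZMod 2
  | [] => 0
  | a :: w => pr σ a + par w

/-- The summand with label `a`. -/
def letter (a : OBOb) : PiEnv (OB 𝒜).Cat := ⟨pr σ a, ⟨[a]⟩⟩

/-- The inclusion of the summand with label `a`. -/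
def letterIncl : ∀ a : OBOb, single (letter 𝒜 σ a) ⟶ dotImage 𝒜 σ
  | up => incl (summand 𝒜 σ) 0
  | down => incl (summand 𝒜 σ) 1

/-- The projection to the summand with label `a`. -/
def letterProj : ∀ a : OBOb, dotImage 𝒜 σ ⟶ single (letter 𝒜 σ a)
  | up => proj (summand 𝒜 σ) 0
  | down => proj (summand 𝒜 σ) 1

theorem letterIncl_mem (a : OBOb) :
    letterIncl 𝒜 σ a ∈ homParity (k := k) (single (letter 𝒜 σ a)) (dotImage 𝒜 σ) 0 := by
  cases a
  · exact incl_mem k (summand 𝒜 σ) 0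
  · exact incl_mem k (summand 𝒜 σ) 1

theorem sum_letterProj_letterIncl :
    letterProj 𝒜 σ up ≫ letterIncl 𝒜 σ up + letterProj 𝒜 σ down ≫ letterIncl 𝒜 σ down =
      𝟙 (dotImage 𝒜 σ) :=
  (Fin.sum_univ_two (fun i => proj (summand 𝒜 σ) i ≫ incl (summand 𝒜 σ) i)).symm.trans
    (sum_proj_incl (summand 𝒜 σ))

/-- The formal sum with the single summand `Π^r Z`, where `r` is the parity shift of `Z`. -/
def shift (Z : (OB 𝒜).Cat) : AddEnv (PiEnv (OB 𝒜).Cat) :=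
  single (⟨par σ (OB.wd 𝒜 Z), Z⟩ : PiEnv (OB 𝒜).Cat)

/-- A morphism as a morphism between shifted objects. -/
def shiftMap {Z Z' : (OB 𝒜).Cat} (f : Z ⟶ Z') : shift 𝒜 σ Z ⟶ shift 𝒜 σ Z' :=
  singleHom (PiEnv.homMk (par σ (OB.wd 𝒜 Z)) (par σ (OB.wd 𝒜 Z')) f)

theorem shiftMap_id (Z : (OB 𝒜).Cat) : shiftMap 𝒜 σ (𝟙 Z) = 𝟙 _ :=
  singleHom_id (⟨par σ (OB.wd 𝒜 Z), Z⟩ : PiEnv (OB 𝒜).Cat)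

theorem shiftMap_comp {X Y Z : (OB 𝒜).Cat} (f : X ⟶ Y) (g : Y ⟶ Z) :
    shiftMap 𝒜 σ (f ≫ g) = shiftMap 𝒜 σ f ≫ shiftMap 𝒜 σ g :=
  singleHom_comp (PiEnv.homMk (par σ (OB.wd 𝒜 X)) (par σ (OB.wd 𝒜 Y)) f)
    (PiEnv.homMk (par σ (OB.wd 𝒜 Y)) (par σ (OB.wd 𝒜 Z)) g)

theorem shiftMap_add {X Y : (OB 𝒜).Cat} (f g : X ⟶ Y) :
    shiftMap 𝒜 σ (f + g) = shiftMap 𝒜 σ f + shiftMap 𝒜 σ g := rfl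

theorem shiftMap_smul {X Y : (OB 𝒜).Cat} (c : k) (f : X ⟶ Y) :
    shiftMap 𝒜 σ (c • f) = c • shiftMap 𝒜 σ f := rfl

theorem shiftMap_zero (X Y : (OB 𝒜).Cat) : shiftMap 𝒜 σ (0 : X ⟶ Y) = 0 := rfl

/-- In the sign of the `Π`-envelope the contribution of the source shift `r` vanishes, since the
right factor is an even identity with equal shifts; what remains is the parity of `φ` times the
shift of `Z`. -/
theorem singleHom_tensor_id {r r' q q' : ZMod 2} {s t : List OBOb} {φ : OBFree 𝒜 s t} {p : ZMod 2}
    (hφ : φ ∈ homog k (OBSig 𝒜) s t p) (Z : (OB 𝒜).Cat) (hq : q = r + par σ (OB.wd 𝒜 Z))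
    (hq' : q' = r' + par σ (OB.wd 𝒜 Z)) :
    HEq (tensorHom (k := k) (singleHom (PiEnv.homMk r r' ((OB 𝒜).ofDiag φ))) (𝟙 (shift 𝒜 σ Z)))
      (sgn k (p * par σ (OB.wd 𝒜 Z)) •
        singleHom (PiEnv.homMk q q' ((OB 𝒜).tail (S := OBSig 𝒜) φ Z))) := by
  subst hq hq'
  rw [← shiftMap_id]
  have e₀ : PiEnv.tensor k (PiEnv.homMk r r' ((OB 𝒜).ofDiag φ))
      (PiEnv.homMk (par σ (OB.wd 𝒜 Z)) (par σ (OB.wd 𝒜 Z)) (𝟙 Z)) = sgn k (p * par σ (OB.wd 𝒜 Z)) •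
        PiEnv.homMk (r + par σ (OB.wd 𝒜 Z)) (r' + par σ (OB.wd 𝒜 Z))
          ((OB 𝒜).tail (S := OBSig 𝒜) φ Z) := by
    refine PiEnv.hom_ext ((PiEnv.tensor_of_mem k (f := PiEnv.homMk r r' ((OB 𝒜).ofDiag φ))
      (g := PiEnv.homMk (par σ (OB.wd 𝒜 Z)) (par σ (OB.wd 𝒜 Z)) (𝟙 Z))
      ((OB 𝒜).ofDiag_mem hφ) (Supercategory.id_mem (k := k) Z)).trans ?_)
    have e : r * (0 + par σ (OB.wd 𝒜 Z) + par σ (OB.wd 𝒜 Z)) + p * par σ (OB.wd 𝒜 Z) =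
        p * par σ (OB.wd 𝒜 Z) := by
      rw [zero_add, CharTwo.add_self_eq_zero, mul_zero, zero_add]
    exact congrArg₂ (fun x y => sgn k x • y) e
      ((OB 𝒜).ofDiag_tensor_id (S := OBSig 𝒜) (OB.wd 𝒜 Z) φ)
  exact heq_of_eq (congrArg (fun g => singleHom g) e₀)

/-- Add a letter to a morphism out of a shifted word. -/
def cons (a : OBOb) {Z : (OB 𝒜).Cat} {Y : AddEnv (PiEnv (OB 𝒜).Cat)} (h : shift 𝒜 σ Z ⟶ Y) :
    shift 𝒜 σ ((OB.F 𝒜 a).obj Z) ⟶ dotImage 𝒜 σ * Y :=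
  tensorHom (k := k) (letterIncl 𝒜 σ a) h

section cons

variable {Z Z' : (OB 𝒜).Cat} {Y Y' : AddEnv (PiEnv (OB 𝒜).Cat)}

theorem cons_mem (a : OBOb) {h : shift 𝒜 σ Z ⟶ Y}
    (hh : h ∈ homParity (k := k) (shift 𝒜 σ Z) Y 0) :
    cons 𝒜 σ a h ∈ homParity (k := k) (shift 𝒜 σ ((OB.F 𝒜 a).obj Z)) (dotImage 𝒜 σ * Y) 0 :=
  StrictMonoidalSupercategory.tensor_mem (k := k) (letterIncl_mem 𝒜 σ a) hh

theorem cons_smul (a : OBOb) (c : k) (h : shift 𝒜 σ Z ⟶ Y) :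
    cons 𝒜 σ a (c • h) = c • cons 𝒜 σ a h := StrictMonoidalSupercategory.tensor_smul _ _ _

theorem cons_add (a : OBOb) (h h' : shift 𝒜 σ Z ⟶ Y) :
    cons 𝒜 σ a (h + h') = cons 𝒜 σ a h + cons 𝒜 σ a h' :=
  StrictMonoidalSupercategory.tensor_add _ _ _

theorem cons_comp (a : OBOb) (h : shift 𝒜 σ Z ⟶ Y) (φ : Y ⟶ Y') :
    cons 𝒜 σ a h ≫ tensorHom (k := k) (𝟙 (dotImage 𝒜 σ)) φ = cons 𝒜 σ a (h ≫ φ) :=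
  (interchange_even_left k _ _ _ _ (letterIncl_mem 𝒜 σ a)).trans
    (congrArg (tensorHom (k := k) · (h ≫ φ)) (Category.comp_id _))

/-- The Koszul rule: `p + par Z' + par Z` is the parity of `f` as a morphism between shifted
objects, and the sign arises from moving it past the shift of the letter `a`. -/
theorem cons_shiftMap_comp (a : OBOb) {f : Z' ⟶ Z} {p : ZMod 2}
    (hf : f ∈ homParity (k := k) Z' Z p) (h : shift 𝒜 σ Z ⟶ Y) :
    cons 𝒜 σ a (shiftMap 𝒜 σ f ≫ h) =
      sgn k (pr σ a * (p + par σ (OB.wd 𝒜 Z') + par σ (OB.wd 𝒜 Z))) •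
        shiftMap 𝒜 σ ((OB.F 𝒜 a).map f) ≫ cons 𝒜 σ a h := by
  have e : tensorHom (k := k) (𝟙 (single (letter 𝒜 σ a))) (shiftMap 𝒜 σ f) =
      sgn k (pr σ a * (p + par σ (OB.wd 𝒜 Z') + par σ (OB.wd 𝒜 Z))) •
        (shiftMap 𝒜 σ ((OB.F 𝒜 a).map f) : shift 𝒜 σ ((OB.F 𝒜 a).obj Z') ⟶
          shift 𝒜 σ ((OB.F 𝒜 a).obj Z)) := by
    have e₀ : PiEnv.tensor k (𝟙 (letter 𝒜 σ a))
        (PiEnv.homMk (par σ (OB.wd 𝒜 Z')) (par σ (OB.wd 𝒜 Z)) f) =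
          sgn k (pr σ a * (p + par σ (OB.wd 𝒜 Z') + par σ (OB.wd 𝒜 Z))) •
            PiEnv.homMk (pr σ a + par σ (OB.wd 𝒜 Z')) (pr σ a + par σ (OB.wd 𝒜 Z))
              ((OB.F 𝒜 a).map f) := by
      refine PiEnv.hom_ext ?_
      refine (PiEnv.tensor_of_mem k (f := 𝟙 (letter 𝒜 σ a))
        (g := PiEnv.homMk (par σ (OB.wd 𝒜 Z')) (par σ (OB.wd 𝒜 Z)) f)
        (Supercategory.id_mem (k := k) _) hf).trans ?_
      refine congrArg₂ (fun x y => sgn k x • y) ?_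
        ((OB 𝒜).consF_map_eq_tensor (S := OBSig 𝒜) a f).symm
      rw [zero_mul, add_zero]
      rfl
    rw [← singleHom_id]
    exact congrArg (fun g => singleHom g) e₀
  have e' := interchange_even_left k (𝟙 (single (letter 𝒜 σ a))) (letterIncl 𝒜 σ a)
    (shiftMap 𝒜 σ f) h (Supercategory.id_mem (k := k) _)
  rw [Category.id_comp, e] at e'
  exact e'.symm.trans (Linear.smul_comp _ _ _ _ _ _)

end cons

end Bulb

section heq

variable (k : Type*) [Field k] {E : Type*} [Category E] [Preadditive E] [Linear k E]
  [Monoid E] [StrictMonoidalSupercategory k E]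

theorem add_heq_add {X Y X' Y' : E} {f g : X ⟶ Y} {f' g' : X' ⟶ Y'} (hX : X = X') (hY : Y = Y')
    (hf : HEq f f') (hg : HEq g g') : HEq (f + g) (f' + g') := by
  subst hX hY
  cases hf; cases hg; rfl

/-- How a component identity for a generator acquires further strands on the right: the inclusion
`h` of those strands is even, so the square tensors without sign. -/
theorem comp_tensor_even {X₁ X₂ S T J Y : E} {U₁ : S ⟶ X₁} {M : X₁ ⟶ X₂} {c : S ⟶ T} {U₂ : T ⟶ X₂}
    (e : U₁ ≫ M = c ≫ U₂) {h : J ⟶ Y} (hh : h ∈ homParity (k := k) J Y 0) :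
    tensorHom (k := k) U₁ h ≫ tensorHom (k := k) M (𝟙 Y) =
      tensorHom (k := k) c (𝟙 J) ≫ tensorHom (k := k) U₂ h := by
  rw [interchange_even_right k _ _ _ _ (Supercategory.id_mem _), interchange_even_right k _ _ _ _ hh,
    e, Category.comp_id, Category.id_comp]

end heq

namespace AddEnv

variable (k : Type*) [Field k] {C : Type*} [Category C] [Preadditive C] [Linear k C] [Monoid C]
  [StrictMonoidalSupercategory k C]

/-- A row with a single nonzero entry factors through the inclusion of the corresponding summand. -/
theorem entry_eq_comp_incl_tensor {m n : ℕ} {W : C} (X : Fin m → C) (Y : Fin n → C) (c : Fin m)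
    (d : Fin n) (f : W ⟶ X c * Y d) (H : ∀ c' d', W ⟶ X c' * Y d') (h : H c d = f)
    (h' : ∀ c' d', c ≠ c' ∨ d ≠ d' → H c' d' = 0) (c' d') :
    H c' d' = f ≫ tensorHom (k := k) (idEntry X c c') (idEntry Y d d') := by
  by_cases hc : c = c'
  · subst hc
    by_cases hd : d = d'
    · subst hd
      rw [idEntry_self, idEntry_self, StrictMonoidalSupercategory.tensor_id, Category.comp_id, h]
    · rw [idEntry_ne Y hd, SuperBrauer.tensor_zero, Limits.comp_zero, h' _ _ (Or.inr hd)]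
  · rw [idEntry_ne X hc, SuperBrauer.zero_tensor, Limits.comp_zero, h' _ _ (Or.inl hc)]

theorem incl_tensor_comp_eq {m n m' n' : ℕ} (X : Fin m → C) (Y : Fin n → C) (X' : Fin m' → C)
    (Y' : Fin n' → C) (i : Fin m) (j : Fin n) (c : Fin m') (d : Fin n')
    (G : ∀ a b c d, X a * Y b ⟶ X' c * Y' d)
    (M : (⟨m, X⟩ : AddEnv C) * (⟨n, Y⟩ : AddEnv C) ⟶ (⟨m', X'⟩ : AddEnv C) * (⟨n', Y'⟩ : AddEnv C))
    (hM : ∀ (l : Fin (m * n)) (l' : Fin (m' * n')),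
      M.entry l l' = G l.divNat l.modNat l'.divNat l'.modNat)
    (f : X i * Y j ⟶ X' c * Y' d) (h : G i j c d = f)
    (h' : ∀ c' d', c ≠ c' ∨ d ≠ d' → G i j c' d' = 0) :
    tensorHom (k := k) (incl X i) (incl Y j) ≫ M =
      singleHom f ≫ tensorHom (k := k) (incl X' c) (incl Y' d) := hom_ext fun a b => by
  refine (incl_tensor_comp_entry k X Y i j M b
    (fun a a' => G a a' (Fin.divNat (m := m') (n := n') b) (Fin.modNat (m := m') (n := n') b))
    (fun l => hM l b) a).trans ?_
  exact (entry_eq_comp_incl_tensor k X' Y' c d f (G i j) h h' _ _).trans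
    (singleHom_comp_entry f (tensorHom (k := k) (incl X' c) (incl Y' d)) a b).symm

end AddEnv

/-! ### The images of the generators, restricted to single summands. -/

namespace Bulb

open OBOb FreeHom AddEnv

section generators

variable {k : Type w} {A : Type v} [Field k] [Ring A] [Algebra k A]
  {𝒜 : ZMod 2 → Submodule k A} [GradedAlgebra 𝒜] (inv : AntiInvolution 𝒜) (σ : ZMod 2)

variable (𝒜) in
/-- The image of the crossing, tensored with the identity of `Y`. -/
def crossE (Y : AddEnv (PiEnv (OB 𝒜).Cat)) :
    dotImage 𝒜 σ * (dotImage 𝒜 σ * Y) ⟶ dotImage 𝒜 σ * (dotImage 𝒜 σ * Y) :=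
  eqToHom (mul_assoc _ _ _).symm ≫ tensorHom (k := k) (crossImage 𝒜 σ) (𝟙 Y) ≫
    eqToHom (mul_assoc _ _ _)

variable (𝒜) in
/-- The image of the cap, tensored with the identity of `Y`. -/
def capE (Y : AddEnv (PiEnv (OB 𝒜).Cat)) : dotImage 𝒜 σ * (dotImage 𝒜 σ * Y) ⟶ Y :=
  eqToHom (mul_assoc _ _ _).symm ≫ tensorHom (k := k) (capImage 𝒜 σ) (𝟙 Y) ≫
    eqToHom (one_mul _)

variable (𝒜) in
/-- The image of the cup, tensored with the identity of `Y`. -/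
def cupE (Y : AddEnv (PiEnv (OB 𝒜).Cat)) : Y ⟶ dotImage 𝒜 σ * (dotImage 𝒜 σ * Y) :=
  eqToHom (one_mul _).symm ≫ tensorHom (k := k) (cupImage 𝒜 σ) (𝟙 Y) ≫
    eqToHom (mul_assoc _ _ _)

/-- The image of a token, tensored with the identity of `Y`. -/
def tokE {p : ZMod 2} (a : 𝒜 p) (Y : AddEnv (PiEnv (OB 𝒜).Cat)) :
    dotImage 𝒜 σ * Y ⟶ dotImage 𝒜 σ * Y :=
  tensorHom (k := k) (tokImage inv σ a) (𝟙 Y)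

variable (𝒜)

/-- The crossings whose multiples are the components of the image of the crossing. -/
def diagCross : ∀ a b : OBOb, OBFree 𝒜 [a, b] [b, a]
  | up, up => obLayer 𝒜 [] .cross []
  | up, down => rightCross 𝒜
  | down, up => leftCross 𝒜
  | down, down => downCross 𝒜

/-- The components of the image of the cap. -/
def diagCap : ∀ a b : OBOb, OBFree 𝒜 [a, b] []
  | up, down => obLayer 𝒜 [] .rightCap []
  | down, up => obLayer 𝒜 [] .leftCap []
  | up, up => 0
  | down, down => 0

/-- The components of the cap, tensored with identities on the right. -/
def cap : ∀ (a b : OBOb) (Z : (OB 𝒜).Cat), (OB.F 𝒜 a).obj ((OB.F 𝒜 b).obj Z) ⟶ Z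
  | up, down, Z => OB.rightCap 𝒜 Z
  | down, up, Z => OB.leftCap 𝒜 Z
  | up, up, _ => 0
  | down, down, _ => 0

variable {𝒜}

/-- The components of the image of a token. -/
def diagTok {p : ZMod 2} (a : 𝒜 p) : ∀ c : OBOb, OBFree 𝒜 [c] [c]
  | up => obLayer 𝒜 [] (.tok a) []
  | down => sgn k (σ * p) • downTok 𝒜 (inv.app a)

/-- The components of a token, tensored with identities on the right. -/
def tok {p : ZMod 2} (a : 𝒜 p) : ∀ (c : OBOb) (Z : (OB 𝒜).Cat),
    (OB.F 𝒜 c).obj Z ⟶ (OB.F 𝒜 c).obj Z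
  | up, Z => OB.tok 𝒜 a Z
  | down, Z => (OB.token 𝒜 (inv.app a)).td Z

theorem downCross_mem : downCross 𝒜 ∈ homog k (OBSig 𝒜) [down, down] [down, down] 0 :=
  comp_even (obLayer_mem 𝒜 _ _ _) (comp_even
    (whiskerL_mem_homog _ (whiskerR_mem_homog _ (rightCross_mem 𝒜))) (obLayer_mem 𝒜 _ _ _) rfl) rfl

theorem diagCross_mem (a b : OBOb) : diagCross 𝒜 a b ∈ homog k (OBSig 𝒜) [a, b] [b, a] 0 := by
  cases a <;> cases b
  exacts [obLayer_mem 𝒜 _ _ _, rightCross_mem 𝒜, leftCross_mem 𝒜, downCross_mem]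

theorem diagCap_mem (a b : OBOb) : diagCap 𝒜 a b ∈ homog k (OBSig 𝒜) [a, b] [] 0 := by
  cases a <;> cases b
  exacts [Submodule.zero_mem _, obLayer_mem 𝒜 _ _ _, obLayer_mem 𝒜 _ _ _, Submodule.zero_mem _]

theorem downTok_mem {p : ZMod 2} (a : 𝒜 p) : downTok 𝒜 a ∈ homog k (OBSig 𝒜) [down] [down] p :=
  comp_even (obLayer_mem 𝒜 _ _ _) (comp_even (obLayer_mem 𝒜 _ _ _) (obLayer_mem 𝒜 _ _ _)
    (add_zero p)) (zero_add p)

theorem diagTok_mem {p : ZMod 2} (a : 𝒜 p) (c : OBOb) :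
    diagTok inv σ a c ∈ homog k (OBSig 𝒜) [c] [c] p := by
  cases c
  exacts [obLayer_mem 𝒜 _ _ _, Submodule.smul_mem _ _ (downTok_mem _)]

theorem tail_diagCross (a b : OBOb) (Z : (OB 𝒜).Cat) :
    (OB 𝒜).tail (S := OBSig 𝒜) (diagCross 𝒜 a b) Z = OB.cross 𝒜 a b Z := by
  cases a <;> cases b
  exacts [rfl, rfl, rfl, OB.tail_downCross 𝒜 Z]

theorem tail_diagCap (a b : OBOb) (Z : (OB 𝒜).Cat) :
    (OB 𝒜).tail (S := OBSig 𝒜) (diagCap 𝒜 a b) Z = cap 𝒜 a b Z := by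
  cases a <;> cases b
  exacts [congrArg (OB 𝒜).mkHom (_root_.map_zero _), OB.tail_rightCap 𝒜 [], OB.tail_leftCap 𝒜 [],
    congrArg (OB 𝒜).mkHom (_root_.map_zero _)]

/-- The sign `(-1)^(σ p)` prescribed on `↓`, and its absence on `↑`, are both the sign of `p` times
the shift of the letter. -/
theorem tail_diagTok {p : ZMod 2} (a : 𝒜 p) (c : OBOb) (Z : (OB 𝒜).Cat) :
    (OB 𝒜).tail (S := OBSig 𝒜) (diagTok inv σ a c) Z = sgn k (p * pr σ c) • tok inv a c Z := by
  cases c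
  · refine (OB.tail_tok 𝒜 a []).trans ?_
    rw [pr, mul_zero, sgn_zero, one_smul]
    rfl
  · refine ((OB 𝒜).tail_smul (S := OBSig 𝒜) _ _ Z).trans ?_
    rw [OB.tail_downTok, mul_comm]
    rfl

end generators

section components

variable {k : Type w} {A : Type v} [Field k] [Ring A] [Algebra k A]
  (𝒜 : ZMod 2 → Submodule k A) [GradedAlgebra 𝒜] (inv : AntiInvolution 𝒜) (σ : ZMod 2)

/-- The prescribed sign `(-1)^σ` on `↓ ↓` fits the uniform Koszul sign of exchanging two shifted
letters, because `σ * σ = σ`. -/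
theorem letterIncl_tensor_crossImage (a b : OBOb) :
    tensorHom (k := k) (letterIncl 𝒜 σ a) (letterIncl 𝒜 σ b) ≫ crossImage 𝒜 σ =
      singleHom (PiEnv.homMk (pr σ a + pr σ b) (pr σ b + pr σ a)
        ((OB 𝒜).ofDiag (sgn k (pr σ a * pr σ b) • diagCross 𝒜 a b))) ≫
      tensorHom (k := k) (letterIncl 𝒜 σ b) (letterIncl 𝒜 σ a) := by
  have key : ∀ (i j : Fin 2) (f : summand 𝒜 σ i * summand 𝒜 σ j ⟶ summand 𝒜 σ j * summand 𝒜 σ i)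
      (_ : crossEntry 𝒜 σ i j j i = f)
      (_ : ∀ c' d', j ≠ c' ∨ i ≠ d' → crossEntry 𝒜 σ i j c' d' = 0),
      tensorHom (k := k) (incl (summand 𝒜 σ) i) (incl (summand 𝒜 σ) j) ≫ crossImage 𝒜 σ =
        singleHom f ≫ tensorHom (k := k) (incl (summand 𝒜 σ) j) (incl (summand 𝒜 σ) i) :=
    fun i j f h h' => incl_tensor_comp_eq k _ _ _ _ i j j i (crossEntry 𝒜 σ) (crossImage 𝒜 σ)
      (fun _ _ => rfl) f h h'
  cases a <;> cases b
  · refine key 0 0 _ ?_ ?_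
    · refine PiEnv.hom_ext ?_
      have e : sgn k (pr σ up * pr σ up) = 1 := by rw [pr, mul_zero, sgn_zero]
      rw [e]
      exact (congrArg (OB 𝒜).ofDiag (one_smul k (diagCross 𝒜 up up))).symm
    · intro c d
      fin_cases c <;> fin_cases d <;> intro h <;> first | rfl | simp at h
  · refine key 0 1 _ ?_ ?_
    · refine PiEnv.hom_ext ?_
      have e : sgn k (pr σ up * pr σ down) = 1 := by rw [pr, zero_mul, sgn_zero]
      rw [e]
      exact (congrArg (OB 𝒜).ofDiag (one_smul k (diagCross 𝒜 up down))).symm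
    · intro c d
      fin_cases c <;> fin_cases d <;> intro h <;> first | rfl | simp at h
  · refine key 1 0 _ ?_ ?_
    · refine PiEnv.hom_ext ?_
      have e : sgn k (pr σ down * pr σ up) = 1 := by rw [pr, pr, mul_zero, sgn_zero]
      rw [e]
      exact (congrArg (OB 𝒜).ofDiag (one_smul k (diagCross 𝒜 down up))).symm
    · intro c d
      fin_cases c <;> fin_cases d <;> intro h <;> first | rfl | simp at h
  · refine key 1 1 _ ?_ ?_
    · refine PiEnv.hom_ext ?_
      have e : sgn k (pr σ down * pr σ down) = sgn k σ := by
        rw [pr]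
        rcases zmod_two_cases σ with rfl | rfl <;> simp
      rw [e]
      rfl
    · intro c d
      fin_cases c <;> fin_cases d <;> intro h <;> first | rfl | simp at h

theorem letterIncl_tensor_capImage (a b : OBOb) :
    tensorHom (k := k) (letterIncl 𝒜 σ a) (letterIncl 𝒜 σ b) ≫ capImage 𝒜 σ =
      singleHom (PiEnv.homMk (pr σ a + pr σ b) 0 ((OB 𝒜).ofDiag (diagCap 𝒜 a b))) := by
  have key : ∀ (i j : Fin 2) (f : summand 𝒜 σ i * summand 𝒜 σ j ⟶ 1) (_ : capEntry 𝒜 σ i j = f),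
      tensorHom (k := k) (incl (summand 𝒜 σ) i) (incl (summand 𝒜 σ) j) ≫ capImage 𝒜 σ =
        singleHom f := fun i j f h => hom_ext fun a b =>
    (incl_tensor_comp_entry k (summand 𝒜 σ) (summand 𝒜 σ) i j (capImage 𝒜 σ) b (capEntry 𝒜 σ)
      (fun _ => rfl) a).trans h
  cases a <;> cases b
  · exact key 0 0 _ rfl
  · exact key 0 1 _ rfl
  · exact key 1 0 _ rfl
  · exact key 1 1 _ rfl

theorem cupImage_eq : cupImage 𝒜 σ =
    singleHom (PiEnv.homMk 0 (pr σ up + pr σ down)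
        ((OB 𝒜).ofDiag (X := []) (Y := [up, down]) (obLayer 𝒜 [] .leftCup []))) ≫
      tensorHom (k := k) (letterIncl 𝒜 σ up) (letterIncl 𝒜 σ down) +
    singleHom (PiEnv.homMk 0 (pr σ down + pr σ up) (sgn k σ •
        (OB 𝒜).ofDiag (X := []) (Y := [down, up]) (obLayer 𝒜 [] .rightCup []))) ≫
      tensorHom (k := k) (letterIncl 𝒜 σ down) (letterIncl 𝒜 σ up) := by
  have key : ∀ c' d' : Fin 2, cupEntry 𝒜 σ c' d' =
      cupEntry 𝒜 σ 0 1 ≫ tensorHom (k := k) (idEntry (summand 𝒜 σ) 0 c')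
        (idEntry (summand 𝒜 σ) 1 d') +
      cupEntry 𝒜 σ 1 0 ≫ tensorHom (k := k) (idEntry (summand 𝒜 σ) 1 c')
        (idEntry (summand 𝒜 σ) 0 d') := by
    intro c' d'
    -- The cup has two nonzero entries, so it is split into two families with one nonzero entry
    -- each.
    rw [← entry_eq_comp_incl_tensor k (summand 𝒜 σ) (summand 𝒜 σ) 0 1 (cupEntry 𝒜 σ 0 1)
        (fun c d => if c = 0 ∧ d = 1 then cupEntry 𝒜 σ c d else 0) (if_pos ⟨rfl, rfl⟩)
        (fun c d h => if_neg fun h' => h.elim (fun g => g h'.1.symm) (fun g => g h'.2.symm)),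
      ← entry_eq_comp_incl_tensor k (summand 𝒜 σ) (summand 𝒜 σ) 1 0 (cupEntry 𝒜 σ 1 0)
        (fun c d => if c = 1 ∧ d = 0 then cupEntry 𝒜 σ c d else 0) (if_pos ⟨rfl, rfl⟩)
        (fun c d h => if_neg fun h' => h.elim (fun g => g h'.1.symm) (fun g => g h'.2.symm))]
    fin_cases c' <;> fin_cases d' <;> simp
    all_goals rfl
  refine hom_ext fun a b => (key (Fin.divNat (m := 2) (n := 2) b)
    (Fin.modNat (m := 2) (n := 2) b)).trans (congrArg₂ (· + ·) ?_ ?_)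
  · exact (singleHom_comp_entry (cupEntry 𝒜 σ 0 1)
      (tensorHom (k := k) (incl (summand 𝒜 σ) 0) (incl (summand 𝒜 σ) 1)) a b).symm
  · exact (singleHom_comp_entry (cupEntry 𝒜 σ 1 0)
      (tensorHom (k := k) (incl (summand 𝒜 σ) 1) (incl (summand 𝒜 σ) 0)) a b).symm

theorem letterIncl_tokImage {p : ZMod 2} (a : 𝒜 p) (c : OBOb) :
    letterIncl 𝒜 σ c ≫ tokImage inv σ a =
      singleHom (PiEnv.homMk (pr σ c) (pr σ c) ((OB 𝒜).ofDiag (diagTok inv σ a c))) ≫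
        letterIncl 𝒜 σ c := by
  have key : ∀ (i : Fin 2) (f : summand 𝒜 σ i ⟶ summand 𝒜 σ i) (_ : tokEntry inv σ a i i = f)
      (_ : ∀ j, i ≠ j → tokEntry inv σ a i j = 0),
      incl (summand 𝒜 σ) i ≫ tokImage inv σ a = singleHom f ≫ incl (summand 𝒜 σ) i := by
    intro i f h h'
    refine hom_ext fun l j => (incl_comp_entry (summand 𝒜 σ) i (tokImage inv σ a) l j).trans
      (Eq.trans ?_ (singleHom_comp_entry f (incl (summand 𝒜 σ) i) l j).symm)
    change tokEntry inv σ a i j = f ≫ idEntry (summand 𝒜 σ) i j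
    by_cases hij : i = j
    · subst hij
      rw [idEntry_self, Category.comp_id, h]
    · rw [idEntry_ne _ hij, Limits.comp_zero]
      exact h' j hij
  cases c
  · refine key 0 _ rfl fun j hj => ?_
    fin_cases j
    exacts [absurd rfl hj, rfl]
  · refine key 1 _ rfl fun j hj => ?_
    fin_cases j
    exacts [rfl, absurd rfl hj]

end components

end Bulb

/-! ### Action of the whiskered images on words in the letters. -/

namespace Bulb

open OBOb FreeHom AddEnv

variable {k : Type w} {A : Type v} [Field k] [Ring A] [Algebra k A]
  (𝒜 : ZMod 2 → Submodule k A) [GradedAlgebra 𝒜] (inv : AntiInvolution 𝒜) (σ : ZMod 2)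

theorem singleHom_tensor_id_even {r r' q q' : ZMod 2} {s t : List OBOb} {φ : OBFree 𝒜 s t}
    (hφ : φ ∈ homog k (OBSig 𝒜) s t 0) (Z : (OB 𝒜).Cat) (hq : q = r + par σ (OB.wd 𝒜 Z))
    (hq' : q' = r' + par σ (OB.wd 𝒜 Z)) :
    HEq (tensorHom (k := k) (singleHom (PiEnv.homMk r r' ((OB 𝒜).ofDiag φ))) (𝟙 (shift 𝒜 σ Z)))
      (singleHom (PiEnv.homMk q q' ((OB 𝒜).tail (S := OBSig 𝒜) φ Z))) := by
  have h := singleHom_tensor_id 𝒜 σ hφ Z hq hq'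
  rw [zero_mul, sgn_zero, one_smul] at h
  exact h

variable {Z : (OB 𝒜).Cat} {Y : AddEnv (PiEnv (OB 𝒜).Cat)} {h : shift 𝒜 σ Z ⟶ Y}

theorem cons_cons_heq (a b : OBOb) (h : shift 𝒜 σ Z ⟶ Y) :
    HEq (cons 𝒜 σ a (cons 𝒜 σ b h))
      (tensorHom (k := k) (tensorHom (k := k) (letterIncl 𝒜 σ a) (letterIncl 𝒜 σ b)) h) :=
  (tensor_assoc_heq k _ _ _).symm

/-- The shifted object `↑ ⊗ Z` or `↓ ⊗ Z` as a tensor product. -/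
theorem shift_cons_cons (a b : OBOb) (Z : (OB 𝒜).Cat) :
    shift 𝒜 σ ((OB.F 𝒜 a).obj ((OB.F 𝒜 b).obj Z)) =
      single (letter 𝒜 σ a) * single (letter 𝒜 σ b) * shift 𝒜 σ Z :=
  (mul_assoc (single (letter 𝒜 σ a)) (single (letter 𝒜 σ b)) (shift 𝒜 σ Z)).symm

/-- The one-summand formula `letterIncl_tensor_crossImage` tensored with the even morphism `h`; all
remaining work is rebracketing. The cap, cup and token formulas below have the same shape. -/
theorem cons_cons_crossE (hh : h ∈ homParity (k := k) (shift 𝒜 σ Z) Y 0) (a b : OBOb) :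
    cons 𝒜 σ a (cons 𝒜 σ b h) ≫ crossE 𝒜 σ Y =
      sgn k (pr σ a * pr σ b) • shiftMap 𝒜 σ (OB.cross 𝒜 a b Z) ≫
        cons 𝒜 σ b (cons 𝒜 σ a h) := by
  have h₁ := comp_tensor_even k (letterIncl_tensor_crossImage 𝒜 σ a b) hh
  have h₂ := singleHom_tensor_id_even 𝒜 σ (r := pr σ a + pr σ b) (r' := pr σ b + pr σ a)
    (Submodule.smul_mem _ (sgn k (pr σ a * pr σ b)) (diagCross_mem (𝒜 := 𝒜) a b)) Z
    (add_assoc _ _ _).symm (add_assoc _ _ _).symm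
  have h₃ : (OB 𝒜).tail (S := OBSig 𝒜) (sgn k (pr σ a * pr σ b) • diagCross 𝒜 a b) Z =
      sgn k (pr σ a * pr σ b) • OB.cross 𝒜 a b Z :=
    ((OB 𝒜).tail_smul (S := OBSig 𝒜) _ _ Z).trans (congrArg _ (tail_diagCross a b Z))
  have h₄ := h₂.trans (heq_of_eq (congrArg (fun f => singleHom (PiEnv.homMk
    (pr σ a + (pr σ b + par σ (OB.wd 𝒜 Z))) (pr σ b + (pr σ a + par σ (OB.wd 𝒜 Z))) f)) h₃))
  refine Eq.trans (eq_of_heq ?_) (Linear.smul_comp (R := k) _ _ _ (sgn k (pr σ a * pr σ b))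
    (shiftMap 𝒜 σ (OB.cross 𝒜 a b Z)) (cons 𝒜 σ b (cons 𝒜 σ a h)))
  refine (comp_heq_comp (shift_cons_cons 𝒜 σ a b Z) (mul_assoc _ _ _).symm (mul_assoc _ _ _).symm
    (cons_cons_heq 𝒜 σ a b h) (conj_heq _ _ _)).trans ((heq_of_eq h₁).trans ?_)
  exact comp_heq_comp (shift_cons_cons 𝒜 σ a b Z).symm (shift_cons_cons 𝒜 σ b a Z).symm
    (mul_assoc _ _ _) h₄ (cons_cons_heq 𝒜 σ b a h).symm

theorem cons_cons_capE (hh : h ∈ homParity (k := k) (shift 𝒜 σ Z) Y 0) (a b : OBOb) :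
    cons 𝒜 σ a (cons 𝒜 σ b h) ≫ capE 𝒜 σ Y = shiftMap 𝒜 σ (cap 𝒜 a b Z) ≫ h := by
  have h₁ := comp_tensor_even k (U₂ := 𝟙 (1 : AddEnv (PiEnv (OB 𝒜).Cat)))
    ((letterIncl_tensor_capImage 𝒜 σ a b).trans (Category.comp_id _).symm) hh
  have h₂ := singleHom_tensor_id_even 𝒜 σ (r := pr σ a + pr σ b) (r' := 0)
    (diagCap_mem (𝒜 := 𝒜) a b) Z (add_assoc _ _ _).symm (zero_add _).symm
  have h₄ := h₂.trans (heq_of_eq (congrArg (fun f => singleHom (PiEnv.homMk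
    (pr σ a + (pr σ b + par σ (OB.wd 𝒜 Z))) (par σ (OB.wd 𝒜 Z)) f)) (tail_diagCap a b Z)))
  refine eq_of_heq ((comp_heq_comp (shift_cons_cons 𝒜 σ a b Z) (mul_assoc _ _ _).symm
    (one_mul _).symm (cons_cons_heq 𝒜 σ a b h) (conj_heq _ _ _)).trans ((heq_of_eq h₁).trans ?_))
  exact comp_heq_comp (shift_cons_cons 𝒜 σ a b Z).symm (one_mul (shift 𝒜 σ Z))
    (one_mul _) h₄ (one_tensor_heq k h)

theorem comp_cupE (hh : h ∈ homParity (k := k) (shift 𝒜 σ Z) Y 0) :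
    h ≫ cupE 𝒜 σ Y = shiftMap 𝒜 σ (OB.leftCup 𝒜 Z) ≫ cons 𝒜 σ up (cons 𝒜 σ down h) +
      sgn k σ • shiftMap 𝒜 σ (OB.rightCup 𝒜 Z) ≫ cons 𝒜 σ down (cons 𝒜 σ up h) := by
  have key : ∀ (a b : OBOb) (φ : OBFree 𝒜 [] [a, b]) (_ : φ ∈ homog k (OBSig 𝒜) [] [a, b] 0),
      HEq (tensorHom (k := k) (singleHom (PiEnv.homMk 0 (pr σ a + pr σ b) ((OB 𝒜).ofDiag φ)) ≫
          tensorHom (k := k) (letterIncl 𝒜 σ a) (letterIncl 𝒜 σ b)) h)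
        (shiftMap 𝒜 σ (Z := Z) (Z' := (OB.F 𝒜 a).obj ((OB.F 𝒜 b).obj Z))
          ((OB 𝒜).tail (S := OBSig 𝒜) φ Z) ≫ cons 𝒜 σ a (cons 𝒜 σ b h)) := by
    intro a b φ hφ
    have h₂ := singleHom_tensor_id_even 𝒜 σ (r := 0) (r' := pr σ a + pr σ b) hφ Z
      (zero_add _).symm (add_assoc _ _ _).symm
    have h₁ := interchange_even_right k
      (singleHom (PiEnv.homMk 0 (pr σ a + pr σ b) ((OB 𝒜).ofDiag φ)))
      (tensorHom (k := k) (letterIncl 𝒜 σ a) (letterIncl 𝒜 σ b)) (𝟙 _) h hh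
    rw [Category.id_comp] at h₁
    refine (heq_of_eq h₁.symm).trans ?_
    exact comp_heq_comp (one_mul (shift 𝒜 σ Z)) (shift_cons_cons 𝒜 σ a b Z).symm
      (mul_assoc _ _ _) h₂ (cons_cons_heq 𝒜 σ a b h).symm
  have k₁ := key up down (obLayer 𝒜 [] .leftCup []) (obLayer_mem 𝒜 _ _ _)
  have k₂ := key down up (sgn k σ • obLayer 𝒜 [] .rightCup [])
    (Submodule.smul_mem _ _ (obLayer_mem 𝒜 _ _ _))
  have e₁ : (OB 𝒜).tail (S := OBSig 𝒜) (obLayer 𝒜 [] .leftCup []) Z = OB.leftCup 𝒜 Z :=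
    OB.tail_leftCup 𝒜 []
  have e₂ : (OB 𝒜).tail (S := OBSig 𝒜) (sgn k σ • obLayer 𝒜 [] .rightCup []) Z =
      sgn k σ • OB.rightCup 𝒜 Z :=
    ((OB 𝒜).tail_smul (S := OBSig 𝒜) _ _ Z).trans (congrArg _ (OB.tail_rightCup 𝒜 []))
  -- The strand to the right is absorbed first: composing `h` with `1 ⊗ cup` gives the tensor
  -- product of the cup with `h`, as the identity of the unit object is even.
  have h₀ : HEq (h ≫ cupE 𝒜 σ Y) (tensorHom (k := k) (cupImage 𝒜 σ) h) := by
    have e := interchange_even_left k (𝟙 (1 : AddEnv (PiEnv (OB 𝒜).Cat))) (cupImage 𝒜 σ) h (𝟙 Y)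
      (Supercategory.id_mem _)
    rw [Category.id_comp, Category.comp_id] at e
    refine HEq.trans ?_ (heq_of_eq e)
    exact comp_heq_comp (one_mul _).symm (one_mul _).symm (mul_assoc _ _ _).symm
      (one_tensor_heq k h).symm (conj_heq _ _ _)
  have h₁ := StrictMonoidalSupercategory.add_tensor (k := k)
    (singleHom (PiEnv.homMk 0 (pr σ up + pr σ down)
        ((OB 𝒜).ofDiag (X := []) (Y := [up, down]) (obLayer 𝒜 [] .leftCup []))) ≫
      tensorHom (k := k) (letterIncl 𝒜 σ up) (letterIncl 𝒜 σ down))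
    (singleHom (PiEnv.homMk 0 (pr σ down + pr σ up) (sgn k σ •
        (OB 𝒜).ofDiag (X := []) (Y := [down, up]) (obLayer 𝒜 [] .rightCup []))) ≫
      tensorHom (k := k) (letterIncl 𝒜 σ down) (letterIncl 𝒜 σ up)) h
  have h₂ : tensorHom (k := k) (cupImage 𝒜 σ) h = _ :=
    (congrArg (tensorHom (k := k) · h) (cupImage_eq 𝒜 σ)).trans h₁
  refine Eq.trans (eq_of_heq (h₀.trans ((heq_of_eq h₂).trans (add_heq_add (one_mul (shift 𝒜 σ Z))
    (mul_assoc _ _ _) k₁ k₂)))) ?_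
  refine congrArg₂ (· + ·) (congrArg (fun f => shiftMap 𝒜 σ f ≫ cons 𝒜 σ up (cons 𝒜 σ down h)) e₁)
    ((congrArg (fun f => shiftMap 𝒜 σ f ≫ cons 𝒜 σ down (cons 𝒜 σ up h)) e₂).trans ?_)
  exact Linear.smul_comp (R := k) _ _ _ (sgn k σ) (shiftMap 𝒜 σ (OB.rightCup 𝒜 Z))
    (cons 𝒜 σ down (cons 𝒜 σ up h))

/-- The sign has two sources: `p * pr σ c` is prescribed in the image of the token, and `p * par σ
Z` comes from tensoring with the shifted strands to the right. -/
theorem cons_tokE (hh : h ∈ homParity (k := k) (shift 𝒜 σ Z) Y 0) {p : ZMod 2} (a : 𝒜 p)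
    (c : OBOb) :
    cons 𝒜 σ c h ≫ tokE inv σ a Y =
      sgn k (p * (pr σ c + par σ (OB.wd 𝒜 Z))) • shiftMap 𝒜 σ (tok inv a c Z) ≫
        cons 𝒜 σ c h := by
  have h₁ := comp_tensor_even k (letterIncl_tokImage 𝒜 inv σ a c) hh
  have h₂ := eq_of_heq (singleHom_tensor_id 𝒜 σ (r := pr σ c) (r' := pr σ c)
    (q := pr σ c + par σ (OB.wd 𝒜 Z))
    (q' := pr σ c + par σ (OB.wd 𝒜 Z)) (diagTok_mem inv σ a c) Z rfl rfl)
  replace h₂ := h₂.trans (congrArg (fun f => sgn k (p * par σ (OB.wd 𝒜 Z)) • singleHom (PiEnv.homMk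
    (pr σ c + par σ (OB.wd 𝒜 Z)) (pr σ c + par σ (OB.wd 𝒜 Z)) f)) (tail_diagTok inv σ a c Z))
  refine h₁.trans ((congrArg (· ≫ cons 𝒜 σ c h) h₂).trans ?_)
  refine (Linear.smul_comp (R := k) _ _ _ _ _ _).trans ?_
  refine (congrArg _ (Linear.smul_comp (R := k) _ _ _ (sgn k (p * pr σ c))
    (shiftMap 𝒜 σ (tok inv a c Z)) (cons 𝒜 σ c h))).trans ?_
  have e : sgn k (p * par σ (OB.wd 𝒜 Z)) * sgn k (p * pr σ c) =
      sgn k (p * (pr σ c + par σ (OB.wd 𝒜 Z))) := by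
    rw [← sgn_add, mul_add, add_comm]
  exact (smul_smul _ _ _).trans (congrArg (fun s : k => s • _) e)

/-! ### Joint faithfulness of the components -/

theorem hom_ext_of_closure {E : Type*} [Category E] [Preadditive E] {Y T : E} {S : Set (Y ⟶ Y)}
    (hS : 𝟙 Y ∈ AddSubgroup.closure S) {f g : Y ⟶ T} (H : ∀ m ∈ S, m ≫ f = m ≫ g) : f = g := by
  have key : ∀ m ∈ AddSubgroup.closure S, m ≫ f = m ≫ g := by
    intro m hm
    induction hm using AddSubgroup.closure_induction with
    | mem m hm => exact H m hm
    | zero => simp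
    | add m m' _ _ h h' => rw [Preadditive.add_comp, Preadditive.add_comp, h, h']
    | neg m _ h => rw [Preadditive.neg_comp, Preadditive.neg_comp, h]
  simpa using key _ hS

/-- A predicate on the morphisms from shifted objects to `Y`. -/
abbrev Tests (Y : AddEnv (PiEnv (OB 𝒜).Cat)) := ∀ Z : (OB 𝒜).Cat, (shift 𝒜 σ Z ⟶ Y) → Prop

/-- The even morphisms from shifted objects. -/
def Even (Y : AddEnv (PiEnv (OB 𝒜).Cat)) : Tests 𝒜 σ Y :=
  fun Z h => h ∈ homParity (k := k) (shift 𝒜 σ Z) Y 0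

/-- The morphisms obtained by adding a letter. -/
inductive Cons (P : Tests 𝒜 σ Y) : Tests 𝒜 σ (dotImage 𝒜 σ * Y)
  | mk (a : OBOb) (Z : (OB 𝒜).Cat) (h : shift 𝒜 σ Z ⟶ Y) (hh : P Z h) :
      Cons P ((OB.F 𝒜 a).obj Z) (cons 𝒜 σ a h)

theorem Cons.le_even {P : Tests 𝒜 σ Y} (hP : P ≤ Even 𝒜 σ Y) : Cons 𝒜 σ P ≤ Even 𝒜 σ _ := by
  rintro _ _ ⟨a, Z, h, hh⟩
  exact cons_mem 𝒜 σ a (hP Z h hh)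

/-- The morphisms satisfying `P` generate the identity of `Y`. -/
def Generated (P : Tests 𝒜 σ Y) : Prop :=
  𝟙 Y ∈ AddSubgroup.closure {m : Y ⟶ Y | ∃ (Z : (OB 𝒜).Cat) (q : Y ⟶ shift 𝒜 σ Z)
    (h : shift 𝒜 σ Z ⟶ Y), P Z h ∧ m = q ≫ h}

variable {𝒜 σ}

theorem Generated.one : Generated 𝒜 σ (Even 𝒜 σ 1) :=
  AddSubgroup.subset_closure ⟨⟨[]⟩, 𝟙 _, 𝟙 _, Supercategory.id_mem _, (Category.comp_id _).symm⟩

/-- Tensor the decomposition of the identity of `↑ ⊕ Π^σ ↓` into its two summands with a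
decomposition of the identity of `Y`. -/
theorem Generated.cons {P : Tests 𝒜 σ Y} (hY : Generated 𝒜 σ P) (hP : P ≤ Even 𝒜 σ Y) :
    Generated 𝒜 σ (Cons 𝒜 σ P) := by
  have key : ∀ (a : OBOb) (m : Y ⟶ Y) (_ : m ∈ AddSubgroup.closure {m : Y ⟶ Y |
      ∃ (Z : (OB 𝒜).Cat) (q : Y ⟶ shift 𝒜 σ Z) (h : shift 𝒜 σ Z ⟶ Y), P Z h ∧ m = q ≫ h}),
      tensorHom (k := k) (letterProj 𝒜 σ a ≫ letterIncl 𝒜 σ a) m ∈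
        AddSubgroup.closure {m : dotImage 𝒜 σ * Y ⟶ dotImage 𝒜 σ * Y | ∃ (Z : (OB 𝒜).Cat)
          (q : dotImage 𝒜 σ * Y ⟶ shift 𝒜 σ Z) (h : shift 𝒜 σ Z ⟶ dotImage 𝒜 σ * Y),
          Cons 𝒜 σ P Z h ∧ m = q ≫ h} := by
    intro a m hm
    let t : (Y ⟶ Y) →+ (dotImage 𝒜 σ * Y ⟶ dotImage 𝒜 σ * Y) :=
      AddMonoidHom.mk' (fun m => tensorHom (k := k) (letterProj 𝒜 σ a ≫ letterIncl 𝒜 σ a) m)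
        (fun m m' => StrictMonoidalSupercategory.tensor_add _ m m')
    refine (AddSubgroup.closure_le (K := (AddSubgroup.closure _).comap t)).2 ?_ hm
    rintro _ ⟨Z, q, h, hh, rfl⟩
    refine AddSubgroup.subset_closure ⟨(OB.F 𝒜 a).obj Z, tensorHom (k := k) (letterProj 𝒜 σ a) q, _,
      Cons.mk a Z h hh, ?_⟩
    -- A tensor product of factorizations is a factorization of the tensor product; evenness of the
    -- tests is needed here to avoid a sign.
    exact (interchange_even_right k _ _ _ _ (hP Z h hh)).symm
  rw [Generated, ← StrictMonoidalSupercategory.tensor_id (k := k), ← sum_letterProj_letterIncl,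
    StrictMonoidalSupercategory.add_tensor]
  exact AddSubgroup.add_mem _ (key up _ hY) (key down _ hY)

theorem Generated.hom_ext {P : Tests 𝒜 σ Y} (hY : Generated 𝒜 σ P)
    {T : AddEnv (PiEnv (OB 𝒜).Cat)} {f g : Y ⟶ T} (H : ∀ Z h, P Z h → h ≫ f = h ≫ g) : f = g := by
  refine hom_ext_of_closure hY ?_
  rintro _ ⟨Z, q, h, hh, rfl⟩
  rw [Category.assoc, Category.assoc, H Z h hh]

section ext

variable {T : AddEnv (PiEnv (OB 𝒜).Cat)}

/-- Morphisms out of `↑ ⊕ Π^σ ↓` are determined by their components. -/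
theorem hom_ext_one {f g : dotImage 𝒜 σ * 1 ⟶ T}
    (H : ∀ (a : OBOb) (Z : (OB 𝒜).Cat) (h : shift 𝒜 σ Z ⟶ 1), Even 𝒜 σ 1 Z h →
      cons 𝒜 σ a h ≫ f = cons 𝒜 σ a h ≫ g) : f = g := by
  refine (Generated.one.cons le_rfl).hom_ext ?_
  rintro _ _ ⟨a, Z, h, hh⟩
  exact H a Z h hh

/-- Morphisms out of the square of `↑ ⊕ Π^σ ↓` are determined by their components. -/
theorem hom_ext_two {f g : dotImage 𝒜 σ * (dotImage 𝒜 σ * 1) ⟶ T}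
    (H : ∀ (a b : OBOb) (Z : (OB 𝒜).Cat) (h : shift 𝒜 σ Z ⟶ 1), Even 𝒜 σ 1 Z h →
      cons 𝒜 σ a (cons 𝒜 σ b h) ≫ f = cons 𝒜 σ a (cons 𝒜 σ b h) ≫ g) : f = g := by
  refine ((Generated.one.cons le_rfl).cons (Cons.le_even 𝒜 σ le_rfl)).hom_ext ?_
  rintro _ _ ⟨a, _, _, ⟨b, Z, h, hh⟩⟩
  exact H a b Z h hh

/-- Morphisms out of the cube of `↑ ⊕ Π^σ ↓` are determined by their components. -/
theorem hom_ext_three {f g : dotImage 𝒜 σ * (dotImage 𝒜 σ * (dotImage 𝒜 σ * 1)) ⟶ T}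
    (H : ∀ (a b c : OBOb) (Z : (OB 𝒜).Cat) (h : shift 𝒜 σ Z ⟶ 1), Even 𝒜 σ 1 Z h →
      cons 𝒜 σ a (cons 𝒜 σ b (cons 𝒜 σ c h)) ≫ f =
        cons 𝒜 σ a (cons 𝒜 σ b (cons 𝒜 σ c h)) ≫ g) : f = g := by
  refine (((Generated.one.cons le_rfl).cons (Cons.le_even 𝒜 σ le_rfl)).cons
    (Cons.le_even 𝒜 σ (Cons.le_even 𝒜 σ le_rfl))).hom_ext ?_
  rintro _ _ ⟨a, _, _, ⟨b, _, _, ⟨c, Z, h, hh⟩⟩⟩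
  exact H a b c Z h hh

end ext

end Bulb

namespace GenData

variable {k : Type w} [Field k] {S : Signature.{u, v}} {E : Type*} [Category E]
  [Preadditive E] [Linear k E] [Monoid E] [StrictMonoidalSupercategory k E] (G : GenData k S E)

theorem map_layer_heq {U V s t X Y : List S.Ob} {p : ZMod 2} (g : S.Gen s t p)
    (hX : X = U ++ (s ++ V)) (hY : Y = U ++ (t ++ V)) :
    HEq (G.map (FreeHom.layer k U g V hX hY)) (tensorHom (k := k) (𝟙 (G.word U))
      (tensorHom (k := k) (G.gen g) (𝟙 (G.word V)))) := by
  have e : G.map (FreeHom.layer k U g V hX hY) = G.layerMap ⟨U, V, s, t, p, g, hX, hY⟩ :=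
    (G.map_single _ _).trans ((one_smul _ _).trans (Category.comp_id _))
  rw [e]
  exact G.layerMap_heq _

theorem map_layer_nil_heq {V s t X Y : List S.Ob} {p : ZMod 2} (g : S.Gen s t p)
    (hX : X = [] ++ (s ++ V)) (hY : Y = [] ++ (t ++ V)) :
    HEq (G.map (FreeHom.layer k [] g V hX hY)) (tensorHom (k := k) (G.gen g) (𝟙 (G.word V))) :=
  (G.map_layer_heq g hX hY).trans (one_tensor_heq k _)

theorem map_layer_singleton_heq (a : S.Ob) {V s t X Y : List S.Ob} {p : ZMod 2} (g : S.Gen s t p)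
    (hX : X = [a] ++ (s ++ V)) (hY : Y = [a] ++ (t ++ V)) :
    HEq (G.map (FreeHom.layer k [a] g V hX hY))
      (tensorHom (k := k) (𝟙 (G.ob a)) (G.map (FreeHom.layer k [] g V rfl rfl))) := by
  have e : G.word [a] = G.ob a := mul_one _
  refine (G.map_layer_heq g hX hY).trans ?_
  exact tensor_heq k e e (objWord_append G.ob s V).symm (objWord_append G.ob t V).symm
    (id_heq_id e) (G.map_layer_nil_heq g rfl rfl).symm

end GenData

/-! ### The images as data for the universal property. -/

namespace Bulb

open OBOb FreeHom AddEnv BrOb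

variable {k : Type w} {A : Type v} [Field k] [Ring A] [Algebra k A]
  {𝒜 : ZMod 2 → Submodule k A} [GradedAlgebra 𝒜] (inv : AntiInvolution 𝒜) (σ : ZMod 2)

/-- The images of the generating morphisms of the Brauer supercategory. -/
def genImage : ∀ {s t : List BrOb} {p : ZMod 2}, BrGen 𝒜 σ s t p →
    (objWord (fun _ : BrOb => dotImage 𝒜 σ) s ⟶ objWord (fun _ : BrOb => dotImage 𝒜 σ) t)
  -- The image of a word ends with the unit object as a factor, so the generators are sent to their
  -- images tensored with the identity of `1`.
  | _, _, _, .cross => crossE 𝒜 σ 1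
  | _, _, _, .cap => capE 𝒜 σ 1
  | _, _, _, .cup => cupE 𝒜 σ 1
  | _, _, _, .tok a => tokE inv σ a 1

theorem homMk_mem {X Y : (OB 𝒜).Cat} {f : X ⟶ Y} {p q : ZMod 2} (r s : ZMod 2)
    (hf : f ∈ homParity (k := k) X Y q) (h : p + (-r + s) = q) :
    PiEnv.homMk r s f ∈ homParity (k := k) (⟨r, X⟩ : PiEnv (OB 𝒜).Cat) ⟨s, Y⟩ p := by
  subst h
  exact hf

theorem crossImage_mem :
    crossImage 𝒜 σ ∈ homParity (k := k) (dotImage 𝒜 σ * dotImage 𝒜 σ)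
      (dotImage 𝒜 σ * dotImage 𝒜 σ) 0 := by
  have key : ∀ a b c d, crossEntry 𝒜 σ a b c d ∈ homParity (k := k)
      (summand 𝒜 σ a * summand 𝒜 σ b) (summand 𝒜 σ c * summand 𝒜 σ d) 0 := by
    intro a b c d
    fin_cases a <;> fin_cases b <;> fin_cases c <;> fin_cases d
    exacts [homMk_mem (0 + 0) (0 + 0) ((OB 𝒜).ofDiag_mem (obLayer_mem 𝒜 _ _ _)) (by ring),
      Submodule.zero_mem _, Submodule.zero_mem _, Submodule.zero_mem _, Submodule.zero_mem _,
      Submodule.zero_mem _,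
      homMk_mem (0 + σ) (σ + 0) ((OB 𝒜).ofDiag_mem (rightCross_mem 𝒜)) (by ring),
      Submodule.zero_mem _, Submodule.zero_mem _,
      homMk_mem (σ + 0) (0 + σ) ((OB 𝒜).ofDiag_mem (leftCross_mem 𝒜)) (by ring),
      Submodule.zero_mem _, Submodule.zero_mem _, Submodule.zero_mem _, Submodule.zero_mem _,
      Submodule.zero_mem _,
      homMk_mem (σ + σ) (σ + σ) (Submodule.smul_mem _ _ ((OB 𝒜).ofDiag_mem downCross_mem)) (by ring)]
  exact fun i j => key _ _ _ _

theorem capImage_mem :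
    capImage 𝒜 σ ∈ homParity (k := k) (dotImage 𝒜 σ * dotImage 𝒜 σ) 1 σ := by
  have key : ∀ a b, capEntry 𝒜 σ a b ∈ homParity (k := k)
      (summand 𝒜 σ a * summand 𝒜 σ b) 1 σ := by
    intro a b
    fin_cases a <;> fin_cases b
    · exact Submodule.zero_mem _
    · exact homMk_mem (0 + σ) 0 ((OB 𝒜).ofDiag_mem (obLayer_mem 𝒜 _ _ _)) (by ring)
    · exact homMk_mem (σ + 0) 0 ((OB 𝒜).ofDiag_mem (obLayer_mem 𝒜 _ _ _)) (by ring)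
    · exact Submodule.zero_mem _
  exact fun i j => key _ _

theorem cupImage_mem :
    cupImage 𝒜 σ ∈ homParity (k := k) 1 (dotImage 𝒜 σ * dotImage 𝒜 σ) σ := by
  have key : ∀ a b, cupEntry 𝒜 σ a b ∈ homParity (k := k) 1
      (summand 𝒜 σ a * summand 𝒜 σ b) σ := by
    intro a b
    fin_cases a <;> fin_cases b
    · exact Submodule.zero_mem _
    · exact homMk_mem 0 (0 + σ) ((OB 𝒜).ofDiag_mem (obLayer_mem 𝒜 _ _ _))
        (by rw [neg_zero, zero_add, zero_add, CharTwo.add_self_eq_zero])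
    · exact homMk_mem 0 (σ + 0) (Submodule.smul_mem _ _ ((OB 𝒜).ofDiag_mem (obLayer_mem 𝒜 _ _ _)))
        (by rw [neg_zero, zero_add, add_zero, CharTwo.add_self_eq_zero])
    · exact Submodule.zero_mem _
  exact fun i j => key _ _

theorem tokImage_mem {p : ZMod 2} (a : 𝒜 p) :
    tokImage inv σ a ∈ homParity (k := k) (dotImage 𝒜 σ) (dotImage 𝒜 σ) p := by
  have key : ∀ i j, tokEntry inv σ a i j ∈ homParity (k := k) (summand 𝒜 σ i) (summand 𝒜 σ j) p := by
    intro i j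
    fin_cases i <;> fin_cases j
    · exact homMk_mem 0 0 ((OB 𝒜).ofDiag_mem (obLayer_mem 𝒜 _ _ _)) (by ring)
    · exact Submodule.zero_mem _
    · exact Submodule.zero_mem _
    · exact homMk_mem σ σ (Submodule.smul_mem _ _ ((OB 𝒜).ofDiag_mem (downTok_mem _))) (by ring)
  exact fun i j => key _ _

theorem tensor_id_mem {E : Type*} [Category E] [Preadditive E] [Linear k E] [Monoid E]
    [StrictMonoidalSupercategory k E] {X Y : E} {f : X ⟶ Y} {p : ZMod 2}
    (hf : f ∈ homParity (k := k) X Y p) (Z : E) :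
    tensorHom (k := k) f (𝟙 Z) ∈ homParity (k := k) (X * Z) (Y * Z) p := by
  have := StrictMonoidalSupercategory.tensor_mem hf (Supercategory.id_mem (k := k) Z)
  rwa [add_zero] at this

theorem crossE_mem (Y : AddEnv (PiEnv (OB 𝒜).Cat)) :
    crossE 𝒜 σ Y ∈ homParity (k := k) (dotImage 𝒜 σ * (dotImage 𝒜 σ * Y))
      (dotImage 𝒜 σ * (dotImage 𝒜 σ * Y)) 0 :=
  conj_mem k _ _ (tensor_id_mem (crossImage_mem σ) Y)

theorem capE_mem (Y : AddEnv (PiEnv (OB 𝒜).Cat)) :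
    capE 𝒜 σ Y ∈ homParity (k := k) (dotImage 𝒜 σ * (dotImage 𝒜 σ * Y)) Y σ :=
  conj_mem k _ _ (tensor_id_mem (capImage_mem σ) Y)

theorem cupE_mem (Y : AddEnv (PiEnv (OB 𝒜).Cat)) :
    cupE 𝒜 σ Y ∈ homParity (k := k) Y (dotImage 𝒜 σ * (dotImage 𝒜 σ * Y)) σ :=
  conj_mem k _ _ (tensor_id_mem (cupImage_mem σ) Y)

theorem genImage_mem : ∀ {s t : List BrOb} {p : ZMod 2} (g : BrGen 𝒜 σ s t p),
    genImage inv σ g ∈ homParity (k := k) (objWord (fun _ : BrOb => dotImage 𝒜 σ) s)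
      (objWord (fun _ : BrOb => dotImage 𝒜 σ) t) p
  | _, _, _, .cross => crossE_mem σ 1
  | _, _, _, .cap => capE_mem σ 1
  | _, _, _, .cup => cupE_mem σ 1
  | _, _, _, .tok a => tensor_id_mem (tokImage_mem inv σ a) 1

/-- The images of the generators of the Brauer supercategory. -/
def genData : GenData k (BrSig 𝒜 σ) (AddEnv (PiEnv (OB 𝒜).Cat)) where
  ob _ := dotImage 𝒜 σ
  gen g := genImage inv σ g
  gen_mem g := genImage_mem inv σ g

section layers

variable (V : List BrOb)

theorem tensor_one_tensor_heq {E : Type*} [Category E] [Preadditive E] [Linear k E] [Monoid E]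
    [StrictMonoidalSupercategory k E] {X Y : E} (f : X ⟶ Y) (Z : E) :
    HEq (tensorHom (k := k) (tensorHom (k := k) f (𝟙 (1 : E))) (𝟙 Z)) (tensorHom (k := k) f (𝟙 Z)) :=
  tensor_heq k (mul_one _) (mul_one _) rfl rfl (tensor_one_heq k f) HEq.rfl

/-- Tensoring with the identity of the unit changes nothing up to transport, so the layer with
further strands on the right is the crossing image tensored once with their identity. -/
theorem map_cross : (genData inv σ).map (brLayer [] .cross V) =
    crossE 𝒜 σ ((genData inv σ).word V) := by
  refine eq_of_heq (((genData inv σ).map_layer_nil_heq (S := BrSig 𝒜 σ) BrGen.cross rfl rfl).trans ?_)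
  refine HEq.trans ?_ (conj_heq _ _ _).symm
  refine HEq.trans ?_ (tensor_one_tensor_heq _ _)
  exact tensor_heq k (mul_assoc _ _ _).symm (mul_assoc _ _ _).symm rfl rfl (conj_heq _ _ _) HEq.rfl

theorem map_cap : (genData inv σ).map (brLayer [] .cap V) =
    capE 𝒜 σ ((genData inv σ).word V) := by
  refine eq_of_heq (((genData inv σ).map_layer_nil_heq (S := BrSig 𝒜 σ) BrGen.cap rfl rfl).trans ?_)
  refine HEq.trans ?_ (conj_heq _ _ _).symm
  refine HEq.trans ?_ (tensor_one_tensor_heq _ _)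
  exact tensor_heq k (mul_assoc _ _ _).symm (one_mul _).symm rfl rfl (conj_heq _ _ _) HEq.rfl

theorem map_cup : (genData inv σ).map (brLayer [] .cup V) =
    cupE 𝒜 σ ((genData inv σ).word V) := by
  refine eq_of_heq (((genData inv σ).map_layer_nil_heq (S := BrSig 𝒜 σ) BrGen.cup rfl rfl).trans ?_)
  refine HEq.trans ?_ (conj_heq _ _ _).symm
  refine HEq.trans ?_ (tensor_one_tensor_heq _ _)
  exact tensor_heq k (one_mul _).symm (mul_assoc _ _ _).symm rfl rfl (conj_heq _ _ _) HEq.rfl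

theorem map_tok {p : ZMod 2} (a : 𝒜 p) : (genData inv σ).map (brLayer [] (.tok a) V) =
    tokE inv σ a ((genData inv σ).word V) :=
  eq_of_heq (((genData inv σ).map_layer_nil_heq (S := BrSig 𝒜 σ) (BrGen.tok a) rfl rfl).trans
    (tensor_one_tensor_heq _ _))

theorem map_dot {s t : List BrOb} {p : ZMod 2} (g : BrGen 𝒜 σ s t p) :
    (genData inv σ).map (brLayer [dot] g V) =
      tensorHom (k := k) (𝟙 (dotImage 𝒜 σ)) ((genData inv σ).map (brLayer [] g V)) :=
  eq_of_heq ((genData inv σ).map_layer_singleton_heq (S := BrSig 𝒜 σ) dot g rfl rfl)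

end layers

end Bulb

/-! ### The algebra of downward tokens -/

section superalgebra

variable {k : Type w} {A : Type v} [Field k] [Ring A] [Algebra k A]
  {𝒜 : ZMod 2 → Submodule k A} [GradedAlgebra 𝒜] (inv : AntiInvolution 𝒜)

namespace AntiInvolution

/-- Apply multiplicativity to the product of `inv 1` and `1`, whose image is `1` by involutivity. -/
theorem toFun_one : inv.toFun 1 = 1 := by
  have h := inv.map_mul (inv.map_mem (SetLike.one_mem_graded 𝒜)) (SetLike.one_mem_graded 𝒜)
  rw [mul_one, inv.involutive, mul_zero, sgn_zero, one_smul, mul_one] at h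
  exact h.symm

end AntiInvolution

end superalgebra

namespace OB

open OBOb FreeHom

variable {k : Type w} {A : Type v} [Field k] [Ring A] [Algebra k A]
  (𝒜 : ZMod 2 → Submodule k A) [GradedAlgebra 𝒜] {Z : (OB 𝒜).Cat}

/-- The downward token, tensored with identities on the right. -/
def dtok {p : ZMod 2} (a : 𝒜 p) (Z : (OB 𝒜).Cat) : (F 𝒜 down).obj Z ⟶ (F 𝒜 down).obj Z :=
  (token 𝒜 a).td Z

theorem tok_mem {p : ZMod 2} (a : 𝒜 p) (Z : (OB 𝒜).Cat) :
    tok 𝒜 a Z ∈ homParity (k := k) ((F 𝒜 up).obj Z) ((F 𝒜 up).obj Z) p :=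
  (OB 𝒜).genTail_mem (S := OBSig 𝒜) (OBGen.tok a) Z

theorem td_mem {p : ZMod 2} (a : 𝒜 p) (Z : (OB 𝒜).Cat) :
    dtok 𝒜 a Z ∈ homParity (k := k) ((F 𝒜 down).obj Z) ((F 𝒜 down).obj Z) p := by
  have h : downTok 𝒜 a ∈ homog k (OBSig 𝒜) [down] [down] p :=
    comp_even (obLayer_mem 𝒜 _ _ _) (comp_even (obLayer_mem 𝒜 _ _ _) (obLayer_mem 𝒜 _ _ _)
      (add_zero p)) (zero_add p)
  have h' := (OB 𝒜).tail_mem (S := OBSig 𝒜) h Z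
  exact Eq.mp (congrArg (fun f : (F 𝒜 down).obj Z ⟶ (F 𝒜 down).obj Z =>
    f ∈ homParity (k := k) ((F 𝒜 down).obj Z) ((F 𝒜 down).obj Z) p) (tail_downTok 𝒜 a Z)) h'

theorem F_map_add (a : OBOb) {X Y : (OB 𝒜).Cat} (f g : X ⟶ Y) :
    (F 𝒜 a).map (f + g) = (F 𝒜 a).map f + (F 𝒜 a).map g :=
  _root_.map_add ((OB 𝒜).homWhiskerL (S := OBSig 𝒜) [a]) f g

theorem F_map_smul (a : OBOb) {X Y : (OB 𝒜).Cat} (c : k) (f : X ⟶ Y) :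
    (F 𝒜 a).map (c • f) = c • (F 𝒜 a).map f := (OB 𝒜).consF_map_smul a c f

theorem hom_down_ext {X : (OB 𝒜).Cat} {f g : X ⟶ (F 𝒜 down).obj Z}
    (h : (F 𝒜 up).map f ≫ rightCap 𝒜 Z = (F 𝒜 up).map g ≫ rightCap 𝒜 Z) : f = g := by
  rw [← capR_eq] at h
  exact (dual 𝒜).hom_down_ext h

theorem td_rightCap {p : ZMod 2} (a : 𝒜 p) (Z : (OB 𝒜).Cat) :
    (F 𝒜 up).map (dtok 𝒜 a Z) ≫ rightCap 𝒜 Z = tok 𝒜 a _ ≫ rightCap 𝒜 Z := by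
  rw [← capR_eq]
  exact (token 𝒜 a).td_capR Z

theorem td_leftCap {p : ZMod 2} (a : 𝒜 p) (Z : (OB 𝒜).Cat) :
    dtok 𝒜 a ((F 𝒜 up).obj Z) ≫ leftCap 𝒜 Z = (F 𝒜 down).map (tok 𝒜 a Z) ≫ leftCap 𝒜 Z :=
  (token 𝒜 a).td_cap Z

/-- Tokens are indexed by a parity together with an element; this compares tokens whose parities are
equal only propositionally, such as `p + q` and `q + p`. -/
theorem td_congr {p q : ZMod 2} {a : 𝒜 p} {b : 𝒜 q} (hpq : p = q) (h : (a : A) = b)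
    (Z : (OB 𝒜).Cat) : dtok 𝒜 a Z = dtok 𝒜 b Z := by
  subst hpq
  obtain rfl : a = b := Subtype.ext h
  rfl

theorem td_one (Z : (OB 𝒜).Cat) : dtok 𝒜 (homOne 𝒜) Z = 𝟙 _ := by
  refine hom_down_ext 𝒜 ?_
  rw [td_rightCap, tok_one]
  exact congrArg (· ≫ rightCap 𝒜 Z) (CategoryTheory.Functor.map_id _ _).symm

theorem td_add {p : ZMod 2} (a b : 𝒜 p) (Z : (OB 𝒜).Cat) :
    dtok 𝒜 (a + b) Z = dtok 𝒜 a Z + dtok 𝒜 b Z := by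
  refine hom_down_ext 𝒜 ?_
  rw [td_rightCap, tok_add, F_map_add, Preadditive.add_comp, Preadditive.add_comp, td_rightCap,
    td_rightCap]

theorem td_smul {p : ZMod 2} (c : k) (a : 𝒜 p) (Z : (OB 𝒜).Cat) :
    dtok 𝒜 (c • a) Z = c • dtok 𝒜 a Z := by
  refine hom_down_ext 𝒜 ?_
  rw [td_rightCap, tok_smul, F_map_smul, Linear.smul_comp, Linear.smul_comp, td_rightCap]

/-- Compare under the right cap, where a downward token becomes an upward token on the other leg.
Passing the second token there requires exchanging it with the first, which produces the sign and
reverses the order of the product. -/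
theorem td_mul {p q : ZMod 2} (a : 𝒜 p) (b : 𝒜 q) (Z : (OB 𝒜).Cat) :
    dtok 𝒜 a Z ≫ dtok 𝒜 b Z = sgn k (p * q) • dtok 𝒜 (homMul 𝒜 a b) Z := by
  refine hom_down_ext 𝒜 ?_
  have e : (F 𝒜 up).map (dtok 𝒜 a Z) ≫ tok 𝒜 b ((F 𝒜 down).obj Z) =
      sgn k (q * p) • tok 𝒜 b ((F 𝒜 down).obj Z) ≫ (F 𝒜 up).map (dtok 𝒜 a Z) := by
    have h : tok 𝒜 b ((F 𝒜 down).obj Z) ≫ (F 𝒜 up).map (dtok 𝒜 a Z) =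
        sgn k (q * p) • (F 𝒜 up).map (dtok 𝒜 a Z) ≫ tok 𝒜 b ((F 𝒜 down).obj Z) :=
      (OB 𝒜).genTail_exchange (S := OBSig 𝒜) (OBGen.tok b) (td_mem 𝒜 a Z)
    rw [h, smul_smul, sgn_self, one_smul]
  rw [F_map_smul, Linear.smul_comp, td_rightCap, ← tok_mul, CategoryTheory.Functor.map_comp,
    Category.assoc, td_rightCap, ← Category.assoc, e, Linear.smul_comp, Category.assoc, td_rightCap,
    Category.assoc, mul_comm]

end OB

/-! ### Tokens on strands of either orientation. -/

namespace Bulb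

open OBOb FreeHom AddEnv BrOb

variable {k : Type w} {A : Type v} [Field k] [Ring A] [Algebra k A]
  {𝒜 : ZMod 2 → Submodule k A} [GradedAlgebra 𝒜] (inv : AntiInvolution 𝒜) (σ : ZMod 2)

theorem tok_mem {p : ZMod 2} (a : 𝒜 p) (c : OBOb) (Z : (OB 𝒜).Cat) :
    tok inv a c Z ∈ homParity (k := k) ((OB.F 𝒜 c).obj Z) ((OB.F 𝒜 c).obj Z) p := by
  cases c
  exacts [OB.tok_mem 𝒜 a Z, OB.td_mem 𝒜 _ Z]

theorem tok_one (c : OBOb) (Z : (OB 𝒜).Cat) : tok inv (homOne 𝒜) c Z = 𝟙 _ := by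
  cases c
  · exact OB.tok_one 𝒜 Z
  · exact (OB.td_congr 𝒜 rfl inv.toFun_one Z).trans (OB.td_one 𝒜 Z)

theorem tok_add {p : ZMod 2} (a b : 𝒜 p) (c : OBOb) (Z : (OB 𝒜).Cat) :
    tok inv (a + b) c Z = tok inv a c Z + tok inv b c Z := by
  cases c
  · exact OB.tok_add 𝒜 a b Z
  · exact (OB.td_congr 𝒜 rfl (map_add inv.toFun _ _) Z).trans (OB.td_add 𝒜 _ _ Z)

theorem tok_smul {p : ZMod 2} (r : k) (a : 𝒜 p) (c : OBOb) (Z : (OB 𝒜).Cat) :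
    tok inv (r • a) c Z = r • tok inv a c Z := by
  cases c
  · exact OB.tok_smul 𝒜 r a Z
  · exact (OB.td_congr 𝒜 rfl (map_smul inv.toFun _ _) Z).trans (OB.td_smul 𝒜 _ _ Z)

theorem tok_mul {p q : ZMod 2} (a : 𝒜 p) (b : 𝒜 q) (c : OBOb) (Z : (OB 𝒜).Cat) :
    tok inv b c Z ≫ tok inv a c Z = tok inv (homMul 𝒜 a b) c Z := by
  cases c
  · exact OB.tok_mul 𝒜 a b Z
  · refine (OB.td_mul 𝒜 (inv.app b) (inv.app a) Z).trans ((OB.td_smul 𝒜 _ _ Z).symm.trans ?_)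
    refine OB.td_congr 𝒜 (add_comm q p) ?_ Z
    -- The sign in the multiplication of downward tokens is the sign in the product rule of the
    -- anti-involution.
    exact ((inv.map_mul a.2 b.2).trans (by rw [mul_comm p q]; rfl)).symm

theorem tok_cross {p : ZMod 2} (a : 𝒜 p) (c d : OBOb) (Z : (OB 𝒜).Cat) :
    tok inv a c ((OB.F 𝒜 d).obj Z) ≫ OB.cross 𝒜 c d Z =
      OB.cross 𝒜 c d Z ≫ (OB.F 𝒜 d).map (tok inv a c Z) := by
  cases c
  · exact (OB.token 𝒜 a).tok_cross up d Z
  · exact (OB.token 𝒜 (inv.app a)).tok_cross down d Z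

theorem tok_cap {p : ZMod 2} (a : 𝒜 p) (c d : OBOb) (Z : (OB 𝒜).Cat) :
    tok inv a c ((OB.F 𝒜 d).obj Z) ≫ cap 𝒜 c d Z =
      (OB.F 𝒜 c).map (tok inv (inv.app a) d Z) ≫ cap 𝒜 c d Z := by
  cases c <;> cases d
  · exact Limits.comp_zero.trans Limits.comp_zero.symm
  · refine (OB.td_rightCap 𝒜 a Z).symm.trans ?_
    -- On `↑ ↓` the second leg carries the downward token of `inv (inv a)`, that is, of `a`.
    exact congrArg (fun f => (OB.F 𝒜 up).map f ≫ OB.rightCap 𝒜 Z)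
      (OB.td_congr 𝒜 rfl (inv.involutive a).symm Z)
  · exact OB.td_leftCap 𝒜 (inv.app a) Z
  · exact Limits.comp_zero.trans Limits.comp_zero.symm

end Bulb

namespace Bulb

open OBOb FreeHom AddEnv BrOb

variable {k : Type w} {A : Type v} [Field k] [Ring A] [Algebra k A]
  {𝒜 : ZMod 2 → Submodule k A} [GradedAlgebra 𝒜] (inv : AntiInvolution 𝒜) (σ : ZMod 2)

theorem mul_self_zmod_two (p : ZMod 2) : p * p = p := by
  revert p; decide

/-! ### Identities between components -/

section identities

variable (Z : (OB 𝒜).Cat)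

theorem F_map_zero (c : OBOb) (X Y : (OB 𝒜).Cat) : (OB.F 𝒜 c).map (0 : X ⟶ Y) = 0 :=
  _root_.map_zero ((OB 𝒜).homWhiskerL (S := OBSig 𝒜) [c])

theorem zigzagR_up : (OB.F 𝒜 up).map (OB.rightCup 𝒜 Z) ≫ OB.rightCap 𝒜 ((OB.F 𝒜 up).obj Z) =
    𝟙 _ := by
  rw [← OB.capR_eq, ← OB.cupR_eq]
  exact (OB.dual 𝒜).zigzagR_up Z

theorem zigzagR_down :
    OB.rightCup 𝒜 ((OB.F 𝒜 down).obj Z) ≫ (OB.F 𝒜 down).map (OB.rightCap 𝒜 Z) = 𝟙 _ := by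
  rw [← OB.capR_eq, ← OB.cupR_eq]
  exact (OB.dual 𝒜).zigzagR_down Z

/-- For opposite orientations this is the expression of one cap through the other and a crossing;
for equal orientations both sides vanish. -/
theorem cross_cap (a b : OBOb) : OB.cross 𝒜 a b Z ≫ cap 𝒜 b a Z = cap 𝒜 a b Z := by
  cases a <;> cases b
  · exact Limits.comp_zero
  · exact OB.capR_eq 𝒜 Z
  · refine (congrArg (OB.cross 𝒜 down up Z ≫ ·) (OB.capR_eq 𝒜 Z).symm).trans ?_
    exact (OB.dual 𝒜).down_up_capR Z
  · exact Limits.comp_zero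

theorem cap_slide (a b c : OBOb) :
    OB.cross 𝒜 a b ((OB.F 𝒜 c).obj Z) ≫ (OB.F 𝒜 b).map (cap 𝒜 a c Z) =
      (OB.F 𝒜 a).map (OB.cross 𝒜 b c Z) ≫ cap 𝒜 a c ((OB.F 𝒜 b).obj Z) := by
  have h₀ : ∀ (W X : (OB 𝒜).Cat) (f : W ⟶ (OB.F 𝒜 b).obj X),
      f ≫ (OB.F 𝒜 b).map (0 : X ⟶ Z) = 0 := fun _ X f =>
    (congrArg (f ≫ ·) (F_map_zero b X Z)).trans Limits.comp_zero
  cases a <;> cases c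
  · exact (h₀ _ _ _).trans Limits.comp_zero.symm
  · refine (congrArg (fun f => OB.cross 𝒜 up b _ ≫ (OB.F 𝒜 b).map f) (OB.capR_eq 𝒜 Z).symm).trans ?_
    refine ((OB.dual 𝒜).capR_slide b Z).trans ?_
    exact congrArg ((OB.F 𝒜 up).map (OB.cross 𝒜 b down Z) ≫ ·) (OB.capR_eq 𝒜 _)
  · exact (OB.dual 𝒜).cap_slide b Z
  · exact (h₀ _ _ _).trans Limits.comp_zero.symm

end identities

/-! ### Transport of components through letters -/

section letters

variable {Z Z' : (OB 𝒜).Cat} {Y T : AddEnv (PiEnv (OB 𝒜).Cat)}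

theorem cross_mem (a b : OBOb) (Z : (OB 𝒜).Cat) : OB.cross 𝒜 a b Z ∈ homParity (k := k)
    ((OB.F 𝒜 a).obj ((OB.F 𝒜 b).obj Z)) ((OB.F 𝒜 b).obj ((OB.F 𝒜 a).obj Z)) 0 :=
  (OB 𝒜).tail_mem (S := OBSig 𝒜) (obCross_mem 𝒜 a b) Z

/-- A crossing is even and preserves the total shift of the word, so it passes letters without sign.
-/
theorem cons_cross (a b c : OBOb)
    (h : shift 𝒜 σ ((OB.F 𝒜 c).obj ((OB.F 𝒜 b).obj Z)) ⟶ Y) :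
    cons 𝒜 σ a (shiftMap 𝒜 σ (OB.cross 𝒜 b c Z) ≫ h) =
      shiftMap 𝒜 σ ((OB.F 𝒜 a).map (OB.cross 𝒜 b c Z)) ≫ cons 𝒜 σ a h := by
  refine (cons_shiftMap_comp 𝒜 σ a (cross_mem b c Z) h).trans ?_
  have e : ∀ p q r z : ZMod 2, p * (0 + (q + (r + z)) + (r + (q + z))) = 0 := by decide
  exact (congrArg (fun s : k => s • _) ((congrArg (sgn k) (e _ _ _ _)).trans sgn_zero)).trans
    (one_smul k _)

/-- A nonzero cap removes one `↑` and one `↓`, hence changes the shift by `σ`; passing the letter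
`c` costs the sign of `pr σ c * σ`. For equal orientations the cap is zero. -/
theorem cons_cap (c a b : OBOb) (h : shift 𝒜 σ Z ⟶ Y) :
    cons 𝒜 σ c (shiftMap 𝒜 σ (cap 𝒜 a b Z) ≫ h) =
      sgn k (pr σ c * σ) • shiftMap 𝒜 σ ((OB.F 𝒜 c).map (cap 𝒜 a b Z)) ≫ cons 𝒜 σ c h := by
  have e₁ : ∀ p q z : ZMod 2, p * (0 + (0 + (q + z)) + z) = p * q := by decide
  have e₂ : ∀ p q z : ZMod 2, p * (0 + (q + (0 + z)) + z) = p * q := by decide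
  have h₀ : ∀ X : (OB 𝒜).Cat, cons 𝒜 σ c (shiftMap 𝒜 σ (0 : X ⟶ Z) ≫ h) =
      sgn k (pr σ c * σ) • shiftMap 𝒜 σ ((OB.F 𝒜 c).map (0 : X ⟶ Z)) ≫ cons 𝒜 σ c h := fun X => by
    rw [F_map_zero, shiftMap_zero, shiftMap_zero, Limits.zero_comp, Limits.zero_comp, smul_zero]
    exact SuperBrauer.tensor_zero k _
  cases a <;> cases b
  · exact h₀ _
  · refine (cons_shiftMap_comp 𝒜 σ c ((OB 𝒜).genTail_mem (S := OBSig 𝒜) OBGen.rightCap Z) h).trans ?_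
    exact congrArg (fun s : k => s • _) (congrArg (sgn k) (e₁ _ _ _))
  · refine (cons_shiftMap_comp 𝒜 σ c ((OB 𝒜).genTail_mem (S := OBSig 𝒜) OBGen.leftCap Z) h).trans ?_
    exact congrArg (fun s : k => s • _) (congrArg (sgn k) (e₂ _ _ _))
  · exact h₀ _

theorem cons_leftCup (c : OBOb) (h : shift 𝒜 σ ((OB.F 𝒜 up).obj ((OB.F 𝒜 down).obj Z)) ⟶ Y) :
    cons 𝒜 σ c (shiftMap 𝒜 σ (OB.leftCup 𝒜 Z) ≫ h) =
      sgn k (pr σ c * σ) • shiftMap 𝒜 σ ((OB.F 𝒜 c).map (OB.leftCup 𝒜 Z)) ≫ cons 𝒜 σ c h := by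
  have e₁ : ∀ p q z : ZMod 2, p * (0 + z + (0 + (q + z))) = p * q := by decide
  refine (cons_shiftMap_comp 𝒜 σ c ((OB 𝒜).genTail_mem (S := OBSig 𝒜) OBGen.leftCup Z) h).trans ?_
  exact congrArg (fun s : k => s • _) (congrArg (sgn k) (e₁ _ _ _))

theorem cons_rightCup (c : OBOb) (h : shift 𝒜 σ ((OB.F 𝒜 down).obj ((OB.F 𝒜 up).obj Z)) ⟶ Y) :
    cons 𝒜 σ c (shiftMap 𝒜 σ (OB.rightCup 𝒜 Z) ≫ h) =
      sgn k (pr σ c * σ) • shiftMap 𝒜 σ ((OB.F 𝒜 c).map (OB.rightCup 𝒜 Z)) ≫ cons 𝒜 σ c h := by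
  have e₁ : ∀ p q z : ZMod 2, p * (0 + z + (q + (0 + z))) = p * q := by decide
  refine (cons_shiftMap_comp 𝒜 σ c ((OB 𝒜).genTail_mem (S := OBSig 𝒜) OBGen.rightCup Z) h).trans ?_
  exact congrArg (fun s : k => s • _) (congrArg (sgn k) (e₁ _ _ _))

theorem cons_tok {p : ZMod 2} (a : 𝒜 p) (c d : OBOb) (h : shift 𝒜 σ ((OB.F 𝒜 d).obj Z) ⟶ Y) :
    cons 𝒜 σ c (shiftMap 𝒜 σ (tok inv a d Z) ≫ h) =
      sgn k (pr σ c * p) • shiftMap 𝒜 σ ((OB.F 𝒜 c).map (tok inv a d Z)) ≫ cons 𝒜 σ c h := by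
  have e : ∀ r p z : ZMod 2, r * (p + z + z) = r * p := by decide
  refine (cons_shiftMap_comp 𝒜 σ c (tok_mem inv a d Z) h).trans ?_
  exact congrArg (fun s : k => s • _) (congrArg (sgn k) (e _ _ _))

theorem shiftMap_comp_comp {X : (OB 𝒜).Cat} (f : X ⟶ Z) (g : Z ⟶ Z') (h : shift 𝒜 σ Z' ⟶ Y) :
    shiftMap 𝒜 σ f ≫ shiftMap 𝒜 σ g ≫ h = shiftMap 𝒜 σ (f ≫ g) ≫ h := by
  rw [shiftMap_comp, Category.assoc]

variable {h : shift 𝒜 σ Z ⟶ Y}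

theorem cons_comp_comp (a : OBOb) (h : shift 𝒜 σ Z ⟶ Y) {Y' : AddEnv (PiEnv (OB 𝒜).Cat)}
    (φ : Y ⟶ Y') (ψ : dotImage 𝒜 σ * Y' ⟶ T) :
    cons 𝒜 σ a h ≫ tensorHom (k := k) (𝟙 (dotImage 𝒜 σ)) φ ≫ ψ = cons 𝒜 σ a (h ≫ φ) ≫ ψ := by
  rw [← Category.assoc, cons_comp]

theorem crossE_comp (hh : h ∈ homParity (k := k) (shift 𝒜 σ Z) Y 0)
    (a b : OBOb) (φ : dotImage 𝒜 σ * (dotImage 𝒜 σ * Y) ⟶ T) :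
    cons 𝒜 σ a (cons 𝒜 σ b h) ≫ crossE 𝒜 σ Y ≫ φ =
      sgn k (pr σ a * pr σ b) • shiftMap 𝒜 σ (OB.cross 𝒜 a b Z) ≫
        cons 𝒜 σ b (cons 𝒜 σ a h) ≫ φ := by
  rw [← Category.assoc, cons_cons_crossE 𝒜 σ hh, Linear.smul_comp, Category.assoc]

theorem cupE_comp (hh : h ∈ homParity (k := k) (shift 𝒜 σ Z) Y 0)
    (φ : dotImage 𝒜 σ * (dotImage 𝒜 σ * Y) ⟶ T) :
    h ≫ cupE 𝒜 σ Y ≫ φ = shiftMap 𝒜 σ (OB.leftCup 𝒜 Z) ≫ cons 𝒜 σ up (cons 𝒜 σ down h) ≫ φ +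
      sgn k σ • shiftMap 𝒜 σ (OB.rightCup 𝒜 Z) ≫ cons 𝒜 σ down (cons 𝒜 σ up h) ≫ φ := by
  rw [← Category.assoc, comp_cupE 𝒜 σ hh, Preadditive.add_comp, Linear.smul_comp, Category.assoc,
    Category.assoc]

theorem tokE_comp (hh : h ∈ homParity (k := k) (shift 𝒜 σ Z) Y 0)
    {p : ZMod 2} (a : 𝒜 p) (c : OBOb) (φ : dotImage 𝒜 σ * Y ⟶ T) :
    cons 𝒜 σ c h ≫ tokE inv σ a Y ≫ φ =
      sgn k (p * (pr σ c + par σ (OB.wd 𝒜 Z))) • shiftMap 𝒜 σ (tok inv a c Z) ≫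
        cons 𝒜 σ c h ≫ φ := by
  rw [← Category.assoc, cons_tokE 𝒜 inv σ hh, Linear.smul_comp, Category.assoc]

end letters

/-! ### The relations of the Brauer supercategory -/

section relations

theorem crossE_crossE : crossE 𝒜 σ 1 ≫ crossE 𝒜 σ 1 = 𝟙 _ := by
  refine hom_ext_two fun a b Z h hh => ?_
  have e : OB.cross 𝒜 a b Z ≫ OB.cross 𝒜 b a Z = 𝟙 _ := (OB.dual 𝒜).x_x a b Z
  rw [← Category.assoc, cons_cons_crossE 𝒜 σ hh, Linear.smul_comp, Category.assoc,
    cons_cons_crossE 𝒜 σ hh, Linear.comp_smul, smul_smul, ← Category.assoc, ← shiftMap_comp, e,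
    shiftMap_id, Category.id_comp, Category.comp_id, mul_comm (pr σ b), sgn_self, one_smul]

theorem crossE_braid :
    crossE 𝒜 σ (dotImage 𝒜 σ * 1) ≫ tensorHom (k := k) (𝟙 (dotImage 𝒜 σ)) (crossE 𝒜 σ 1) ≫
        crossE 𝒜 σ (dotImage 𝒜 σ * 1) =
      tensorHom (k := k) (𝟙 (dotImage 𝒜 σ)) (crossE 𝒜 σ 1) ≫ crossE 𝒜 σ (dotImage 𝒜 σ * 1) ≫
        tensorHom (k := k) (𝟙 (dotImage 𝒜 σ)) (crossE 𝒜 σ 1) := by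
  refine hom_ext_three fun a b c Z h hh => ?_
  have hc := fun d => cons_mem 𝒜 σ d hh
  have e : OB.cross 𝒜 a b ((OB.F 𝒜 c).obj Z) ≫ (OB.F 𝒜 b).map (OB.cross 𝒜 a c Z) ≫
      OB.cross 𝒜 b c ((OB.F 𝒜 a).obj Z) = (OB.F 𝒜 a).map (OB.cross 𝒜 b c Z) ≫
      OB.cross 𝒜 a c ((OB.F 𝒜 b).obj Z) ≫ (OB.F 𝒜 c).map (OB.cross 𝒜 a b Z) :=
    (OB.dual 𝒜).braid a b c Z
  rw [crossE_comp σ (hc c), cons_comp_comp, cons_cons_crossE 𝒜 σ hh, cons_smul, cons_cross,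
    Linear.smul_comp, Category.assoc, cons_cons_crossE 𝒜 σ (hc a), cons_comp_comp,
    cons_cons_crossE 𝒜 σ hh, cons_smul, cons_cross, Linear.smul_comp, Category.assoc,
    crossE_comp σ (hc b), cons_comp, cons_cons_crossE 𝒜 σ hh, cons_smul, cons_cross]
  simp only [Linear.comp_smul, smul_smul, shiftMap_comp_comp]
  -- Both sides carry the sign of the same three pairs of strands, since each pair crosses exactly
  -- once.
  rw [e]
  congr 1
  ring

/-- A letter `↑` selects the left cup and a letter `↓` the right cup, the other summand being killed
by a cap on equal orientations. For `↓` the sign of the cup cancels the sign of the cap passing `↓`.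
-/
theorem cupE_capE : cupE 𝒜 σ (dotImage 𝒜 σ * 1) ≫
    tensorHom (k := k) (𝟙 (dotImage 𝒜 σ)) (capE 𝒜 σ 1) = 𝟙 _ := by
  refine hom_ext_one fun a Z h hh => ?_
  rw [cupE_comp σ (cons_mem 𝒜 σ a hh), cons_comp, cons_comp, cons_cons_capE 𝒜 σ hh,
    cons_cons_capE 𝒜 σ hh, cons_cap, cons_cap]
  simp only [Linear.comp_smul, smul_smul, shiftMap_comp_comp]
  cases a
  · have e₁ : OB.leftCup 𝒜 ((OB.F 𝒜 up).obj Z) ≫ (OB.F 𝒜 up).map (cap 𝒜 down up Z) = 𝟙 _ :=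
      OB.zigzag_up 𝒜 Z
    have e₂ : (OB.F 𝒜 down).map (cap 𝒜 up up Z) = 0 := F_map_zero _ _ _
    rw [e₁, e₂, Limits.comp_zero, shiftMap_zero, Limits.zero_comp, smul_zero, add_zero, shiftMap_id,
      pr, zero_mul, sgn_zero, one_smul, Category.id_comp, Category.comp_id]
  · have e₁ : (OB.F 𝒜 up).map (cap 𝒜 down down Z) = 0 := F_map_zero _ _ _
    have e₂ : OB.rightCup 𝒜 ((OB.F 𝒜 down).obj Z) ≫ (OB.F 𝒜 down).map (cap 𝒜 up down Z) = 𝟙 _ :=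
      zigzagR_down Z
    rw [e₁, e₂, Limits.comp_zero, shiftMap_zero, Limits.zero_comp, smul_zero, zero_add, shiftMap_id,
      pr, mul_self_zmod_two, sgn_self, one_smul, Category.id_comp, Category.comp_id]

/-- For `↑` the external sign cancels the sign of the right cup; for `↓` it cancels the Koszul sign
of the left cup passing the letter. -/
theorem cupE_capE_sign : sgn k σ • tensorHom (k := k) (𝟙 (dotImage 𝒜 σ)) (cupE 𝒜 σ 1) ≫
    capE 𝒜 σ (dotImage 𝒜 σ * 1) = 𝟙 _ := by
  refine hom_ext_one fun a Z h hh => ?_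
  rw [Linear.comp_smul, cons_comp_comp, comp_cupE 𝒜 σ hh, cons_add, cons_smul, cons_leftCup,
    cons_rightCup, Preadditive.add_comp, Linear.smul_comp, Linear.smul_comp, Linear.smul_comp,
    Category.assoc, Category.assoc, cons_cons_capE 𝒜 σ (cons_mem 𝒜 σ _ hh),
    cons_cons_capE 𝒜 σ (cons_mem 𝒜 σ _ hh)]
  simp only [smul_smul, shiftMap_comp_comp, smul_add]
  cases a
  · have e₁ : cap 𝒜 up up ((OB.F 𝒜 down).obj Z) = 0 := rfl
    have e₂ : (OB.F 𝒜 up).map (OB.rightCup 𝒜 Z) ≫ cap 𝒜 up down ((OB.F 𝒜 up).obj Z) = 𝟙 _ :=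
      zigzagR_up Z
    rw [e₁, e₂, Limits.comp_zero, shiftMap_zero, Limits.zero_comp, smul_zero, zero_add, shiftMap_id,
      ← mul_assoc, sgn_self, pr, zero_mul, sgn_zero, one_mul, one_smul, Category.id_comp,
      Category.comp_id]
  · have e₁ : (OB.F 𝒜 down).map (OB.leftCup 𝒜 Z) ≫ cap 𝒜 down up ((OB.F 𝒜 down).obj Z) = 𝟙 _ :=
      OB.zigzag_down 𝒜 Z
    have e₂ : cap 𝒜 down down ((OB.F 𝒜 up).obj Z) = 0 := rfl
    rw [e₁, e₂, Limits.comp_zero, shiftMap_zero, Limits.zero_comp, smul_zero, add_zero, shiftMap_id,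
      pr, mul_self_zmod_two, sgn_self, one_smul, Category.id_comp, Category.comp_id]

/-- The crossing carries a sign only on `↓ ↓`, where the cap vanishes. -/
theorem crossE_capE : crossE 𝒜 σ 1 ≫ capE 𝒜 σ 1 = capE 𝒜 σ 1 := by
  refine hom_ext_two fun a b Z h hh => ?_
  rw [crossE_comp σ hh, cons_cons_capE 𝒜 σ hh, cons_cons_capE 𝒜 σ hh, shiftMap_comp_comp]
  rw [cross_cap]
  cases a <;> cases b
  · rw [pr, mul_zero, sgn_zero, one_smul]
  · rw [pr, zero_mul, sgn_zero, one_smul]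
  · rw [pr, pr, mul_zero, sgn_zero, one_smul]
  · have e : shiftMap 𝒜 σ (cap 𝒜 down down Z) = 0 := rfl
    rw [e, Limits.zero_comp, smul_zero]

theorem crossE_slide_capE : crossE 𝒜 σ (dotImage 𝒜 σ * 1) ≫
      tensorHom (k := k) (𝟙 (dotImage 𝒜 σ)) (capE 𝒜 σ 1) =
    tensorHom (k := k) (𝟙 (dotImage 𝒜 σ)) (crossE 𝒜 σ 1) ≫ capE 𝒜 σ (dotImage 𝒜 σ * 1) := by
  refine hom_ext_three fun a b c Z h hh => ?_
  have hc := fun d => cons_mem 𝒜 σ d hh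
  rw [crossE_comp σ (hc c), cons_comp, cons_cons_capE 𝒜 σ hh, cons_cap, cons_comp_comp,
    cons_cons_crossE 𝒜 σ hh, cons_smul, cons_cross, Linear.smul_comp, Category.assoc,
    cons_cons_capE 𝒜 σ (hc b)]
  simp only [Linear.comp_smul, smul_smul, shiftMap_comp_comp]
  rw [cap_slide, ← sgn_add]
  have h₀ : ∀ a, (OB.F 𝒜 a).map (OB.cross 𝒜 b a Z) ≫ cap 𝒜 a a ((OB.F 𝒜 b).obj Z) = 0 := by
    intro a
    cases a
    exacts [Limits.comp_zero, Limits.comp_zero]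
  -- When the cap is nonzero exactly one of `a`, `c` is `↓`, so `pr σ a + pr σ c = σ`, which makes
  -- the two signs agree; otherwise both sides are zero.
  cases a <;> cases c
  · rw [h₀, shiftMap_zero, Limits.zero_comp, smul_zero, smul_zero]
  · rw [pr, pr, zero_mul, zero_add]
  · rw [pr, pr, mul_zero, mul_comm σ, CharTwo.add_self_eq_zero]
  · rw [h₀, shiftMap_zero, Limits.zero_comp, smul_zero, smul_zero]

theorem tokE_one : tokE inv σ (homOne 𝒜) 1 = 𝟙 _ := by
  refine hom_ext_one fun c Z h hh => ?_
  rw [cons_tokE 𝒜 inv σ hh, tok_one, shiftMap_id, zero_mul, sgn_zero, one_smul, Category.id_comp,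
    Category.comp_id]

theorem tokE_add {p : ZMod 2} (a b : 𝒜 p) :
    tokE inv σ (a + b) 1 = tokE inv σ a 1 + tokE inv σ b 1 := by
  refine hom_ext_one fun c Z h hh => ?_
  rw [Preadditive.comp_add, cons_tokE 𝒜 inv σ hh, cons_tokE 𝒜 inv σ hh, cons_tokE 𝒜 inv σ hh,
    tok_add, shiftMap_add, Preadditive.add_comp, smul_add]

theorem tokE_smul {p : ZMod 2} (r : k) (a : 𝒜 p) :
    tokE inv σ (r • a) 1 = r • tokE inv σ a 1 := by
  refine hom_ext_one fun c Z h hh => ?_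
  rw [Linear.comp_smul, cons_tokE 𝒜 inv σ hh, cons_tokE 𝒜 inv σ hh, tok_smul, shiftMap_smul,
    Linear.smul_comp, smul_comm]

theorem tokE_mul {p q : ZMod 2} (a : 𝒜 p) (b : 𝒜 q) :
    tokE inv σ b 1 ≫ tokE inv σ a 1 = tokE inv σ (homMul 𝒜 a b) 1 := by
  refine hom_ext_one fun c Z h hh => ?_
  rw [tokE_comp inv σ hh, cons_tokE 𝒜 inv σ hh, cons_tokE 𝒜 inv σ hh, Linear.comp_smul, smul_smul,
    shiftMap_comp_comp, tok_mul, ← sgn_add]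
  congr 2
  ring

theorem tokE_crossE {p : ZMod 2} (a : 𝒜 p) :
    tokE inv σ a (dotImage 𝒜 σ * 1) ≫ crossE 𝒜 σ 1 =
      crossE 𝒜 σ 1 ≫ tensorHom (k := k) (𝟙 (dotImage 𝒜 σ)) (tokE inv σ a 1) := by
  refine hom_ext_two fun c d Z h hh => ?_
  rw [tokE_comp inv σ (cons_mem 𝒜 σ _ hh), cons_cons_crossE 𝒜 σ hh, crossE_comp σ hh, cons_comp,
    cons_tokE 𝒜 inv σ hh, cons_smul, cons_tok]
  simp only [Linear.comp_smul, smul_smul, shiftMap_comp_comp, tok_cross, ← sgn_add]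
  congr 2
  -- On the left the token passes the shifts of both letters and of `Z` at once; on the right the
  -- same sign is split between `cons_tokE` and the passage of the letter `d`.
  change p * (pr σ c + (pr σ d + par σ (OB.wd 𝒜 Z))) + _ = _
  ring

theorem tokE_capE {p : ZMod 2} (a : 𝒜 p) :
    tokE inv σ a (dotImage 𝒜 σ * 1) ≫ capE 𝒜 σ 1 =
      tensorHom (k := k) (𝟙 (dotImage 𝒜 σ)) (tokE inv σ (inv.app a) 1) ≫ capE 𝒜 σ 1 := by
  refine hom_ext_two fun c d Z h hh => ?_
  rw [tokE_comp inv σ (cons_mem 𝒜 σ _ hh), cons_cons_capE 𝒜 σ hh, cons_comp_comp,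
    cons_tokE 𝒜 inv σ hh, cons_smul, cons_tok, Linear.smul_comp, Linear.smul_comp, Category.assoc,
    cons_cons_capE 𝒜 σ hh]
  simp only [smul_smul, shiftMap_comp_comp, tok_cap, ← sgn_add]
  congr 2
  change p * (pr σ c + (pr σ d + par σ (OB.wd 𝒜 Z))) = _
  ring

end relations

end Bulb

/-! ### Verification of the relations and the superfunctor `D`. -/

namespace Bulb

open OBOb FreeHom AddEnv BrOb

variable {k : Type w} {A : Type v} [Field k] [Ring A] [Algebra k A]
  {𝒜 : ZMod 2 → Submodule k A} [GradedAlgebra 𝒜] (inv : AntiInvolution 𝒜) (σ : ZMod 2)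

section layers

variable (V : List BrOb)

theorem map_dot_cross : (genData inv σ).map (brLayer [dot] .cross V) =
    tensorHom (k := k) (𝟙 (dotImage 𝒜 σ)) (crossE 𝒜 σ ((genData inv σ).word V)) :=
  (map_dot inv σ V _).trans (congrArg _ (map_cross inv σ V))

theorem map_dot_cap : (genData inv σ).map (brLayer [dot] .cap V) =
    tensorHom (k := k) (𝟙 (dotImage 𝒜 σ)) (capE 𝒜 σ ((genData inv σ).word V)) :=
  (map_dot inv σ V _).trans (congrArg _ (map_cap inv σ V))

theorem map_dot_cup : (genData inv σ).map (brLayer [dot] .cup V) =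
    tensorHom (k := k) (𝟙 (dotImage 𝒜 σ)) (cupE 𝒜 σ ((genData inv σ).word V)) :=
  (map_dot inv σ V _).trans (congrArg _ (map_cup inv σ V))

theorem map_dot_tok {p : ZMod 2} (a : 𝒜 p) : (genData inv σ).map (brLayer [dot] (.tok a) V) =
    tensorHom (k := k) (𝟙 (dotImage 𝒜 σ)) (tokE inv σ a ((genData inv σ).word V)) :=
  (map_dot inv σ V _).trans (congrArg _ (map_tok inv σ V a))

variable {inv σ}

theorem map_brComp {X Y Z : List BrOb} {f : BrFree 𝒜 σ X Y} {g : BrFree 𝒜 σ Y Z}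
    {φ : (genData inv σ).word X ⟶ (genData inv σ).word Y}
    {ψ : (genData inv σ).word Y ⟶ (genData inv σ).word Z} (hf : (genData inv σ).map f = φ)
    (hg : (genData inv σ).map g = ψ) : (genData inv σ).map (brComp f g) = φ ≫ ψ :=
  ((genData inv σ).map_comp f g).trans (by rw [hf, hg])

end layers

set_option maxHeartbeats 2000000 in
/-- The images of the generators satisfy the relations of the Brauer supercategory. -/
theorem genData_respects : (genData inv σ).Respects (Br inv σ) := by
  intro X Y f g h
  have c := map_cross inv σ
  have c' := map_dot_cross inv σ
  have i := (genData inv σ).map_id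
  cases h with
  | cross_cross =>
    exact (map_brComp (c []) (c [])).trans ((crossE_crossE σ).trans (i [dot, dot]).symm)
  | braid =>
    exact (map_brComp (c [dot]) (map_brComp (c' []) (c [dot]))).trans ((crossE_braid σ).trans
      (map_brComp (c' []) (map_brComp (c [dot]) (c' []))).symm)
  | zigzag =>
    exact (map_brComp (map_cup inv σ [dot]) (map_dot_cap inv σ [])).trans ((cupE_capE σ).trans (i [dot]).symm)
  | zigzag_sign =>
    exact (map_smul _ _ _).trans ((congrArg _ (map_brComp (map_dot_cup inv σ []) (map_cap inv σ [dot]))).trans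
      ((cupE_capE_sign σ).trans (i [dot]).symm))
  | cross_cap =>
    exact (map_brComp (c []) (map_cap inv σ [])).trans ((crossE_capE σ).trans (map_cap inv σ []).symm)
  | cross_slide_cap =>
    exact (map_brComp (c [dot]) (map_dot_cap inv σ [])).trans ((crossE_slide_capE σ).trans
      (map_brComp (c' []) (map_cap inv σ [dot])).symm)
  | tok_one => exact (map_tok inv σ [] _).trans ((tokE_one inv σ).trans (i [dot]).symm)
  | tok_add x y =>
    exact (map_tok inv σ [] _).trans ((tokE_add inv σ x y).trans ((map_add _ _ _).trans
      (congrArg₂ (· + ·) (map_tok inv σ [] x) (map_tok inv σ [] y))).symm)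
  | tok_smul r x =>
    exact (map_tok inv σ [] _).trans ((tokE_smul inv σ r x).trans ((map_smul _ _ _).trans
      (congrArg (r • ·) (map_tok inv σ [] x))).symm)
  | tok_mul x y =>
    exact (map_brComp (map_tok inv σ [] y) (map_tok inv σ [] x)).trans ((tokE_mul inv σ x y).trans
      (map_tok inv σ [] _).symm)
  | tok_cross x =>
    exact (map_brComp (map_tok inv σ [dot] x) (c [])).trans ((tokE_crossE inv σ x).trans
      (map_brComp (c []) (map_dot_tok inv σ [] x)).symm)
  | tok_cap x =>
    exact (map_brComp (map_tok inv σ [dot] x) (map_cap inv σ [])).trans ((tokE_capE inv σ x).trans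
      (map_brComp (map_dot_tok inv σ [] _) (map_cap inv σ [])).symm)

/-- The superfunctor `D`. -/
def functor : StrictMonoidalSuperfunctor k (Br inv σ).Cat (AddEnv (PiEnv (OB 𝒜).Cat)) :=
  (genData_respects inv σ).lift

theorem crossE_one_heq : HEq (crossE 𝒜 σ 1) (crossImage 𝒜 σ) :=
  (conj_heq _ _ _).trans (tensor_one_heq k _)

theorem capE_one_heq : HEq (capE 𝒜 σ 1) (capImage 𝒜 σ) :=
  (conj_heq _ _ _).trans (tensor_one_heq k _)

theorem cupE_one_heq : HEq (cupE 𝒜 σ 1) (cupImage 𝒜 σ) :=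
  (conj_heq _ _ _).trans (tensor_one_heq k _)

theorem tokE_one_heq {p : ZMod 2} (a : 𝒜 p) : HEq (tokE inv σ a 1) (tokImage inv σ a) :=
  tensor_one_heq k _

theorem functor_isBulb : IsBulb inv σ (functor inv σ) where
  obj_dot := mul_one (dotImage 𝒜 σ)
  map_cross := eq_conj_of_heq _ _ ((heq_of_eq (map_cross inv σ [])).trans (crossE_one_heq σ))
  map_cap := eq_conj_of_heq _ _ ((heq_of_eq (map_cap inv σ [])).trans (capE_one_heq σ))
  map_cup := eq_conj_of_heq _ _ ((heq_of_eq (map_cup inv σ [])).trans (cupE_one_heq σ))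
  map_tok a := eq_conj_of_heq _ _ ((heq_of_eq (map_tok inv σ [] a)).trans (tokE_one_heq inv σ a))

variable {inv σ} in
theorem isBulb_unique {D D' : StrictMonoidalSuperfunctor k (Br inv σ).Cat (AddEnv (PiEnv (OB 𝒜).Cat))}
    (h : IsBulb inv σ D) (h' : IsBulb inv σ D') : D = D' := by
  -- Both superfunctors send a generator to transports of one fixed morphism, possibly along
  -- different equalities; such transports are heterogeneously equal.
  have conj : ∀ {X Y X' Y' X'' Y'' : AddEnv (PiEnv (OB 𝒜).Cat)} {f : X ⟶ Y} {f' : X' ⟶ Y'}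
      {g : X'' ⟶ Y''} {hX : X = X''} {hY : Y'' = Y} {hX' : X' = X''} {hY' : Y'' = Y'},
      f = eqToHom hX ≫ g ≫ eqToHom hY → f' = eqToHom hX' ≫ g ≫ eqToHom hY' → HEq f f' := by
    rintro _ _ _ _ _ _ f f' g rfl rfl rfl rfl rfl rfl
    rfl
  refine (Br inv σ).superfunctor_ext (fun | .dot => h.obj_dot.trans h'.obj_dot.symm) fun g => ?_
  cases g with
  | cross => exact conj h.map_cross h'.map_cross
  | cap => exact conj h.map_cap h'.map_cap
  | cup => exact conj h.map_cup h'.map_cup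
  | tok a => exact conj (h.map_tok a) (h'.map_tok a)

end Bulb

/-! ### The supertrace and the anti-involution -/

/-- Endomorphisms which are adjoint with respect to a nondegenerate form have the same trace. -/
theorem trace_eq_of_adjoint {k V : Type*} [Field k] [AddCommGroup V] [Module k V]
    [Module.Finite k V] {B : V →ₗ[k] V →ₗ[k] k} (hB : B.Nondegenerate) {f g : V →ₗ[k] V}
    (h : ∀ x y, B (f x) y = B x (g y)) : LinearMap.trace k V f = LinearMap.trace k V g := by
  have hi : Function.Injective B := LinearMap.ker_eq_bot.1 (LinearMap.separatingLeft_iff_ker_eq_bot.1 hB.1)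
  let e : V ≃ₗ[k] Module.Dual k V :=
    LinearEquiv.ofInjectiveOfFinrankEq B hi (Subspace.dual_finrank_eq (K := k) (V := V)).symm
  -- The form identifies the space with its dual, and adjointness says that this identification
  -- carries `f` to the transpose of `g`.
  have he : e.conj f = Module.Dual.transpose (R := k) g := by
    refine LinearMap.ext fun φ => ?_
    obtain ⟨x, rfl⟩ := e.surjective φ
    rw [LinearEquiv.conj_apply_apply, LinearEquiv.symm_apply_apply]
    exact LinearMap.ext (h x)
  rw [← LinearMap.trace_conj' f e, he]
  exact LinearMap.trace_transpose' g

section superalgebra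

variable {k : Type w} {A : Type v} [Field k] [Ring A] [Algebra k A]
  (𝒜 : ZMod 2 → Submodule k A) [GradedAlgebra 𝒜]

/-- The parity involution `a ↦ (-1) ^ (parity a) a`. -/
def parityInvolution : A →ₗ[k] A := GradedAlgebra.proj 𝒜 0 - GradedAlgebra.proj 𝒜 1

theorem parityInvolution_of_mem {p : ZMod 2} {a : A} (ha : a ∈ 𝒜 p) :
    parityInvolution 𝒜 a = sgn k p • a := by
  rw [parityInvolution, LinearMap.sub_apply, GradedAlgebra.proj_apply, GradedAlgebra.proj_apply]
  rcases zmod_two_cases p with rfl | rfl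
  · rw [DirectSum.decompose_of_mem_same 𝒜 ha, DirectSum.decompose_of_mem_ne 𝒜 ha (by decide)]
    simp
  · rw [DirectSum.decompose_of_mem_same 𝒜 ha, DirectSum.decompose_of_mem_ne 𝒜 ha (by decide)]
    simp [sgn]

theorem superTrace_eq (a : A) : superTrace 𝒜 a =
    LinearMap.trace k A (parityInvolution 𝒜 ∘ₗ LinearMap.mulRight k a) := rfl

@[elab_as_elim]
theorem graded_induction {P : A → Prop} (a : A) (hom : ∀ p, ∀ a ∈ 𝒜 p, P a)
    (add : ∀ a b, P a → P b → P (a + b)) : P a :=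
  DirectSum.Decomposition.inductionOn 𝒜 (motive := P) (hom 0 0 (Submodule.zero_mem _))
    (fun m => hom _ m m.2) add a

variable {𝒜} {inv : AntiInvolution 𝒜} {form : A →ₗ[k] k}

/-- If the parities of `x` and `y` differ, the product is odd and the form vanishes on it; if they
agree, both sides carry the same sign. -/
theorem form_parityInvolution_mul (h : ∀ a ∈ 𝒜 1, form a = 0) (x y : A) :
    form (parityInvolution 𝒜 x * y) = form (x * parityInvolution 𝒜 y) := by
  refine graded_induction 𝒜 x (fun p x hx => ?_) fun x x' hx hx' => by
    simp only [map_add, add_mul, hx, hx']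
  refine graded_induction 𝒜 y (fun q y hy => ?_) fun y y' hy hy' => by
    simp only [map_add, mul_add, hy, hy']
  rw [parityInvolution_of_mem 𝒜 hx, parityInvolution_of_mem 𝒜 hy, smul_mul_assoc, mul_smul_comm,
    map_smul, map_smul]
  have hxy : x * y ∈ 𝒜 (p + q) := SetLike.mul_mem_graded hx hy
  rcases zmod_two_cases p with rfl | rfl <;> rcases zmod_two_cases q with rfl | rfl
  · rfl
  · rw [h _ hxy, smul_zero, smul_zero]
  · rw [h _ hxy, smul_zero, smul_zero]
  · rfl

theorem AntiInvolution.parityInvolution_comm (inv : AntiInvolution 𝒜) (x : A) :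
    inv.toFun (parityInvolution 𝒜 x) = parityInvolution 𝒜 (inv.toFun x) := by
  refine graded_induction 𝒜 x (fun p x hx => ?_) fun x x' hx hx' => by
    simp only [map_add, hx, hx']
  rw [parityInvolution_of_mem 𝒜 hx, parityInvolution_of_mem 𝒜 (inv.map_mem hx), map_smul]

theorem AntiInvolution.map_even_mul (inv : AntiInvolution 𝒜) {a : A} (ha : a ∈ 𝒜 0) (x : A) :
    inv.toFun (a * x) = inv.toFun x * inv.toFun a := by
  refine graded_induction 𝒜 x (fun p x hx => ?_) fun x x' hx hx' => by
    simp only [map_add, mul_add, add_mul, hx, hx']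
  rw [inv.map_mul ha hx, zero_mul, sgn_zero, one_smul]

/-- In the presence of an even nondegenerate form the supertrace is invariant under the
anti-involution. -/
theorem superTrace_inv [Module.Finite k A] (even : ∀ a ∈ 𝒜 1, form a = 0)
    (nondeg : ((LinearMap.mul k A).compr₂ form).Nondegenerate) (inv : AntiInvolution 𝒜) {a : A}
    (ha : a ∈ 𝒜 0) : superTrace 𝒜 (inv.toFun a) = superTrace 𝒜 a := by
  have h₁ : superTrace 𝒜 (inv.toFun a) =
      LinearMap.trace k A (parityInvolution 𝒜 ∘ₗ LinearMap.mulLeft k a) := by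
    have e : parityInvolution 𝒜 ∘ₗ LinearMap.mulRight k (inv.toFun a) =
        inv.toFun ∘ₗ parityInvolution 𝒜 ∘ₗ LinearMap.mulLeft k a ∘ₗ inv.toFun := by
      refine LinearMap.ext fun x => ?_
      change parityInvolution 𝒜 (x * inv.toFun a) =
        inv.toFun (parityInvolution 𝒜 (a * inv.toFun x))
      rw [inv.parityInvolution_comm, inv.map_even_mul ha, inv.involutive]
    -- The two copies of `inv` meet by cyclicity of the trace and cancel.
    rw [superTrace_eq, e, LinearMap.trace_comp_comm']
    congr 1
    refine LinearMap.ext fun x => ?_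
    change parityInvolution 𝒜 (a * inv.toFun (inv.toFun x)) = parityInvolution 𝒜 (a * x)
    rw [inv.involutive]
  rw [h₁, LinearMap.trace_comp_comm', superTrace_eq]
  -- For the pairing given by the form of a product, associativity makes right and left
  -- multiplication by `a` adjoint, and the parity involution is self-adjoint.
  refine (trace_eq_of_adjoint nondeg fun x y => ?_).symm
  change form (parityInvolution 𝒜 (x * a) * y) = form (x * (a * parityInvolution 𝒜 y))
  rw [form_parityInvolution_mul even, mul_assoc]

end superalgebra

/-! ### Strict monoidal superfunctors between envelopes -/

section envelopes

variable {k : Type w} [Field k] {C D : Type*} [Category C] [Preadditive C] [Linear k C] [Monoid C]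
  [StrictMonoidalSupercategory k C] [Category D] [Preadditive D] [Linear k D] [Monoid D]
  [StrictMonoidalSupercategory k D] (F : StrictMonoidalSuperfunctor k C D)

/-- The strict monoidal superfunctor induced on `Π`-envelopes. -/
def PiEnv.mapSuperfunctor : StrictMonoidalSuperfunctor k (PiEnv C) (PiEnv D) where
  toFunctor := PiEnv.mapFunctor F.toFunctor
  map_add f g := PiEnv.hom_ext (F.map_add f.base g.base)
  map_smul c f := PiEnv.hom_ext (F.map_smul c f.base)
  map_mem hf := F.map_mem hf
  obj_one := PiEnv.ext rfl F.obj_one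
  obj_mul X Y := PiEnv.ext rfl (F.obj_mul X.obj Y.obj)
  map_tensor {X X' Y Y'} f g := by
    refine PiEnv.hom_ext ?_
    rw [PiEnv.comp_base, PiEnv.comp_base, PiEnv.eqToHom_base, PiEnv.eqToHom_base]
    change F.map (PiEnv.tensorBase k X.parity Y.parity Y'.parity f.base g.base) = _ ≫
      PiEnv.tensorBase k X.parity Y.parity Y'.parity (F.map f.base) (F.map g.base) ≫ _
    rw [PiEnv.tensorBase, PiEnv.tensorBase, F.map_smul, F.map_tensor, F.map_twist, F.map_twist]
    exact (_root_.map_smul (conjLinear k (F.obj_mul _ _) (F.obj_mul _ _).symm) _ _).symm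

/-- The strict monoidal superfunctor induced on additive envelopes. -/
def AddEnv.mapSuperfunctor : StrictMonoidalSuperfunctor k (AddEnv C) (AddEnv D) where
  toFunctor := AddEnv.mapFunctor F.toFunctor
  map_add f g := AddEnv.hom_ext fun i j => F.map_add (f.entry i j) (g.entry i j)
  map_smul c f := AddEnv.hom_ext fun i j => F.map_smul c (f.entry i j)
  map_mem hf := fun i j => F.map_mem (hf i j)
  obj_one := AddEnv.ext_cast rfl fun _ => F.obj_one
  obj_mul X Y := AddEnv.ext_cast rfl fun i => F.obj_mul (X.obj i.divNat) (Y.obj i.modNat)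
  map_tensor {X X' Y Y'} f g := AddEnv.hom_ext fun i j => by
    rw [AddEnv.conj_entry]
    exact F.map_tensor (f.entry i.divNat j.divNat) (g.entry i.modNat j.modNat)

end envelopes

/-! ### Values of bubbles and descent to the specialized categories. -/

namespace Bulb

open OBOb FreeHom AddEnv BrOb

variable {k : Type w} {A : Type v} [Field k] [Ring A] [Algebra k A]

section quotient

variable (𝒜 : ZMod 2 → Submodule k A) [GradedAlgebra 𝒜] (d : k)

/-- The superfunctor between envelopes induced by the specialization of bubbles. -/
def specialize : StrictMonoidalSuperfunctor k (AddEnv (PiEnv (OB 𝒜).Cat))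
    (AddEnv (PiEnv (OBd 𝒜 d).Cat)) :=
  AddEnv.mapSuperfunctor (PiEnv.mapSuperfunctor
    (Presentation.quotientSuperfunctor (P := OB 𝒜) (Q := OBd 𝒜 d) fun h => Or.inl h))

/-- The bubble with a token. -/
def bubble {p : ZMod 2} (a : 𝒜 p) : (1 : (OB 𝒜).Cat) ⟶ 1 :=
  OB.rightCup 𝒜 1 ≫ (OB.F 𝒜 down).map (OB.tok 𝒜 a 1) ≫ OB.leftCap 𝒜 1

/-- The downward token moves across the right cap to the `↑` strand; the resulting clockwise bubble
equals the counterclockwise one, so the bubble relation also evaluates it. -/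
theorem cup_dtok_cap {p : ZMod 2} (a : 𝒜 p) :
    OB.leftCup 𝒜 1 ≫ (OB.F 𝒜 up).map (OB.dtok 𝒜 a 1) ≫ OB.rightCap 𝒜 1 = bubble 𝒜 a := by
  rw [OB.td_rightCap, ← OB.capR_eq, bubble, ← OB.cupR_eq]
  exact (OB.token 𝒜 a).clockwise_bubble 1

theorem quotient_bubble {p : ZMod 2} (a : 𝒜 p) :
    (OB.quotient 𝒜 d).map (bubble 𝒜 a) = (d * superTrace 𝒜 (a : A)) • 𝟙 (1 : (OBd 𝒜 d).Cat) := by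
  have e : bubble 𝒜 a = (OB 𝒜).ofDiag (obComp 𝒜 (Y := [down, up]) (obLayer 𝒜 [] .rightCup []) <|
      obComp 𝒜 (Y := [down, up]) (obLayer 𝒜 [down] (.tok a) []) <| obLayer 𝒜 [] .leftCap []) := by
    have e₁ : (OB.F 𝒜 down).map (OB.tok 𝒜 a 1) =
        (OB 𝒜).ofDiag (X := [down, up]) (Y := [down, up]) (obLayer 𝒜 [down] (.tok a) []) :=
      congrArg (OB 𝒜).ofDiag (FreeHom.whiskerL_single (S := OBSig 𝒜) [down] _ _)
    rw [bubble, e₁]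
    rfl
  rw [e]
  -- The bubble is now written literally as the diagram that appears in the additional relation.
  exact ((OBd 𝒜 d).ofDiag_eq_iff _ _).2 (.rel (Or.inr (.bubble a)))

theorem specialize_bubble (σ : ZMod 2) {p : ZMod 2} (a : 𝒜 p) :
    (specialize 𝒜 d).map (shiftMap 𝒜 σ (bubble 𝒜 a)) =
      (d * superTrace 𝒜 (a : A)) • 𝟙 ((specialize 𝒜 d).obj (shift 𝒜 σ 1)) := by
  have e : (specialize 𝒜 d).map (shiftMap 𝒜 σ ((d * superTrace 𝒜 (a : A)) • 𝟙 (1 : (OB 𝒜).Cat))) =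
      (d * superTrace 𝒜 (a : A)) • 𝟙 ((specialize 𝒜 d).obj (shift 𝒜 σ 1)) := by
    rw [shiftMap_smul, shiftMap_id, (specialize 𝒜 d).map_smul, (specialize 𝒜 d).map_id]
  refine Eq.trans ?_ e
  refine AddEnv.hom_ext fun i j => PiEnv.hom_ext ?_
  exact quotient_bubble 𝒜 d a

end quotient

variable {𝒜 : ZMod 2 → Submodule k A} [GradedAlgebra 𝒜] (inv : AntiInvolution 𝒜) (σ : ZMod 2)

/-- The cup produces two closed loops. The `↑ ↓` loop carries the token on its `↓` leg and
contributes `inv a`; the `↓ ↑` loop carries `a` itself, with the extra sign of the cup. -/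
theorem comp_cupE_tokE_capE {Y : AddEnv (PiEnv (OB 𝒜).Cat)} {h : shift 𝒜 σ 1 ⟶ Y}
    (hh : h ∈ homParity (k := k) (shift 𝒜 σ (1 : (OB 𝒜).Cat)) Y 0) {p : ZMod 2} (a : 𝒜 p) :
    h ≫ cupE 𝒜 σ Y ≫ tensorHom (k := k) (𝟙 (dotImage 𝒜 σ)) (tokE inv σ a Y) ≫ capE 𝒜 σ Y =
      sgn k (p * σ) • (shiftMap 𝒜 σ (bubble 𝒜 (inv.app a)) +
        sgn k σ • shiftMap 𝒜 σ (bubble 𝒜 a)) ≫ h := by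
  have e₁ : OB.leftCup 𝒜 1 ≫ (OB.F 𝒜 up).map (tok inv a down 1) ≫ cap 𝒜 up down 1 =
    bubble 𝒜 (inv.app a) := cup_dtok_cap 𝒜 (inv.app a)
  have e₂ : OB.rightCup 𝒜 1 ≫ (OB.F 𝒜 down).map (tok inv a up 1) ≫ cap 𝒜 down up 1 =
    bubble 𝒜 a := rfl
  rw [cupE_comp σ hh, cons_comp_comp, cons_tokE 𝒜 inv σ hh, cons_smul, cons_tok, Linear.smul_comp,
    Linear.smul_comp, Category.assoc, cons_cons_capE 𝒜 σ hh, cons_comp_comp,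
    cons_tokE 𝒜 inv σ hh, cons_smul, cons_tok, Linear.smul_comp, Linear.smul_comp, Category.assoc,
    cons_cons_capE 𝒜 σ hh]
  simp only [Linear.comp_smul, smul_smul, shiftMap_comp_comp, ← sgn_add]
  rw [e₁, e₂, Preadditive.add_comp, Linear.smul_comp, smul_add, smul_smul, ← sgn_add]
  congr 3
  · change p * (σ + 0) + 0 * p = p * σ
    ring
  · change σ + (p * (0 + 0) + σ * p) = p * σ + σ
    ring

theorem cupE_tokE_capE {p : ZMod 2} (a : 𝒜 p) :
    cupE 𝒜 σ 1 ≫ tensorHom (k := k) (𝟙 (dotImage 𝒜 σ)) (tokE inv σ a 1) ≫ capE 𝒜 σ 1 =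
      sgn k (p * σ) • (shiftMap 𝒜 σ (bubble 𝒜 (inv.app a)) +
        sgn k σ • shiftMap 𝒜 σ (bubble 𝒜 a)) := by
  -- The shifted empty word is definitionally the unit object, so the identity is an admissible test
  -- morphism.
  refine (Category.id_comp _).symm.trans ((comp_cupE_tokE_capE (Y := 1) inv σ (h := 𝟙 _)
    (Supercategory.id_mem (k := k) (1 : AddEnv (PiEnv (OB 𝒜).Cat))) a).trans ?_)
  exact congrArg _ (Category.comp_id _)

/-- For even `a` and `σ = 0` the two equal supertraces add up, which is where the factor `2` comes
from; for even `a` and `σ = 1` both sides vanish since `d = 0`; for odd `a` all supertraces vanish.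
-/
theorem scalar_add_sgn_mul_scalar {p : ZMod 2} {a : 𝒜 p} {d : k}
    (hd : σ = 1 → d = 0) (h : p = 0 → superTrace 𝒜 (inv.app a : A) = superTrace 𝒜 (a : A)) :
    sgn k (p * σ) * (d * superTrace 𝒜 (inv.app a : A) + sgn k σ * (d * superTrace 𝒜 (a : A))) =
      2 * d * superTrace 𝒜 (a : A) := by
  rcases zmod_two_cases p with rfl | rfl
  · rw [h rfl, zero_mul, sgn_zero]
    rcases zmod_two_cases σ with rfl | rfl
    · rw [sgn_zero]
      ring
    · rw [hd rfl]
      ring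
  · rw [superTrace_odd 𝒜 a.2, superTrace_odd 𝒜 (inv.app a).2]
    ring

variable {inv σ}

/-- The old relations hold already before specialization; the new one follows from the value of the
bubble and the invariance of the supertrace. -/
theorem comp_specialize_respects {d : k} (hd : σ = 1 → d = 0)
    (hstr : ∀ a ∈ 𝒜 0, superTrace 𝒜 (inv.toFun a) = superTrace 𝒜 a)
    ⦃X Y : List (BrSig 𝒜 σ).Ob⦄ ⦃f g : FreeHom k (BrSig 𝒜 σ) X Y⦄
    (h : (Brd inv σ (2 * d)).Rel f g) :
    ((functor inv σ).comp (specialize 𝒜 d)).map ((Br inv σ).ofDiag f) =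
      ((functor inv σ).comp (specialize 𝒜 d)).map ((Br inv σ).ofDiag g) := by
  rcases h with h | h
  · exact congrArg (specialize 𝒜 d).map (genData_respects inv σ h)
  cases h with
  | @bubble p a =>
    have e₁ := map_brComp (map_cup inv σ []) (map_brComp (map_dot_tok inv σ [] a)
      (map_cap inv σ []))
    refine (congrArg (specialize 𝒜 d).map (e₁.trans (cupE_tokE_capE inv σ a))).trans ?_
    have hp : p = 0 → superTrace 𝒜 (inv.app a : A) = superTrace 𝒜 (a : A) := by
      rintro rfl
      exact hstr a a.2
    have e₂ : (specialize 𝒜 d).map (sgn k (p * σ) • (shiftMap 𝒜 σ (bubble 𝒜 (inv.app a)) +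
        sgn k σ • shiftMap 𝒜 σ (bubble 𝒜 a))) =
        (2 * d * superTrace 𝒜 (a : A)) • 𝟙 ((specialize 𝒜 d).obj (shift 𝒜 σ 1)) := by
      rw [(specialize 𝒜 d).map_smul, (specialize 𝒜 d).map_add, (specialize 𝒜 d).map_smul,
        specialize_bubble, specialize_bubble, smul_smul, ← add_smul, smul_smul,
        scalar_add_sgn_mul_scalar inv σ hd hp]
    refine e₂.trans ?_
    have e₃ : (functor inv σ).map ((Br inv σ).ofDiag
        ((2 * d * superTrace 𝒜 (a : A)) • brId (𝒜 := 𝒜) (σ := σ) [])) =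
        (2 * d * superTrace 𝒜 (a : A)) • 𝟙 (1 : AddEnv (PiEnv (OB 𝒜).Cat)) :=
      (_root_.map_smul (genData inv σ).map _ _).trans (congrArg _ ((genData inv σ).map_id []))
    refine Eq.trans ?_ (congrArg (specialize 𝒜 d).map e₃).symm
    refine Eq.trans ?_ ((specialize 𝒜 d).map_smul _ _).symm
    exact congrArg _ ((specialize 𝒜 d).map_id 1).symm

end Bulb

end SuperBrauer

end

theorem mainTheorem4 {k A : Type*} [Field k] [Ring A] [Algebra k A]
    (𝒜 : ZMod 2 → Submodule k A) [GradedAlgebra 𝒜] (inv : AntiInvolution 𝒜) (σ : ZMod 2) :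
    ∃ D : StrictMonoidalSuperfunctor k (Br inv σ).Cat (AddEnv (PiEnv (OB 𝒜).Cat)),
      IsBulb inv σ D ∧ (∀ D', IsBulb inv σ D' → D' = D) ∧
      (Module.Finite k A → (∃ form : A →ₗ[k] k, IsInvolutiveFrobenius 𝒜 inv form) →
        ∀ d : k, (σ = 1 → d = 0) →
          ∃! Dd : StrictMonoidalSuperfunctor k (Brd inv σ (2 * d)).Cat
              (AddEnv (PiEnv (OBd 𝒜 d).Cat)),
            Br.quotient inv σ (2 * d) ⋙ Dd.toFunctor =
              D.toFunctor ⋙ AddEnv.mapFunctor (PiEnv.mapFunctor (OB.quotient 𝒜 d))) := by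
  refine ⟨Bulb.functor inv σ, Bulb.functor_isBulb inv σ,
    fun D' h => Bulb.isBulb_unique h (Bulb.functor_isBulb inv σ), ?_⟩
  rintro hfin ⟨form, hform⟩ d hd
  have hresp := Bulb.comp_specialize_respects hd fun a ha =>
    superTrace_inv (fun _ h => hform.even h) hform.nondegenerate inv ha
  have e := Presentation.quotient_comp_descend (P := Br inv σ) (Q := Brd inv σ (2 * d))
    (fun h => Or.inl h) hresp
  -- The functor underlying `Bulb.specialize` unfolds to the one required on the envelopes, so `e`
  -- is the factorization asked for.
  exact ⟨Presentation.descend _ hresp, e, fun _ h =>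
    Presentation.quotient_cancel (P := Br inv σ) (fun h => Or.inl h) (h.trans e.symm)⟩
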